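/- **Setting.** Let $d\in\mathbb N$, $\beta\ge 0$, and let $(\Omega,\mathcal F,\mathbb P)$ be an atomless probability space. Write $L^2=L^2(\Omega;\mathbb R^d)$, $\mathcal L(X)$ for the law of $X\in L^2$, and $\mathcal P_p(\mathbb R^d)$ for the Borel probability measures on $\mathbb R^d$ with finite $p$-th moment, with the Wasserstein distance $\mathbf d_p$ ($p=1,2$). Let $H=H(p,x)\in C^1(\mathbb R^d\times\mathbb R^d;\mathbb R)$ be such that for every $r$ there is $C_r$ with $|D_pH(p,x)|\le C_r(1+|x|)$ for all $x$ and all $|p|\le r$, and let $F\in C(\mathbb R^d\times\mathcal P_1(\mathbb R^d);\mathbb R)$. The master equation with right-hand side $R:\mathbb R^d\times\mathcal P_2(\mathbb R^d)\to\mathbb R$ is $$ \begin{aligned} &U(x,m)-\beta\Delta_x U(x,m)+H(D_xU(x,m),x)+\int D_mU(x,m,y)\cdot D_pH(D_xU(y,m),y)\,m(dy)\\ &-\beta\Big(\int \mathrm{Tr}\,D^2_{ym}U(x,m,y)\,m(dy)+2\int \mathrm{Tr}\,D^2_{xm}U(x,m,y)\,m(dy)+\iint \mathrm{Tr}\,D^2_{mm}U(x,m,y,y')\,m(dy)m(dy')\Big)=R(x,m),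 \end{aligned} $$ and (ME2) is the case $R=F$. *Derivatives in $m$.* A map $V$ on $\mathcal P_2(\mathbb R^d)$ has derivative $D_mV(m,\cdot)$ at $m$ if, for every $X\in L^2$ with law $m$, $D_mV(m,X)$ is square integrable and the lift $Z\mapsto V(\mathcal L(Z))$ is Fréchet differentiable on $L^2$ at $X$ with derivative $Z\mapsto\mathbb E[D_mV(m,X)\,Z]$. Set $D^2_{ym}U=D_yD_mU$, $D^2_{xm}U=D_xD_mU$, and let $D^2_{mm}U(x,m,y,\cdot)$ be the derivative in $m$ of $D_mU(x,m,y)$. We say that $U$ *has continuous derivatives* if $U(\cdot,m)$ is $C^2$ for each $m$; the derivatives $D_xU,D^2_{xx}U,D_mU,D^2_{ym}U,D^2_{xm}U,D^2_{mm}U$ exist everywhere; they and $U$ are jointly continuous in all their variables; and each $(x_0,m_0)$ has a neighbourhood and a constant $C$ such that, for $(x,m)$ in the neighbourhood and all $y,y'$: $|D_mU|+|D^2_{xm}U|\le C(1+|y|)$, $|D^2_{ym}U|\le C(1+|y|^2)$, $|D^2_{mm}U|\le C(1+|y|)(1+|y'|)$. Such a $U$ is a *classical solution* of the master equation with right-hand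 side $R$ if moreover all integrals in the equation converge absolutely and the equation holds at every $(x,m)\in\mathbb R^d\times\mathcal P_2(\mathbb R^d)$. *Weak solutions.* Let $L^\infty_{ac}$ be the set of $X\in L^2$ whose law is absolutely continuous with respect to the Lebesgue measure $\lambda$ with bounded density, and set $N(X)=\|d\mathcal L(X)/d\lambda\|_\infty$. Put $\hat U(X,Y)=\mathbb E[U(X,\mathcal L(X))-U(Y,\mathcal L(X))]$ on $L^2\times L^2$, and $\hat U^\varepsilon=\hat U+\varepsilon N(X)$ on $L^\infty_{ac}\times L^2$. For $z_0\in L^\infty_{ac}\times L^2$ let $D^{2,-}\hat U^\varepsilon(z_0)$ be the set of $(\mathcal X,p)$, with $\mathcal X$ a bounded bilinear form on $L^2\times L^2$ and $p\in L^2\times L^2$, such that $$\liminf_{z\to z_0,\ z\in L^\infty_{ac}\times L^2}\|z-z_0\|^{-2}\Big(\hat U^\varepsilon(z)-\hat U^\varepsilon(z_0)-\langle p,z-z_0\rangle-\tfrac12\mathcal X(z-z_0,z-z_0)\Big)\ge 0,$$ and let $\bar D^{2,-}\hat U^\varepsilon(z)$ be the set of limits of $(\mathcal X_n,p_n)\in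 D^{2,-}\hat U^\varepsilon(z_n)$ with $z_n\in L^\infty_{ac}\times L^2$, $z_n\to z$ and $\hat U^\varepsilon(z_n)\to\hat U^\varepsilon(z)$. With $e_1,\dots,e_d$ the canonical basis of $\mathbb R^d$, seen as constant random variables, let $\Lambda(\mathcal X)=\sum_{k=1}^d\mathcal X((e_k,e_k),(e_k,e_k))$. A bounded continuous $U:\mathbb R^d\times\mathcal P_2(\mathbb R^d)\to\mathbb R$ is a *weak solution* of (ME2) if it is Lipschitz continuous and semiconcave in $x$, uniformly in $m$, and there is $C>0$ such that for all $(X,Y)\in L^\infty_{ac}\times L^2$, $\varepsilon\in(0,1)$ and $(\mathcal X,(p_X,p_Y))\in\bar D^{2,-}\hat U^\varepsilon(X,Y)$ for which the random variables under the three expectations written below are integrable, $$ \begin{aligned} 0\le{}&\hat U(X,Y)-\beta\Lambda(\mathcal X)-\mathbb E[F(X,\mathcal L(X))-F(Y,\mathcal L(X))]+\mathbb E[H(D_xU(X,\mathcal L(X)),X)-H(-p_Y,Y)]\\ &-\mathbb E[(D_xU(X,\mathcal L(X))-p_X)\cdot D_pH(D_xU(X,\mathcal L(X)),X)]+C\varepsilon(1+N(X)).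 \end{aligned} $$ **Proposition.** If $U$ is a weak solution of (ME2) and has continuous derivatives, then there is a continuous function $g:\mathcal P_2(\mathbb R^d)\to\mathbb R$ such that $U$ is a classical solution of the master equation with right-hand side $F(x,m)+g(m)$. -/

import Mathlib

open MeasureTheory Filter Topology Set

noncomputable section

namespace MasterEq

/-- The Euclidean space `ℝᵈ`. -/
abbrev E (d : ℕ) := EuclideanSpace ℝ (Fin d)

/-- `P_p(ℝᵈ)`: Borel probability measures on `ℝᵈ` with finite moment of order `p`. -/
@[ext] structure PSpace (d p : ℕ) where
  toMeasure : Measure (E d)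
  isProb : IsProbabilityMeasure toMeasure
  moment_lt_top : ∫⁻ x, ‖x‖ₑ ^ p ∂toMeasure < ⊤

/-- The Wasserstein distance `d_p`: infimum over all couplings `π` of `m` and `m'` of
`(∫ |x - y|^p π(dx,dy))^(1/p)`. -/
def wdist {d p : ℕ} (m m' : PSpace d p) : ENNReal :=
  ⨅ π : {π : Measure (E d × E d) //
      π.map Prod.fst = m.toMeasure ∧ π.map Prod.snd = m'.toMeasure},
    (∫⁻ z, edist z.1 z.2 ^ p ∂π.1) ^ (1 / (p : ℝ))

/-- The topology of the Wasserstein distance: a set is open iff it contains a `d_p`-ball around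
each of its points. -/
instance {d p : ℕ} : TopologicalSpace (PSpace d p) where
  IsOpen s := ∀ m ∈ s, ∃ r : ENNReal, 0 < r ∧ ∀ m', wdist m m' < r → m' ∈ s
  isOpen_univ := fun _ _ => ⟨1, one_pos, fun _ _ => mem_univ _⟩
  isOpen_inter := by
    rintro s t hs ht m ⟨hms, hmt⟩
    obtain ⟨r, hr, h⟩ := hs m hms
    obtain ⟨r', hr', h'⟩ := ht m hmt
    exact ⟨min r r', lt_min hr hr', fun m' hm' =>
      ⟨h m' (hm'.trans_le (min_le_left _ _)), h' m' (hm'.trans_le (min_le_right _ _))⟩⟩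
  isOpen_sUnion := by
    rintro S hS m ⟨s, hsS, hms⟩
    obtain ⟨r, hr, h⟩ := hS s hsS m hms
    exact ⟨r, hr, fun m' hm' => ⟨s, hsS, h m' hm'⟩⟩

/-- The inclusion `P_2(ℝᵈ) ⊆ P_1(ℝᵈ)`. -/
def PSpace.toP1 {d : ℕ} (m : PSpace d 2) : PSpace d 1 where
  toMeasure := m.toMeasure
  isProb := m.isProb
  moment_lt_top := by
    have := m.isProb
    have hle : ∀ x : E d, ‖x‖ₑ ^ 1 ≤ 1 + ‖x‖ₑ ^ 2 := by
      intro x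
      rw [pow_one]
      rcases le_total ‖x‖ₑ 1 with h | h
      · exact h.trans le_self_add
      · exact (le_self_pow₀ h two_ne_zero).trans le_add_self
    refine (lintegral_mono hle).trans_lt ?_
    rw [lintegral_add_left measurable_const]
    simpa using m.moment_lt_top

/-- A measure is atomless if every measurable set of positive measure has a measurable subset
of strictly smaller positive measure. -/
def Atomless {Ω : Type*} [MeasurableSpace Ω] (P : Measure Ω) : Prop :=
  ∀ A, MeasurableSet A → 0 < P A → ∃ B, MeasurableSet B ∧ B ⊆ A ∧ 0 < P B ∧ P B < P A

section HilbertSpace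

variable {Ω : Type*} [MeasurableSpace Ω] {d : ℕ}

/-- The Hilbert space `L² = L²(Ω; ℝᵈ)`. -/
abbrev L2 (P : Measure Ω) (d : ℕ) := Lp (E d) 2 P

/-- The Hilbert space `L² × L²`. -/
abbrev L2Pair (P : Measure Ω) (d : ℕ) := WithLp 2 (L2 P d × L2 P d)

variable {P : Measure Ω} [IsProbabilityMeasure P]

/-- The law `ℒ(X)` of `X ∈ L²`, as an element of `P_2(ℝᵈ)`. -/
def law (X : L2 P d) : PSpace d 2 where
  toMeasure := P.map X
  isProb := Measure.isProbabilityMeasure_map (Lp.stronglyMeasurable X).measurable.aemeasurable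
  moment_lt_top := by
    rw [lintegral_map (by fun_prop) (Lp.stronglyMeasurable X).measurable]
    have h := lintegral_rpow_enorm_lt_top_of_eLpNorm_lt_top two_ne_zero ENNReal.ofNat_ne_top
      (Lp.memLp X).2
    simpa using h

/-- Lions differentiability, with derivative `Ψ : ℝᵈ → L(ℝᵈ, G)` at `m`, of a map `V` on
`P_2(ℝᵈ)` with values in `G`: the lift `X ↦ V(ℒ(X))` is Fréchet differentiable on `L²` at each `X`
with law `m`, its derivative there being `Z ↦ 𝔼[Ψ(X) Z]` with `Ψ(X)` square integrable. -/
def HasLDerivAt (P : Measure Ω) [IsProbabilityMeasure P] {G : Type*} [NormedAddCommGroup G]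
    [NormedSpace ℝ G] (V : PSpace d 2 → G) (Ψ : E d → E d →L[ℝ] G) (m : PSpace d 2) : Prop :=
  ∀ X : L2 P d, law X = m → MemLp (fun ω => Ψ (X ω)) 2 P ∧
    ∃ T : L2 P d →L[ℝ] G, (∀ Z : L2 P d, T Z = ∫ ω, Ψ (X ω) (Z ω) ∂P) ∧
      HasFDerivAt (fun Z : L2 P d => V (law Z)) T X

/-- The second-order subdifferential `D^{2,-} φ(x₀)` of a function `φ` defined on a subset `S` of
a Hilbert space (equivalently, extended by `+∞` outside `S`): the condition reads
`liminf |x - x₀|⁻² (φ(x) - φ(x₀) - ⟨p, x - x₀⟩ - ½ 𝒳(x - x₀, x - x₀)) ≥ 0` as `x → x₀`, `x ∈ S`. -/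
def subjet {K : Type*} [NormedAddCommGroup K] [InnerProductSpace ℝ K] (S : Set K) (φ : K → ℝ)
    (x₀ : K) : Set ((K →L[ℝ] K →L[ℝ] ℝ) × K) :=
  {q | ∀ δ : ℝ, 0 < δ → ∀ᶠ x in 𝓝[S] x₀,
    -δ * ‖x - x₀‖ ^ 2 ≤
      φ x - φ x₀ - inner ℝ q.2 (x - x₀) - 1 / 2 * q.1 (x - x₀) (x - x₀)}

/-- The closed second-order subdifferential `D̄^{2,-} φ(x)`. -/
def closedSubjet {K : Type*} [NormedAddCommGroup K] [InnerProductSpace ℝ K] (S : Set K)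
    (φ : K → ℝ) (x : K) : Set ((K →L[ℝ] K →L[ℝ] ℝ) × K) :=
  {q | ∃ (xs : ℕ → K) (qs : ℕ → (K →L[ℝ] K →L[ℝ] ℝ) × K),
    (∀ n, xs n ∈ S ∧ qs n ∈ subjet S φ (xs n)) ∧
    Tendsto xs atTop (𝓝 x) ∧ Tendsto qs atTop (𝓝 q) ∧
    Tendsto (fun n => φ (xs n)) atTop (𝓝 (φ x))}

/-- `L^∞_ac`: the random variables of `L²` whose law has a bounded density. -/
def LInftyAc (P : Measure Ω) [IsProbabilityMeasure P] (d : ℕ) : Set (L2 P d) :=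
  {X | (law X).toMeasure ≪ volume ∧
    essSup ((law X).toMeasure.rnDeriv volume) volume < ⊤}

/-- `‖dℒ(X)/dλ‖_∞`. -/
def densNorm (X : L2 P d) : ℝ :=
  (essSup ((law X).toMeasure.rnDeriv volume) volume).toReal

/-- `Û(X,Y) = 𝔼[U(X,ℒ(X)) - U(Y,ℒ(X))]`. -/
def hatU (U : E d → PSpace d 2 → ℝ) (z : L2Pair P d) : ℝ :=
  ∫ ω, (U (z.fst ω) (law z.fst) - U (z.snd ω) (law z.fst)) ∂P

/-- `Û^ε(X,Y) = Û(X,Y) + ε ‖dℒ(X)/dλ‖_∞`, to be considered on `L^∞_ac × L²`. -/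
def hatUeps (U : E d → PSpace d 2 → ℝ) (ε : ℝ) (z : L2Pair P d) : ℝ :=
  hatU U z + ε * densNorm z.fst

/-- The pair `(e_k, e_k)` of constant random variables. -/
def constPair (P : Measure Ω) [IsProbabilityMeasure P] (k : Fin d) : L2Pair P d :=
  WithLp.toLp 2 (Lp.const 2 P (EuclideanSpace.single k (1 : ℝ)),
    Lp.const 2 P (EuclideanSpace.single k (1 : ℝ)))

/-- `Λ(𝒳) = ∑ₖ 𝒳((e_k,e_k),(e_k,e_k))`. -/
def Lam (𝒳 : L2Pair P d →L[ℝ] L2Pair P d →L[ℝ] ℝ) : ℝ :=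
  ∑ k : Fin d, 𝒳 (constPair P k) (constPair P k)

end HilbertSpace

variable {d : ℕ}

/-- `D_x U(x,m)`. -/
def Dx (U : E d → PSpace d 2 → ℝ) (x : E d) (m : PSpace d 2) : E d :=
  gradient (fun x' => U x' m) x

/-- `D_p H(p,x)`. -/
def Dp (H : E d → E d → ℝ) (p x : E d) : E d :=
  gradient (fun p' => H p' x) p

/-- The trace of an endomorphism of `ℝᵈ`. -/
def tr (A : E d →L[ℝ] E d) : ℝ := LinearMap.trace ℝ (E d) (A : E d →ₗ[ℝ] E d)

/-- Weak solutions of the master equation. The inequality is required whenever the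
three expectations of coupling and Hamiltonian terms in it are those of integrable
random variables. -/
structure IsWeakSolution {Ω : Type*} [MeasurableSpace Ω] (P : Measure Ω) [IsProbabilityMeasure P]
    (β : ℝ) (H : E d → E d → ℝ) (F : E d → PSpace d 1 → ℝ) (U : E d → PSpace d 2 → ℝ) :
    Prop where
  bounded : ∃ C : ℝ, ∀ x m, |U x m| ≤ C
  continuous : Continuous fun q : E d × PSpace d 2 => U q.1 q.2
  lipschitz : ∃ L : NNReal, ∀ m, LipschitzWith L fun x => U x m
  semiconcave : ∃ K : ℝ, ∀ m, ConcaveOn ℝ univ fun x => U x m - K * ‖x‖ ^ 2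
  subjet_ineq : ∃ C : ℝ, 0 < C ∧ ∀ X ∈ LInftyAc P d, ∀ Y : L2 P d, ∀ ε ∈ Ioo (0 : ℝ) 1,
    ∀ (𝒳 : L2Pair P d →L[ℝ] L2Pair P d →L[ℝ] ℝ) (pX pY : L2 P d),
    (𝒳, WithLp.toLp 2 (pX, pY)) ∈
        closedSubjet {z : L2Pair P d | z.fst ∈ LInftyAc P d} (hatUeps U ε)
          (WithLp.toLp 2 (X, Y)) →
    Integrable (fun ω => F (X ω) (law X).toP1 - F (Y ω) (law X).toP1) P →
    Integrable (fun ω => H (Dx U (X ω) (law X)) (X ω) - H (-(pY ω)) (Y ω)) P →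
    Integrable (fun ω => (inner ℝ (Dx U (X ω) (law X) - pX ω)
      (Dp H (Dx U (X ω) (law X)) (X ω)) : ℝ)) P →
    0 ≤ hatU U (WithLp.toLp 2 (X, Y)) - β * Lam 𝒳
      - ∫ ω, (F (X ω) (law X).toP1 - F (Y ω) (law X).toP1) ∂P
      + ∫ ω, (H (Dx U (X ω) (law X)) (X ω) - H (-(pY ω)) (Y ω)) ∂P
      - ∫ ω, inner ℝ (Dx U (X ω) (law X) - pX ω) (Dp H (Dx U (X ω) (law X)) (X ω)) ∂P
      + C * ε * (1 + densNorm X)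

/-- `U` has the continuous derivatives `D_x U`, `D²_xx U`, `D_m U(x,m,y)`,
`D²_ym U(x,m,y) = D_y D_m U`, `D²_xm U(x,m,y) = D_x D_m U` and
`D²_mm U(x,m,y,y') = D_m (D_m U(·,·,y))`, the measure derivatives (Lions derivatives) having,
locally uniformly in `(x,m)`, the growth in `y, y'` under which the integrals of the master
equation converge for measures in `P_2(ℝᵈ)`. -/
structure HasContDerivs {Ω : Type*} [MeasurableSpace Ω] (P : Measure Ω) [IsProbabilityMeasure P]
    (U : E d → PSpace d 2 → ℝ)
    (DmU : E d → PSpace d 2 → E d → E d)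
    (DymU DxmU : E d → PSpace d 2 → E d → E d →L[ℝ] E d)
    (DmmU : E d → PSpace d 2 → E d → E d → E d →L[ℝ] E d) : Prop where
  contDiff_x : ∀ m, ContDiff ℝ 2 fun x => U x m
  cont_U : Continuous fun q : E d × PSpace d 2 => U q.1 q.2
  cont_Dx : Continuous fun q : E d × PSpace d 2 => Dx U q.1 q.2
  cont_Dxx : Continuous fun q : E d × PSpace d 2 => fderiv ℝ (fun x => Dx U x q.2) q.1
  hasDeriv_m : ∀ x m, HasLDerivAt P (fun m' => U x m') (fun y => innerSL ℝ (DmU x m y)) m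
  hasDeriv_ym : ∀ x m y, HasFDerivAt (fun y' => DmU x m y') (DymU x m y) y
  hasDeriv_xm : ∀ x m y, HasFDerivAt (fun x' => DmU x' m y) (DxmU x m y) x
  hasDeriv_mm : ∀ x m y, HasLDerivAt P (fun m' => DmU x m' y) (fun y' => DmmU x m y y') m
  cont_Dm : Continuous fun q : E d × PSpace d 2 × E d => DmU q.1 q.2.1 q.2.2
  cont_Dym : Continuous fun q : E d × PSpace d 2 × E d => DymU q.1 q.2.1 q.2.2
  cont_Dxm : Continuous fun q : E d × PSpace d 2 × E d => DxmU q.1 q.2.1 q.2.2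
  cont_Dmm : Continuous fun q : E d × PSpace d 2 × E d × E d =>
    DmmU q.1 q.2.1 q.2.2.1 q.2.2.2
  growth : ∀ x₀ m₀, ∃ C : ℝ, ∀ᶠ q : E d × PSpace d 2 in 𝓝 (x₀, m₀), ∀ y y' : E d,
    ‖DmU q.1 q.2 y‖ ≤ C * (1 + ‖y‖) ∧
    ‖DymU q.1 q.2 y‖ ≤ C * (1 + ‖y‖ ^ 2) ∧
    ‖DxmU q.1 q.2 y‖ ≤ C * (1 + ‖y‖) ∧
    ‖DmmU q.1 q.2 y y'‖ ≤ C * (1 + ‖y‖) * (1 + ‖y'‖)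

/-- `U`, with the derivatives `DmU, DymU, DxmU, DmmU`, is a classical solution of the master
equation with right-hand side `R(x,m)`: the derivatives exist and are continuous, the integrals
converge, and the equation holds at every `(x,m)`. -/
structure IsClassicalSolution {Ω : Type*} [MeasurableSpace Ω] (P : Measure Ω)
    [IsProbabilityMeasure P] (β : ℝ) (H : E d → E d → ℝ) (R : E d → PSpace d 2 → ℝ)
    (U : E d → PSpace d 2 → ℝ)
    (DmU : E d → PSpace d 2 → E d → E d)
    (DymU DxmU : E d → PSpace d 2 → E d → E d →L[ℝ] E d)
    (DmmU : E d → PSpace d 2 → E d → E d → E d →L[ℝ] E d) : Prop where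
  derivs : HasContDerivs P U DmU DymU DxmU DmmU
  integrable_drift : ∀ x m, Integrable
    (fun y => (inner ℝ (DmU x m y) (Dp H (Dx U y m) y) : ℝ)) m.toMeasure
  integrable_ym : ∀ x m, Integrable (fun y => tr (DymU x m y)) m.toMeasure
  integrable_xm : ∀ x m, Integrable (fun y => tr (DxmU x m y)) m.toMeasure
  integrable_mm : ∀ x m, Integrable (fun z : E d × E d => tr (DmmU x m z.1 z.2))
    (m.toMeasure.prod m.toMeasure)
  equation : ∀ x m,
    U x m - β * Laplacian.laplacian (fun x' => U x' m) x + H (Dx U x m) x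
      + ∫ y, inner ℝ (DmU x m y) (Dp H (Dx U y m) y) ∂m.toMeasure
      - β * (∫ y, tr (DymU x m y) ∂m.toMeasure
        + 2 * ∫ y, tr (DxmU x m y) ∂m.toMeasure
        + ∫ z : E d × E d, tr (DmmU x m z.1 z.2) ∂(m.toMeasure.prod m.toMeasure))
      = R x m

end MasterEq

end

/-!
The weak formulation says that, in the viscosity sense, the *residual* of the equation, i.e. its
left-hand side minus `F`, is on average over `X` at least as large as on average over `Y`. For a `U`
with continuous derivatives this becomes pointwise information, as follows.

Let `Res(x, m)` be the residual. Since `g` may depend on `m` only, what has to be shown is that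
`Res(x, m)` does not depend on `x`; then `g = Res(0, ·)`, which is continuous because `Res` is.

*The test.* Fix a random variable `X₀` whose law `m₀` is a mixture of uniform laws on balls of a
common radius, and a bounded `Y`. The lift `(X, Y) ↦ Û(X, Y)` is in general not twice differentiable
on `L² × L²`, but a lower second-order expansion is enough. Along pairs of equal constants `(c, c)`,
the only directions seen by `Λ`, the lift is smooth, and the trace of its Hessian is the difference
of the averages over `X₀` and over `Y` of the second-order terms of the equation
(`HasContDerivs.isLittleO_translate`, `HasContDerivs.tr_translationHessian`). In the complementary
directions a bound of second order on the remainder suffices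
(`HasContDerivs.exists_integral_remainder_bound`), because the form `𝒳` may be taken very negative
there without changing `Λ(𝒳)`. Finally the density of `m₀` is maximal on a whole ball; if `φ` is a bump
supported there, `X ↦ 𝔼[φ(X)] / ∫ φ` is a smooth lower bound of `N`, with equality at `X₀`
(`exists_bump_densNorm`), so that `N` is subdifferentiable at `X₀`. Together these give an explicit
element of the subdifferential (`HasContDerivs.exists_mem_subjet`), which makes the weak inequality
say, as `ε → 0`, that `𝔼[Res(Y, m₀)] ≤ 𝔼[Res(X₀, m₀)]` (`integral_residual_le`).

*The conclusion.* With `Y` constant, `Res(y, m₀) ≤ ∫ Res(·, m₀) dm₀` for every `y`. Hence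
`Res(·, m₀)` equals its supremum `m₀`-almost everywhere, and by continuity at the centre of every ball
of the mixture. The mixtures one of whose balls is centred at a prescribed point `x` are dense in
`P₂` (`of_ballMixture`), and each of them is the law of some `X₀` because the probability space is
atomless (`Atomless.exists_law_eq`). As `Res` is continuous in `m`
(`HasContDerivs.tendsto_residual`), `Res(y, m) ≤ Res(x, m)` for all `x`, `y` and `m`.
-/

namespace MasterEq

/-! ### Random variables on an atomless space -/

section Realisation

variable {Ω : Type*} [MeasurableSpace Ω] {P : Measure Ω}

/-- Repeatedly keeping the smaller of the two parts of a split at least halves the measure. -/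
lemma Atomless.exists_small [IsFiniteMeasure P] (hP : Atomless P) {A : Set Ω}
    (hA : MeasurableSet A) (hpos : 0 < P A) {ε : ℝ} (hε : 0 < ε) :
    ∃ B, MeasurableSet B ∧ B ⊆ A ∧ 0 < P.real B ∧ P.real B ≤ ε := by
  have key : ∀ n : ℕ, ∃ B, MeasurableSet B ∧ B ⊆ A ∧ 0 < P B ∧
      P.real B ≤ P.real A * (1 / 2) ^ n := by
    intro n
    induction n with
    | zero => exact ⟨A, hA, Subset.rfl, hpos, by simp⟩
    | succ n ih =>
      obtain ⟨B, hB, hBA, hB0, hBn⟩ := ih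
      obtain ⟨D, hD, hDB, hD0, hDlt⟩ := hP B hB hB0
      have hsum : P.real (B \ D) = P.real B - P.real D := measureReal_sdiff hDB hD
      have hlt : P.real D < P.real B :=
        (ENNReal.toReal_lt_toReal (measure_ne_top _ _) (measure_ne_top _ _)).2 hDlt
      rw [pow_succ]
      rcases le_total (P.real D) (P.real B / 2) with h | h
      · exact ⟨D, hD, hDB.trans hBA, hD0, by linarith⟩
      · refine ⟨B \ D, hB.diff hD, sdiff_subset.trans hBA, ?_, by linarith⟩
        have : 0 < P.real (B \ D) := by linarith
        exact (ENNReal.toReal_pos_iff.1 this).1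
  have hA' : 0 < P.real A := ENNReal.toReal_pos hpos.ne' (measure_ne_top _ _)
  obtain ⟨n, hn⟩ := exists_pow_lt_of_lt_one (div_pos hε hA') (by norm_num : (1 / 2 : ℝ) < 1)
  obtain ⟨B, hB, hBA, hB0, hBn⟩ := key n
  refine ⟨B, hB, hBA, ENNReal.toReal_pos hB0.ne' (measure_ne_top _ _), hBn.trans ?_⟩
  rw [lt_div_iff₀ hA'] at hn
  linarith

/-- Sierpiński's theorem: an atomless finite measure takes every intermediate value between two
nested sets. The set is the union of a greedy sequence, each step of which realises at least half
of the increase that is still possible. -/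
lemma Atomless.exists_between [IsFiniteMeasure P] (hP : Atomless P) {A C : Set Ω}
    (hA : MeasurableSet A) (hC : MeasurableSet C) (hAC : A ⊆ C) {t : ℝ}
    (hAt : P.real A ≤ t) (htC : t ≤ P.real C) :
    ∃ B, MeasurableSet B ∧ A ⊆ B ∧ B ⊆ C ∧ P.real B = t := by
  let S : Set (Set Ω) := {B | MeasurableSet B ∧ A ⊆ B ∧ B ⊆ C ∧ P.real B ≤ t}
  have step : ∀ B : S, ∃ B' : S, (B : Set Ω) ⊆ B' ∧
      ∀ D : S, (B : Set Ω) ⊆ D → P.real B + P.real D ≤ 2 * P.real B' := by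
    intro B
    let V : Set ℝ := {v | ∃ D : S, (B : Set Ω) ⊆ D ∧ P.real D = v}
    have hV : BddAbove V := ⟨t, by rintro v ⟨D, -, rfl⟩; exact D.2.2.2.2⟩
    have hVne : V.Nonempty := ⟨_, B, Subset.rfl, rfl⟩
    have hBs : P.real B ≤ sSup V := le_csSup hV ⟨B, Subset.rfl, rfl⟩
    rcases hBs.eq_or_lt with h | h
    · refine ⟨B, Subset.rfl, fun D hD => ?_⟩
      have : P.real D ≤ sSup V := le_csSup hV ⟨D, hD, rfl⟩
      linarith
    · obtain ⟨v, ⟨B', hBB', rfl⟩, hv⟩ :=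
        exists_lt_of_lt_csSup hVne (show (P.real B + sSup V) / 2 < sSup V by linarith)
      refine ⟨B', hBB', fun D hD => ?_⟩
      have : P.real D ≤ sSup V := le_csSup hV ⟨D, hD, rfl⟩
      linarith
  choose next hsub hnext using step
  let b : ℕ → S := fun n => next^[n] ⟨A, hA, Subset.rfl, hAC, hAt⟩
  have hb : ∀ n, b (n + 1) = next (b n) := fun n => Function.iterate_succ_apply' _ _ _
  have hmono : Monotone fun n => (b n : Set Ω) :=
    monotone_nat_of_le_succ fun n => by simp only [hb]; exact hsub _
  set B : Set Ω := ⋃ n, (b n : Set Ω) with hBdef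
  have hBm : MeasurableSet B := MeasurableSet.iUnion fun n => (b n).2.1
  have hAB : A ⊆ B := (b 0).2.2.1.trans (subset_iUnion (fun n => (b n : Set Ω)) 0)
  have hBC : B ⊆ C := iUnion_subset fun n => (b n).2.2.2.1
  have hlim : Tendsto (fun n => P.real (b n)) atTop (𝓝 (P.real B)) :=
    (ENNReal.tendsto_toReal (measure_ne_top _ _)).comp (tendsto_measure_iUnion_atTop hmono)
  have hBt : P.real B ≤ t := le_of_tendsto' hlim fun n => (b n).2.2.2.2
  refine ⟨B, hBm, hAB, hBC, hBt.antisymm (not_lt.1 fun hlt => ?_)⟩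
  have hdiff : 0 < P.real (C \ B) := by
    rw [measureReal_sdiff hBC hBm]; linarith
  obtain ⟨D, hD, hDs, hD0, hDle⟩ := hP.exists_small (hC.diff hBm)
    (ENNReal.toReal_pos_iff.1 hdiff).1 (sub_pos.2 hlt)
  have hdisj : Disjoint B D := disjoint_sdiff_right.mono_right hDs
  have hun : P.real (B ∪ D) = P.real B + P.real D := measureReal_union hdisj hD
  have hmem : B ∪ D ∈ S :=
    ⟨hBm.union hD, hAB.trans subset_union_left, union_subset hBC (hDs.trans sdiff_subset),
      by linarith⟩
  have hle : ∀ n, P.real (b n) + P.real (B ∪ D) ≤ 2 * P.real (b (n + 1)) := fun n => by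
    rw [hb]
    exact hnext (b n) ⟨_, hmem⟩ ((subset_iUnion (fun n => (b n : Set Ω)) n).trans
      subset_union_left)
  have := le_of_tendsto_of_tendsto' (hlim.add_const _)
    ((hlim.comp (tendsto_add_atTop_nat 1)).const_mul 2) hle
  linarith

/-- The refinement of a dyadic chain of sets of level `n` to one of level `n + 1`. -/
lemma Atomless.exists_refine [IsProbabilityMeasure P] (hP : Atomless P) (n : ℕ) (L : ℕ → Set Ω)
    (hL : ∀ k, MeasurableSet (L k) ∧ L k ⊆ L (k + 1) ∧
      P.real (L k) = min ((k : ℝ) / 2 ^ n) 1) :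
    ∃ L' : ℕ → Set Ω, (∀ k, MeasurableSet (L' k) ∧ L' k ⊆ L' (k + 1) ∧
      P.real (L' k) = min ((k : ℝ) / 2 ^ (n + 1)) 1) ∧ ∀ k, L' (2 * k) = L k := by
  have hmid : ∀ k, ∃ B, MeasurableSet B ∧ L k ⊆ B ∧ B ⊆ L (k + 1) ∧
      P.real B = min (((2 * k + 1 : ℕ) : ℝ) / 2 ^ (n + 1)) 1 := by
    intro k
    refine hP.exists_between (hL k).1 (hL (k + 1)).1 (hL k).2.1 ?_ ?_
    · rw [(hL k).2.2]
      refine min_le_min_right _ ?_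
      rw [div_le_div_iff₀ (by positivity) (by positivity), pow_succ]
      push_cast
      nlinarith [pow_pos (two_pos : (0 : ℝ) < 2) n]
    · rw [(hL (k + 1)).2.2]
      refine min_le_min_right _ ?_
      rw [div_le_div_iff₀ (by positivity) (by positivity), pow_succ]
      push_cast
      nlinarith [pow_pos (two_pos : (0 : ℝ) < 2) n]
  choose M hMm hM1 hM2 hM3 using hmid
  refine ⟨fun j => if j % 2 = 0 then L (j / 2) else M (j / 2), fun j => ?_, fun k => by simp⟩
  obtain ⟨k, rfl | rfl⟩ : ∃ k, j = 2 * k ∨ j = 2 * k + 1 := ⟨j / 2, by omega⟩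
  · have h1 : (2 * k + 1) % 2 ≠ 0 := by omega
    have h2 : (2 * k + 1) / 2 = k := by omega
    simp only [Nat.mul_mod_right, if_true, Nat.mul_div_right k two_pos, h1, if_false, h2]
    refine ⟨(hL k).1, hM1 k, ?_⟩
    rw [(hL k).2.2, pow_succ]
    congr 1
    push_cast
    field_simp
  · have h1 : (2 * k + 1) % 2 ≠ 0 := by omega
    have h2 : (2 * k + 1) / 2 = k := by omega
    have h3 : (2 * k + 1 + 1) % 2 = 0 := by omega
    have h4 : (2 * k + 1 + 1) / 2 = k + 1 := by omega
    simp only [h1, if_false, h2, h3, if_true, h4]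
    exact ⟨hMm k, hM2 k, hM3 k⟩

/-- An atomless probability space carries a random variable uniformly distributed on `[0, 1]`:
with a chain of sets `A n k` of probability `k / 2ⁿ`, it is the infimum of those `k / 2ⁿ` for which
the sample point lies in `A n k`. -/
lemma Atomless.exists_uniform [IsProbabilityMeasure P] (hP : Atomless P) :
    ∃ V : Ω → unitInterval, Measurable V ∧ P.map V = volume := by
  let T : ℕ → Type _ := fun n => {L : ℕ → Set Ω // ∀ k, MeasurableSet (L k) ∧ L k ⊆ L (k + 1) ∧
      P.real (L k) = min ((k : ℝ) / 2 ^ n) 1}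
  let L0 : T 0 := ⟨fun k => if k = 0 then ∅ else univ, fun k => by
    rcases k with _ | k
    · simp
    · simp⟩
  let L : ∀ n, T n := fun n => Nat.rec L0 (fun n Ln =>
    ⟨(hP.exists_refine n Ln.1 Ln.2).choose, (hP.exists_refine n Ln.1 Ln.2).choose_spec.1⟩) n
  have hrefine : ∀ n k, (L (n + 1)).1 (2 * k) = (L n).1 k := fun n =>
    (hP.exists_refine n (L n).1 (L n).2).choose_spec.2
  have hmono : ∀ n, Monotone (L n).1 := fun n => monotone_nat_of_le_succ fun k => ((L n).2 k).2.1
  have hrefine' : ∀ j n k, (L (n + j)).1 (k * 2 ^ j) = (L n).1 k := by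
    intro j
    induction j with
    | zero => intro n k; simp
    | succ j ih =>
      intro n k
      rw [← ih n k, ← hrefine (n + j), show k * 2 ^ (j + 1) = 2 * (k * 2 ^ j) by ring]
      rfl
  let v : ℕ → ℕ → unitInterval := fun n k =>
    ⟨min ((k : ℝ) / 2 ^ n) 1, le_min (by positivity) zero_le_one, min_le_right _ _⟩
  classical
  let V : Ω → unitInterval := fun ω => ⨅ q : ℕ × ℕ, if ω ∈ (L q.1).1 q.2 then v q.1 q.2 else 1
  have hV : Measurable V := Measurable.iInf fun q =>
    Measurable.ite ((L q.1).2 q.2).1 measurable_const measurable_const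
  refine ⟨V, hV, ?_⟩
  have hpre : ∀ t : unitInterval,
      V ⁻¹' (Iio t) = ⋃ q : {q : ℕ × ℕ // v q.1 q.2 < t}, (L q.1.1).1 q.1.2 := by
    intro t
    ext ω
    simp only [V, mem_preimage, mem_Iio, iInf_lt_iff, mem_iUnion]
    constructor
    · rintro ⟨q, hq⟩
      by_cases hω : ω ∈ (L q.1).1 q.2
      · rw [if_pos hω] at hq
        exact ⟨⟨q, hq⟩, hω⟩
      · rw [if_neg hω] at hq
        exact absurd hq (not_lt.2 unitInterval.le_one')
    · rintro ⟨⟨q, hq⟩, hω⟩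
      exact ⟨q, by rwa [if_pos hω]⟩
  have hmeas : ∀ t : unitInterval, P (V ⁻¹' (Iio t)) = ENNReal.ofReal t := by
    intro t
    have hdir : Directed (· ⊆ ·)
        (fun q : {q : ℕ × ℕ // v q.1 q.2 < t} => (L q.1.1).1 q.1.2) := by
      rintro ⟨⟨n, k⟩, hq⟩ ⟨⟨n', k'⟩, hq'⟩
      have e1 : ((k * 2 ^ n' : ℕ) : ℝ) / 2 ^ (n + n') = k / 2 ^ n := by
        push_cast; rw [pow_add]; field_simp
      have e2 : ((k' * 2 ^ n : ℕ) : ℝ) / 2 ^ (n + n') = k' / 2 ^ n' := by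
        push_cast; rw [pow_add]; field_simp
      refine ⟨⟨(n + n', max (k * 2 ^ n') (k' * 2 ^ n)), ?_⟩, ?_, ?_⟩
      · rcases max_choice (k * 2 ^ n') (k' * 2 ^ n) with h | h
        · simp only [h, v, e1]; exact hq
        · simp only [h, v, e2]; exact hq'
      · change (L n).1 k ⊆ (L (n + n')).1 (max (k * 2 ^ n') (k' * 2 ^ n))
        rw [← hrefine' n' n k]
        exact hmono _ (le_max_left _ _)
      · change (L n').1 k' ⊆ (L (n + n')).1 (max (k * 2 ^ n') (k' * 2 ^ n))
        rw [← hrefine' n n' k', add_comm n' n]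
        exact hmono _ (le_max_right _ _)
    have hval : ∀ n k, P ((L n).1 k) = ENNReal.ofReal (v n k) := by
      intro n k
      rw [← ofReal_measureReal (μ := P) (s := (L n).1 k), ((L n).2 k).2.2]
    rw [hpre, hdir.measure_iUnion]
    apply le_antisymm
    · refine iSup_le fun q => ?_
      rw [hval]
      exact ENNReal.ofReal_le_ofReal q.2.le
    · refine le_of_forall_lt fun c hc => ?_
      have hcfin : c ≠ ⊤ := hc.ne_top
      have hct : c.toReal < t := (ENNReal.lt_ofReal_iff_toReal_lt hcfin).1 hc
      obtain ⟨n, hn⟩ := exists_pow_lt_of_lt_one (sub_pos.2 hct) (by norm_num : (1 / 2 : ℝ) < 1)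
      have h2n : (0 : ℝ) < 2 ^ n := by positivity
      -- the largest multiple of `2⁻ⁿ` below `t`
      set k : ℕ := ⌈(t : ℝ) * 2 ^ n⌉₊ - 1 with hk
      have htpos : 0 < (t : ℝ) := ENNReal.toReal_nonneg.trans_lt hct
      have hceil : 1 ≤ ⌈(t : ℝ) * 2 ^ n⌉₊ := Nat.one_le_ceil_iff.2 (by positivity)
      have hk1 : ((k : ℕ) : ℝ) + 1 = ⌈(t : ℝ) * 2 ^ n⌉₊ := by
        rw [hk]; push_cast [hceil]; ring
      have hlt : (k : ℝ) < t * 2 ^ n := by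
        have := Nat.ceil_lt_add_one (show 0 ≤ (t : ℝ) * 2 ^ n by positivity)
        linarith
      have hge : (t : ℝ) * 2 ^ n ≤ k + 1 := by
        rw [hk1]; exact Nat.le_ceil _
      have hkt : (k : ℝ) / 2 ^ n < t := by rwa [div_lt_iff₀ h2n]
      have hck : c.toReal < (k : ℝ) / 2 ^ n := by
        rw [lt_div_iff₀ h2n]
        have : (1 / 2 : ℝ) ^ n * 2 ^ n = 1 := by rw [← mul_pow]; norm_num
        nlinarith
      have hv : (v n k : ℝ) = (k : ℝ) / 2 ^ n := min_eq_left (hkt.le.trans t.2.2)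
      refine lt_of_lt_of_le ?_ (le_iSup (fun q : {q : ℕ × ℕ // v q.1 q.2 < t} =>
        P ((L q.1.1).1 q.1.2)) ⟨(n, k), ?_⟩)
      · rw [hval, hv]
        exact (ENNReal.lt_ofReal_iff_toReal_lt hcfin).2 hck
      · rw [← Subtype.coe_lt_coe, hv]; exact hkt
  have : IsProbabilityMeasure (P.map V) := Measure.isProbabilityMeasure_map hV.aemeasurable
  refine Measure.ext_of_Ici _ _ fun t => ?_
  rw [Measure.map_apply hV measurableSet_Ici, unitInterval.volume_Ici, ← compl_Iio, preimage_compl,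
    prob_compl_eq_one_sub (hV measurableSet_Iio), hmeas, ENNReal.ofReal_sub _ t.2.1,
    ENNReal.ofReal_one]

/-- Every law with finite second moment is that of a square integrable random variable. -/
lemma Atomless.exists_law_eq [IsProbabilityMeasure P] (hP : Atomless P) {d : ℕ} (m : PSpace d 2) :
    ∃ X : L2 P d, law X = m := by
  obtain ⟨V, hV, hVlaw⟩ := hP.exists_uniform
  have := m.isProb
  obtain ⟨f, hf, hfm⟩ := Measure.exists_measurable_map_eq m.toMeasure
  have hmap : P.map (f ∘ V) = m.toMeasure := by
    rw [← Measure.map_map hf hV, hVlaw, hfm]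
  have hmem : MemLp (f ∘ V) 2 P := by
    refine ⟨(hf.comp hV).aestronglyMeasurable, ?_⟩
    rw [eLpNorm_lt_top_iff_lintegral_rpow_enorm_lt_top two_ne_zero ENNReal.ofNat_ne_top]
    have h := m.moment_lt_top
    rw [← hmap, lintegral_map (by fun_prop) (hf.comp hV)] at h
    simpa using h
  refine ⟨hmem.toLp, ?_⟩
  ext1
  exact (Measure.map_congr hmem.coeFn_toLp).trans hmap

end Realisation

/-! ### Wasserstein convergence and integrals of quadratic growth -/

section Wasserstein

variable {d : ℕ}

/-- The filter generated by the Wasserstein balls around `m`. It refines the neighbourhood filter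
of `m`, which is all that is needed of it: since a set is open as soon as it contains a ball around
each of its points, convergence along all these filters gives continuity, without appeal to the
triangle inequality for `wdist`. -/
noncomputable def wnhds {p : ℕ} (m : PSpace d p) : Filter (PSpace d p) :=
  comap (fun m' => wdist m m') (𝓝 0)

lemma eventually_wdist_lt {p : ℕ} (m : PSpace d p) {r : ENNReal} (hr : 0 < r) :
    ∀ᶠ m' in wnhds m, wdist m m' < r :=
  (tendsto_comap (f := fun m' => wdist m m')).eventually (gt_mem_nhds hr)

lemma wnhds_le_nhds {p : ℕ} (m : PSpace d p) : wnhds m ≤ 𝓝 m := by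
  intro s hs
  obtain ⟨t, hts, ht, hmt⟩ := mem_nhds_iff.1 hs
  obtain ⟨r, hr, h⟩ := ht m hmt
  exact mem_of_superset (eventually_wdist_lt m hr) fun m' hm' => hts (h m' hm')

lemma continuous_of_tendsto_wnhds {p : ℕ} {Y : Type*} [TopologicalSpace Y] {g : PSpace d p → Y}
    (hg : ∀ m, Tendsto g (wnhds m) (𝓝 (g m))) : Continuous g := by
  refine continuous_def.2 fun s hs m hm => ?_
  have h : g ⁻¹' s ∈ wnhds m := hg m (hs.mem_nhds hm)
  obtain ⟨t, ht, hts⟩ := mem_comap.1 h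
  obtain ⟨r, hr, hrt⟩ := ENNReal.nhds_zero_basis.mem_iff.1 ht
  exact ⟨r, hr, fun m' hm' => hts (hrt hm')⟩

lemma wdist_le_of_coupling {p : ℕ} {m m' : PSpace d p} (π : Measure (E d × E d))
    (h1 : π.map Prod.fst = m.toMeasure) (h2 : π.map Prod.snd = m'.toMeasure) :
    wdist m m' ≤ (∫⁻ z, edist z.1 z.2 ^ p ∂π) ^ (1 / (p : ℝ)) :=
  iInf_le (fun π : {π : Measure (E d × E d) //
      π.map Prod.fst = m.toMeasure ∧ π.map Prod.snd = m'.toMeasure} =>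
    (∫⁻ z, edist z.1 z.2 ^ p ∂π.1) ^ (1 / (p : ℝ))) ⟨π, h1, h2⟩

/-- It suffices to find couplings whose transport costs tend to zero. -/
lemma tendsto_wnhds_of_coupling {p : ℕ} (hp : p ≠ 0) {ι : Type*} {l : Filter ι} {m : PSpace d p}
    {μ : ι → PSpace d p} (c : ι → ENNReal) (hc : Tendsto c l (𝓝 0))
    (h : ∀ᶠ i in l, ∃ π : Measure (E d × E d), π.map Prod.fst = m.toMeasure ∧
      π.map Prod.snd = (μ i).toMeasure ∧ ∫⁻ z, edist z.1 z.2 ^ p ∂π ≤ c i) :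
    Tendsto μ l (wnhds m) := by
  refine tendsto_comap_iff.2 ?_
  have hp' : (0 : ℝ) < 1 / (p : ℝ) := by positivity
  have hc' : Tendsto (fun i => c i ^ (1 / (p : ℝ))) l (𝓝 0) := by
    have := (ENNReal.continuous_rpow_const (y := 1 / (p : ℝ))).tendsto 0
    rw [ENNReal.zero_rpow_of_pos hp'] at this
    exact this.comp hc
  refine tendsto_of_tendsto_of_tendsto_of_le_of_le' tendsto_const_nhds hc'
    (Eventually.of_forall fun _ => zero_le) (h.mono fun i hi => ?_)
  obtain ⟨π, h1, h2, h3⟩ := hi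
  exact (wdist_le_of_coupling π h1 h2).trans (ENNReal.rpow_le_rpow h3 hp'.le)

lemma isProbabilityMeasure_of_map_fst {m : Measure (E d)} [IsProbabilityMeasure m]
    {π : Measure (E d × E d)} (h : π.map Prod.fst = m) : IsProbabilityMeasure π := by
  constructor
  have : π.map Prod.fst univ = 1 := by rw [h]; exact measure_univ
  rwa [Measure.map_apply measurable_fst MeasurableSet.univ, preimage_univ] at this

lemma wdist_toP1_le (m m' : PSpace d 2) : wdist m.toP1 m'.toP1 ≤ wdist m m' := by
  refine le_iInf fun π => ?_
  obtain ⟨π, h1, h2⟩ := π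
  refine (wdist_le_of_coupling (m := m.toP1) (m' := m'.toP1) π h1 h2).trans ?_
  have := m.isProb
  have := isProbabilityMeasure_of_map_fst h1
  have h := eLpNorm'_le_eLpNorm'_of_exponent_le (f := fun z : E d × E d => z.1 - z.2)
    (p := 1) (q := 2) one_pos one_le_two π (by fun_prop)
  simp only [eLpNorm'] at h
  simpa [edist_eq_enorm_sub] using h

lemma tendsto_toP1 (m : PSpace d 2) : Tendsto PSpace.toP1 (wnhds m) (wnhds m.toP1) := by
  refine tendsto_comap_iff.2 ?_
  exact tendsto_of_tendsto_of_tendsto_of_le_of_le tendsto_const_nhds tendsto_comap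
    (fun _ => zero_le) fun m' => wdist_toP1_le m m'

section Law

variable {Ω : Type*} [MeasurableSpace Ω]

lemma measurable_coe_L2 {P : Measure Ω} (X : L2 P d) : Measurable X :=
  (Lp.stronglyMeasurable X).measurable

variable {P : Measure Ω} [IsProbabilityMeasure P]

lemma tendsto_law_wnhds (X : L2 P d) : Tendsto law (𝓝 X) (wnhds (law X)) := by
  have hlim : Tendsto (fun Y : L2 P d => edist X Y ^ 2) (𝓝 X) (𝓝 0) := by
    have h : Tendsto (fun Y : L2 P d => edist X Y) (𝓝 X) (𝓝 0) := by
      simpa using! (continuous_const (y := X)).edist continuous_id |>.tendsto X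
    simpa using ENNReal.Tendsto.pow (n := 2) h
  refine tendsto_wnhds_of_coupling two_ne_zero _ hlim (Eventually.of_forall fun Y => ?_)
  have hm : Measurable fun ω => (X ω, Y ω) := (measurable_coe_L2 X).prodMk (measurable_coe_L2 Y)
  refine ⟨P.map fun ω => (X ω, Y ω), ?_, ?_, le_of_eq ?_⟩
  · rw [Measure.map_map measurable_fst hm]; rfl
  · rw [Measure.map_map measurable_snd hm]; rfl
  · rw [lintegral_map (by fun_prop) hm, Lp.edist_def,
      eLpNorm_eq_lintegral_rpow_enorm_toReal two_ne_zero ENNReal.ofNat_ne_top]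
    simp only [ENNReal.toReal_ofNat, ENNReal.rpow_ofNat, Pi.sub_apply, ← edist_eq_enorm_sub]
    rw [← ENNReal.rpow_natCast, ← ENNReal.rpow_mul]
    norm_num

lemma continuous_law : Continuous (law : L2 P d → PSpace d 2) :=
  continuous_iff_continuousAt.2 fun X => (tendsto_law_wnhds X).mono_right (wnhds_le_nhds _)

end Law

lemma PSpace.integrable_sq (m : PSpace d 2) :
    Integrable (fun y : E d => ‖y‖ ^ 2) m.toMeasure := by
  refine ⟨by fun_prop, ?_⟩
  have h := m.moment_lt_top
  simpa [HasFiniteIntegral] using h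

lemma PSpace.integrable_of_growth (m : PSpace d 2) {f : E d → ℝ} (hf : Continuous f) {C : ℝ}
    (hC : ∀ y, |f y| ≤ C * (1 + ‖y‖ ^ 2)) : Integrable f m.toMeasure := by
  have := m.isProb
  exact (((integrable_const 1).add m.integrable_sq).const_mul C).mono'
    hf.aestronglyMeasurable (Eventually.of_forall hC)

lemma exists_coupling_of_wdist_lt {m m' : PSpace d 2} {r : ℝ}
    (h : wdist m m' < ENNReal.ofReal r) :
    ∃ π : Measure (E d × E d), π.map Prod.fst = m.toMeasure ∧ π.map Prod.snd = m'.toMeasure ∧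
      Integrable (fun z : E d × E d => dist z.1 z.2 ^ 2) π ∧ ∫ z, dist z.1 z.2 ^ 2 ∂π ≤ r ^ 2 := by
  obtain ⟨⟨π, h1, h2⟩, hπ⟩ := iInf_lt_iff.1 h
  have hr : 0 < r := ENNReal.ofReal_pos.1 (zero_le.trans_lt h)
  have hlt : ∫⁻ z, edist z.1 z.2 ^ 2 ∂π < ENNReal.ofReal (r ^ 2) := by
    have h3 := ENNReal.rpow_lt_rpow hπ (show (0 : ℝ) < 2 by norm_num)
    rw [← ENNReal.rpow_mul] at h3
    norm_num at h3
    rwa [ENNReal.ofReal_pow hr.le]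
  have he : ∀ z : E d × E d, edist z.1 z.2 ^ 2 = ENNReal.ofReal (dist z.1 z.2 ^ 2) := fun z => by
    rw [edist_dist, ENNReal.ofReal_pow dist_nonneg]
  simp only [he] at hlt
  have hm : Measurable fun z : E d × E d => dist z.1 z.2 ^ 2 := by fun_prop
  refine ⟨π, h1, h2, ⟨hm.aestronglyMeasurable, ?_⟩, ?_⟩
  · rw [hasFiniteIntegral_iff_ofReal (Eventually.of_forall fun z => by positivity)]
    exact hlt.trans ENNReal.ofReal_lt_top
  · rw [integral_eq_lintegral_of_nonneg_ae (Eventually.of_forall fun z => by positivity)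
      hm.aestronglyMeasurable]
    exact ENNReal.toReal_le_of_le_ofReal (by positivity) hlt.le

/-- On a compact set, the closeness of `f i y` to `f₀ x` holds with a uniform radius: there is no need
for `f i` to be defined by the same point `x`. -/
lemma exists_uniform_radius {ι : Type*} {l : Filter ι} {f : ι → E d → ℝ} {f₀ : E d → ℝ}
    (hf₀ : Continuous f₀)
    (hlim : ∀ y, Tendsto (fun q : ι × E d => f q.1 q.2) (l ×ˢ 𝓝 y) (𝓝 (f₀ y)))
    {K : Set (E d)} (hK : IsCompact K) {ε : ℝ} (hε : 0 < ε) :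
    ∃ ρ > 0, ∀ᶠ i in l, ∀ x ∈ K, ∀ y, dist x y < ρ → |f i y - f₀ x| ≤ ε := by
  refine hK.induction_on (p := fun s => ∃ ρ > 0, ∀ᶠ i in l, ∀ x ∈ s, ∀ y, dist x y < ρ →
    |f i y - f₀ x| ≤ ε) ⟨1, one_pos, by simp⟩ ?_ ?_ ?_
  · rintro s t hst ⟨ρ, hρ, h⟩
    exact ⟨ρ, hρ, h.mono fun i hi x hx => hi x (hst hx)⟩
  · rintro s t ⟨ρ, hρ, h⟩ ⟨ρ', hρ', h'⟩
    refine ⟨min ρ ρ', lt_min hρ hρ', ?_⟩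
    filter_upwards [h, h'] with i hi hi' x hx y hy
    rcases hx with hx | hx
    · exact hi x hx y (hy.trans_le (min_le_left _ _))
    · exact hi' x hx y (hy.trans_le (min_le_right _ _))
  · intro x _
    have h1 := Metric.tendsto_nhds.1 (hlim x) (ε / 2) (by positivity)
    obtain ⟨A, hA, B, hB, hAB⟩ := eventually_prod_iff.1 h1
    obtain ⟨δ, hδ, hδB⟩ := Metric.eventually_nhds_iff.1 hB
    obtain ⟨δ', hδ', h2⟩ := Metric.continuous_iff.1 hf₀ x (ε / 2) (by positivity)
    refine ⟨Metric.ball x (min (δ / 2) δ'), mem_nhdsWithin_of_mem_nhds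
      (Metric.ball_mem_nhds _ (lt_min (by positivity) hδ')), δ / 2, by positivity, ?_⟩
    filter_upwards [hA] with i hi x' hx' y hy
    have hx1 : dist x' x < δ / 2 := (Metric.mem_ball.1 hx').trans_le (min_le_left _ _)
    have hx2 := h2 x' ((Metric.mem_ball.1 hx').trans_le (min_le_right _ _))
    have hy1 := hAB hi (hδB (y := y) (by
      have := dist_triangle y x' x
      rw [dist_comm y x'] at this
      linarith))
    have := dist_triangle_right (f i y) (f₀ x') (f₀ x)
    rw [← Real.dist_eq]
    simp only at hy1
    linarith

/-- Uniform integrability of the second moment. -/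
lemma tendsto_integral_tail (m : PSpace d 2) :
    Tendsto (fun n : ℕ => ∫ x, {x : E d | (n : ℝ) < ‖x‖}.indicator (fun x => 1 + ‖x‖ ^ 2) x
      ∂m.toMeasure) atTop (𝓝 0) := by
  have := m.isProb
  have hmeas : ∀ n : ℕ, MeasurableSet {x : E d | (n : ℝ) < ‖x‖} := fun n =>
    measurableSet_lt measurable_const measurable_norm
  have h := tendsto_integral_of_dominated_convergence (μ := m.toMeasure)
    (F := fun n : ℕ => {x : E d | (n : ℝ) < ‖x‖}.indicator (fun x => 1 + ‖x‖ ^ 2))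
    (f := fun _ => (0 : ℝ)) (fun x => 1 + ‖x‖ ^ 2)
    (fun n => (Measurable.indicator (by fun_prop) (hmeas n)).aestronglyMeasurable)
    ((integrable_const 1).add m.integrable_sq)
    (fun n => Eventually.of_forall fun x => by
      refine (norm_indicator_le_norm_self _ _).trans_eq ?_
      rw [Real.norm_of_nonneg (by positivity)])
    (Eventually.of_forall fun x => by
      refine tendsto_const_nhds.congr' ?_
      obtain ⟨N, hN⟩ := exists_nat_ge ‖x‖
      filter_upwards [eventually_ge_atTop N] with n hn
      rw [indicator_of_notMem]
      simp only [mem_ofPred_eq, not_lt]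
      exact hN.trans (by exact_mod_cast hn))
  simpa using h

/-- Passage to the limit in `∫ f dm` for integrands of at most quadratic growth, when `m` converges
in the Wasserstein sense and the integrands converge locally uniformly. Along a coupling of small
cost, `f i y - f₀ x` is small if `x` is in a large ball and `y` close to `x`; elsewhere it is
controlled by the tail of the second moment and by the transport cost. -/
lemma tendsto_integral_of_tendsto_wnhds {ι : Type*} {l : Filter ι} {m : PSpace d 2}
    {μ : ι → PSpace d 2} (hμ : Tendsto μ l (wnhds m)) {f : ι → E d → ℝ} {f₀ : E d → ℝ}
    (hf₀ : Continuous f₀) (hf : ∀ᶠ i in l, Continuous (f i))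
    (hlim : ∀ y, Tendsto (fun q : ι × E d => f q.1 q.2) (l ×ˢ 𝓝 y) (𝓝 (f₀ y))) {C : ℝ}
    (hC : ∀ᶠ i in l, ∀ y, |f i y| ≤ C * (1 + ‖y‖ ^ 2)) (hC₀ : ∀ y, |f₀ y| ≤ C * (1 + ‖y‖ ^ 2)) :
    Tendsto (fun i => ∫ y, f i y ∂(μ i).toMeasure) l (𝓝 (∫ y, f₀ y ∂m.toMeasure)) := by
  have := m.isProb
  have hC0 : 0 ≤ C := by
    have := (abs_nonneg _).trans (hC₀ 0)
    simpa using this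
  refine Metric.tendsto_nhds.2 fun ε hε => ?_
  obtain ⟨R, hR⟩ : ∃ R : ℕ, 3 * C * ∫ x, {x : E d | (R : ℝ) < ‖x‖}.indicator
      (fun x => 1 + ‖x‖ ^ 2) x ∂m.toMeasure < ε / 4 := by
    have h := (tendsto_integral_tail m).const_mul (3 * C)
    rw [mul_zero] at h
    exact (h.eventually (gt_mem_nhds (show 0 < ε / 4 by positivity))).exists
  obtain ⟨ρ, hρ, hunif⟩ := exists_uniform_radius hf₀ hlim (isCompact_closedBall (0 : E d) R)
    (show 0 < ε / 4 by positivity)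
  set K : ℝ := C * (2 + 3 * R ^ 2) / ρ ^ 2 + 2 * C with hK
  have hK0 : 0 ≤ K := by positivity
  obtain ⟨r, hr, hKr⟩ : ∃ r : ℝ, 0 < r ∧ K * r ^ 2 < ε / 4 := by
    have h : Tendsto (fun r : ℝ => K * r ^ 2) (𝓝[>] 0) (𝓝 (K * 0 ^ 2)) :=
      ((continuous_const.mul (continuous_id.pow 2)).tendsto 0).mono_left nhdsWithin_le_nhds
    have h2 := h.eventually (gt_mem_nhds (show K * 0 ^ 2 < ε / 4 by simpa using hε))
    obtain ⟨r, hr1, hr2⟩ := (h2.and self_mem_nhdsWithin).exists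
    exact ⟨r, hr2, hr1⟩
  have hsmall := hμ.eventually (eventually_wdist_lt m (ENNReal.ofReal_pos.2 hr))
  filter_upwards [hunif, hsmall, hf, hC] with i hui hsi hfi hCi
  obtain ⟨π, h1, h2, hint, hle⟩ := exists_coupling_of_wdist_lt hsi
  have hπ := isProbabilityMeasure_of_map_fst h1
  have hI := (μ i).integrable_of_growth hfi hCi
  have hI0 := m.integrable_of_growth hf₀ hC₀
  have e1 : ∫ y, f i y ∂(μ i).toMeasure = ∫ z, f i z.2 ∂π := by
    rw [← h2, integral_map measurable_snd.aemeasurable hfi.aestronglyMeasurable]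
  have e2 : ∫ y, f₀ y ∂m.toMeasure = ∫ z, f₀ z.1 ∂π := by
    rw [← h1, integral_map measurable_fst.aemeasurable hf₀.aestronglyMeasurable]
  have i1 : Integrable (fun z => f i z.2) π := by
    rw [← h2] at hI
    exact (integrable_map_measure hfi.aestronglyMeasurable measurable_snd.aemeasurable).1 hI
  have i2 : Integrable (fun z => f₀ z.1) π := by
    rw [← h1] at hI0
    exact (integrable_map_measure hf₀.aestronglyMeasurable measurable_fst.aemeasurable).1 hI0
  set T : E d → ℝ := {x : E d | (R : ℝ) < ‖x‖}.indicator (fun x => 1 + ‖x‖ ^ 2) with hT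
  have hTm : AEStronglyMeasurable T m.toMeasure :=
    (Measurable.indicator (by fun_prop)
      (measurableSet_lt measurable_const measurable_norm)).aestronglyMeasurable
  have hTi : Integrable T m.toMeasure := by
    refine ((integrable_const 1).add m.integrable_sq).mono' hTm (Eventually.of_forall fun x => ?_)
    refine (norm_indicator_le_norm_self _ _).trans_eq ?_
    rw [Real.norm_of_nonneg (by positivity)]
    rfl
  have e3 : ∫ z, T z.1 ∂π = ∫ x, T x ∂m.toMeasure := by
    rw [← h1] at hTm ⊢
    rw [integral_map measurable_fst.aemeasurable hTm]
  have i3 : Integrable (fun z => T z.1) π := by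
    rw [← h1] at hTi hTm
    exact (integrable_map_measure hTm measurable_fst.aemeasurable).1 hTi
  have hpt : ∀ z : E d × E d,
      |f i z.2 - f₀ z.1| ≤ ε / 4 + 3 * C * T z.1 + K * dist z.1 z.2 ^ 2 := by
    rintro ⟨x, y⟩
    simp only
    have hTnn : 0 ≤ T x := indicator_nonneg (fun _ _ => by positivity) _
    by_cases hx : ‖x‖ ≤ R
    · rcases lt_or_ge (dist x y) ρ with h | h
      · have := hui x (by simpa using hx) y h
        have h5 : 0 ≤ K * dist x y ^ 2 := by positivity
        have h6 : 0 ≤ 3 * C * T x := by positivity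
        linarith
      · have hy : ‖y‖ ≤ ‖x‖ + dist x y := by
          rw [dist_eq_norm]
          have := norm_sub_le x (x - y)
          simpa using this
        have hy2 : ‖y‖ ^ 2 ≤ 2 * R ^ 2 + 2 * dist x y ^ 2 := by
          have : ‖y‖ ^ 2 ≤ (R + dist x y) ^ 2 := by gcongr; linarith
          nlinarith [sq_nonneg ((R : ℝ) - dist x y)]
        have hx2 : ‖x‖ ^ 2 ≤ (R : ℝ) ^ 2 := by gcongr
        have hD : 1 ≤ dist x y ^ 2 / ρ ^ 2 := by
          rw [one_le_div (by positivity)]; gcongr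
        have hab := abs_sub (f i y) (f₀ x)
        have hA : |f i y| + |f₀ x| ≤ C * (2 + 3 * R ^ 2) + 2 * C * dist x y ^ 2 := by
          have q1 := hCi y
          have q2 := hC₀ x
          nlinarith
        have hB : C * (2 + 3 * R ^ 2) ≤ C * (2 + 3 * R ^ 2) * (dist x y ^ 2 / ρ ^ 2) :=
          le_mul_of_one_le_right (by positivity) hD
        have hKeq : K * dist x y ^ 2
            = C * (2 + 3 * R ^ 2) * (dist x y ^ 2 / ρ ^ 2) + 2 * C * dist x y ^ 2 := by
          rw [hK]; ring
        have h6 : 0 ≤ 3 * C * T x := by positivity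
        linarith
    · have hTx : T x = 1 + ‖x‖ ^ 2 := indicator_of_mem (by simpa using hx) _
      have hy : ‖y‖ ≤ ‖x‖ + dist x y := by
        rw [dist_eq_norm]
        have := norm_sub_le x (x - y)
        simpa using this
      have hy2 : ‖y‖ ^ 2 ≤ 2 * ‖x‖ ^ 2 + 2 * dist x y ^ 2 := by
        have : ‖y‖ ^ 2 ≤ (‖x‖ + dist x y) ^ 2 := by gcongr
        nlinarith [sq_nonneg (‖x‖ - dist x y)]
      have hab := abs_sub (f i y) (f₀ x)
      have hA : |f i y| + |f₀ x| ≤ 3 * C * T x + 2 * C * dist x y ^ 2 := by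
        rw [hTx]
        have q1 := hCi y
        have q2 := hC₀ x
        nlinarith
      have hKge : 2 * C * dist x y ^ 2 ≤ K * dist x y ^ 2 := by
        have : 0 ≤ C * (2 + 3 * R ^ 2) / ρ ^ 2 := by positivity
        gcongr
        linarith
      linarith
  rw [Real.dist_eq, e1, e2, ← integral_sub i1 i2]
  calc |∫ z, (f i z.2 - f₀ z.1) ∂π|
      ≤ ∫ z, |f i z.2 - f₀ z.1| ∂π := abs_integral_le_integral_abs
    _ ≤ ∫ z, (ε / 4 + 3 * C * T z.1 + K * dist z.1 z.2 ^ 2) ∂π :=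
        integral_mono (i1.sub i2).abs
          (((integrable_const _).add (i3.const_mul _)).add (hint.const_mul _)) hpt
    _ = ε / 4 + 3 * C * ∫ x, T x ∂m.toMeasure + K * ∫ z, dist z.1 z.2 ^ 2 ∂π := by
        have j1 : Integrable (fun z : E d × E d => 3 * C * T z.1) π := i3.const_mul _
        have j2 : Integrable (fun z : E d × E d => ε / 4 + 3 * C * T z.1) π :=
          (integrable_const _).add j1
        rw [integral_add j2 (hint.const_mul _), integral_add (integrable_const _) j1,
          integral_const_mul, integral_const_mul, e3]
        simp
    _ ≤ ε / 4 + 3 * C * ∫ x, T x ∂m.toMeasure + K * r ^ 2 := by gcongr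
    _ < ε := by linarith

end Wasserstein

/-! ### Density of mixtures of uniform laws on balls -/

section Density

variable {d : ℕ}

/-- The mixture, with weights `w`, of the uniform laws on the balls of radius `r` centred at the
points of `s`. -/
noncomputable def ballMixture (s : Finset (E d)) (w : E d → ENNReal) (r : ℝ) : Measure (E d) :=
  ∑ i ∈ s, w i • ProbabilityTheory.cond volume (Metric.ball i r)

lemma volume_ball_ne (i : E d) {r : ℝ} (hr : 0 < r) :
    volume (Metric.ball i r) ≠ 0 ∧ volume (Metric.ball i r) ≠ ⊤ :=
  ⟨(Metric.measure_ball_pos _ _ hr).ne', measure_ball_lt_top.ne⟩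

lemma isProbabilityMeasure_cond_ball (i : E d) {r : ℝ} (hr : 0 < r) :
    IsProbabilityMeasure (ProbabilityTheory.cond volume (Metric.ball i r)) :=
  ProbabilityTheory.cond_isProbabilityMeasure_of_finite (volume_ball_ne i hr).1
    (volume_ball_ne i hr).2

lemma ae_cond_ball (i : E d) (r : ℝ) :
    ∀ᵐ y ∂(ProbabilityTheory.cond volume (Metric.ball i r)), dist i y < r := by
  refine (ProbabilityTheory.ae_cond_mem Metric.isOpen_ball.measurableSet).mono fun y hy => ?_
  rwa [dist_comm]

lemma lintegral_cond_ball_le (i : E d) {r : ℝ} (hr : 0 < r) {f : E d → ENNReal} {c : ENNReal}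
    (hf : ∀ y, dist i y < r → f y ≤ c) :
    ∫⁻ y, f y ∂(ProbabilityTheory.cond volume (Metric.ball i r)) ≤ c := by
  have := isProbabilityMeasure_cond_ball i hr
  refine (lintegral_mono_ae ((ae_cond_ball i r).mono hf)).trans ?_
  simp

lemma lintegral_finset_smul_le {α : Type*} [MeasurableSpace α] (s : Finset (E d))
    (w : E d → ENNReal) (hw : ∑ i ∈ s, w i = 1) (ν : E d → Measure α) (f : α → ENNReal)
    {c : ENNReal} (hf : ∀ i ∈ s, ∫⁻ y, f y ∂(ν i) ≤ c) :
    ∫⁻ y, f y ∂(∑ i ∈ s, w i • ν i) ≤ c := by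
  rw [lintegral_finsetSum_measure]
  calc ∑ i ∈ s, ∫⁻ y, f y ∂(w i • ν i) ≤ ∑ i ∈ s, w i * c :=
        Finset.sum_le_sum fun i hi => by
          rw [lintegral_smul_measure, smul_eq_mul]
          gcongr
          exact hf i hi
    _ = c := by rw [← Finset.sum_mul, hw, one_mul]

lemma isProbabilityMeasure_finset_smul {α : Type*} [MeasurableSpace α] (s : Finset (E d))
    (w : E d → ENNReal) (hw : ∑ i ∈ s, w i = 1) (ν : E d → Measure α)
    (hν : ∀ i, IsProbabilityMeasure (ν i)) : IsProbabilityMeasure (∑ i ∈ s, w i • ν i) := by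
  constructor
  simp [Measure.finsetSum_apply, hw]

lemma map_finset_smul {α γ : Type*} [MeasurableSpace α] [MeasurableSpace γ] (s : Finset (E d))
    (w : E d → ENNReal) (ν : E d → Measure α) {g : α → γ} (hg : Measurable g) :
    (∑ i ∈ s, w i • ν i).map g = ∑ i ∈ s, w i • (ν i).map g := by
  ext A hA
  rw [Measure.map_apply hg hA]
  simp only [Measure.finsetSum_apply, Measure.smul_apply, Measure.map_apply hg hA]

lemma map_simpleFunc_eq_sum (m : Measure (E d)) [IsProbabilityMeasure m]
    (T : SimpleFunc (E d) (E d)) {s : Finset (E d)} (hs : T.range ⊆ s) :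
    m.map T = ∑ i ∈ s, m (T ⁻¹' {i}) • Measure.dirac i := by
  classical
  ext A hA
  rw [Measure.map_apply T.measurable hA, Measure.finsetSum_apply]
  have h1 : T ⁻¹' A = ⋃ i ∈ s.filter (· ∈ A), T ⁻¹' {i} := by
    ext y
    simp only [mem_preimage, mem_iUnion, Finset.mem_filter, mem_singleton_iff, exists_prop,
      exists_eq_right']
    exact ⟨fun h => ⟨hs (T.mem_range_self y), h⟩, fun h => h.2⟩
  rw [h1, measure_biUnion_finset]
  · rw [Finset.sum_filter]
    refine Finset.sum_congr rfl fun i _ => ?_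
    by_cases hi : i ∈ A <;> simp [Measure.dirac_apply' i hA, hi]
  · intro i _ j _ hij
    exact Disjoint.preimage _ (by simpa using hij)
  · exact fun i _ => T.measurable (measurableSet_singleton i)

variable {q : PSpace d 2 → Prop}

/-- Density of the finitely supported laws, obtained by approximating the identity by simple
functions. The support is enlarged by `x`, possibly with weight zero. -/
lemma of_finite_support (x : E d)
    (hcl : ∀ (m : PSpace d 2) (μ : ℕ → PSpace d 2), (∀ n, q (μ n)) →
      Tendsto μ atTop (wnhds m) → q m)
    (h : ∀ (s : Finset (E d)) (w : E d → ENNReal), x ∈ s → ∑ i ∈ s, w i = 1 →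
      ∀ m : PSpace d 2, m.toMeasure = ∑ i ∈ s, w i • Measure.dirac i → q m)
    (m : PSpace d 2) : q m := by
  classical
  have := m.isProb
  let T : ℕ → SimpleFunc (E d) (E d) :=
    fun n => SimpleFunc.approxOn id measurable_id univ 0 (mem_univ _) n
  have hsum : ∀ n, m.toMeasure.map (T n) =
      ∑ i ∈ insert x (T n).range, m.toMeasure (T n ⁻¹' {i}) • Measure.dirac i := fun n =>
    map_simpleFunc_eq_sum _ _ (Finset.subset_insert _ _)
  have hpr : ∀ n, IsProbabilityMeasure (m.toMeasure.map (T n)) := fun n =>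
    Measure.isProbabilityMeasure_map (T n).measurable.aemeasurable
  have hw : ∀ n, ∑ i ∈ insert x (T n).range, m.toMeasure (T n ⁻¹' {i}) = 1 := fun n => by
    have h1 := (hpr n).measure_univ
    rw [hsum n, Measure.finsetSum_apply] at h1
    simpa using h1
  let μ : ℕ → PSpace d 2 := fun n => ⟨m.toMeasure.map (T n), hpr n, by
    rw [hsum n, lintegral_finsetSum_measure]
    refine ENNReal.sum_lt_top.2 fun i _ => ?_
    rw [lintegral_smul_measure, lintegral_dirac]
    exact ENNReal.mul_lt_top (measure_lt_top _ _) (by finiteness)⟩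
  refine hcl m μ (fun n => h _ _ (Finset.mem_insert_self _ _) (hw n) _ (hsum n)) ?_
  have hlim : Tendsto (fun n => eLpNorm (⇑(T n) - id) 2 m.toMeasure) atTop (𝓝 0) := by
    refine SimpleFunc.tendsto_approxOn_Lp_eLpNorm measurable_id (mem_univ _)
      ENNReal.ofNat_ne_top (by simp) ?_
    rw [eLpNorm_lt_top_iff_lintegral_rpow_enorm_lt_top two_ne_zero ENNReal.ofNat_ne_top]
    simpa using m.moment_lt_top
  have hlim2 : Tendsto (fun n => eLpNorm (⇑(T n) - id) 2 m.toMeasure ^ 2) atTop (𝓝 0) := by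
    simpa using ENNReal.Tendsto.pow (n := 2) hlim
  refine tendsto_wnhds_of_coupling two_ne_zero _ hlim2 (Eventually.of_forall fun n => ?_)
  have hm : Measurable fun y => (y, T n y) := measurable_id.prodMk (T n).measurable
  refine ⟨m.toMeasure.map fun y => (y, T n y), ?_, ?_, le_of_eq ?_⟩
  · rw [Measure.map_map measurable_fst hm]; exact Measure.map_id
  · rw [Measure.map_map measurable_snd hm]; rfl
  · rw [lintegral_map (by fun_prop) hm,
      eLpNorm_eq_lintegral_rpow_enorm_toReal two_ne_zero ENNReal.ofNat_ne_top]
    simp only [ENNReal.toReal_ofNat, ENNReal.rpow_ofNat, Pi.sub_apply, ← edist_eq_enorm_sub, id]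
    rw [← ENNReal.rpow_natCast, ← ENNReal.rpow_mul]
    norm_num
    simp only [edist_comm]

/-- A small multiple of the Dirac mass at `x` is mixed in to give `x` a positive weight. -/
lemma of_finite_support_of_weight_pos (x : E d)
    (hcl : ∀ (m : PSpace d 2) (μ : ℕ → PSpace d 2), (∀ n, q (μ n)) →
      Tendsto μ atTop (wnhds m) → q m)
    (h : ∀ (s : Finset (E d)) (w : E d → ENNReal), x ∈ s → w x ≠ 0 → ∑ i ∈ s, w i = 1 →
      ∀ m : PSpace d 2, m.toMeasure = ∑ i ∈ s, w i • Measure.dirac i → q m)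
    (m : PSpace d 2) : q m := by
  classical
  refine of_finite_support x hcl (fun s w hx hw m hm => ?_) m
  have := m.isProb
  let t : ℕ → ENNReal := fun n => ((n : ENNReal) + 1)⁻¹
  have ht0 : ∀ n, t n ≠ 0 := fun n => ENNReal.inv_ne_zero.2 (by finiteness)
  have ht1 : ∀ n, t n ≤ 1 := fun n => ENNReal.inv_le_one.2 le_add_self
  have htt : ∀ n, (1 - t n) + t n = 1 := fun n => tsub_add_cancel_of_le (ht1 n)
  have htlim : Tendsto t atTop (𝓝 0) := by
    have h1 := (tendsto_add_atTop_iff_nat 1).2 ENNReal.tendsto_inv_nat_nhds_zero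
    simpa [t] using h1
  let w' : ℕ → E d → ENNReal := fun n i => (1 - t n) * w i + t n * (Pi.single x 1 : E d → ENNReal) i
  have hw' : ∀ n, ∑ i ∈ s, w' n i = 1 := fun n => by
    simp only [w', Finset.sum_add_distrib, ← Finset.mul_sum, hw]
    rw [Finset.sum_pi_single']
    simp [hx, htt n]
  have hmix : ∀ n, ∑ i ∈ s, w' n i • Measure.dirac i =
      (1 - t n) • m.toMeasure + t n • Measure.dirac x := fun n => by
    simp only [w', add_smul, Finset.sum_add_distrib, mul_smul, ← Finset.smul_sum, ← hm]
    congr 2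
    rw [Finset.sum_eq_single x]
    · simp
    · intro i _ hi; simp [hi]
    · exact fun hx' => absurd hx hx'
  have hmx : ∫⁻ y, edist y x ^ 2 ∂m.toMeasure < ⊤ := by
    have h1 : ∀ y : E d, edist y x ^ 2 ≤ 2 * ‖y‖ₑ ^ 2 + 2 * ‖x‖ₑ ^ 2 := fun y => by
      have h2 : edist y x ≤ ‖y‖ₑ + ‖x‖ₑ := by
        rw [edist_eq_enorm_sub]; exact enorm_sub_le
      have h3 := ENNReal.rpow_add_le_mul_rpow_add_rpow ‖y‖ₑ ‖x‖ₑ (p := 2) one_le_two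
      norm_num at h3
      calc edist y x ^ 2 ≤ (‖y‖ₑ + ‖x‖ₑ) ^ 2 := by gcongr
        _ ≤ 2 * (‖y‖ₑ ^ 2 + ‖x‖ₑ ^ 2) := h3
        _ = _ := by ring
    refine (lintegral_mono h1).trans_lt ?_
    rw [lintegral_add_right _ measurable_const, lintegral_const_mul _ (by fun_prop)]
    have := m.moment_lt_top
    simp only [lintegral_const, measure_univ, mul_one]
    finiteness
  let μ : ℕ → PSpace d 2 := fun n => ⟨∑ i ∈ s, w' n i • Measure.dirac i,
    isProbabilityMeasure_finset_smul s _ (hw' n) _ fun i => inferInstance, by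
      rw [hmix, lintegral_add_measure, lintegral_smul_measure, lintegral_smul_measure,
        lintegral_dirac]
      have := m.moment_lt_top
      have h1 : t n ≠ ⊤ := ne_top_of_le_ne_top ENNReal.one_ne_top (ht1 n)
      simp only [smul_eq_mul]
      finiteness⟩
  refine hcl m μ (fun n => h s (w' n) hx ?_ (hw' n) _ rfl) ?_
  · simp [w', ht0 n]
  have hclim : Tendsto (fun n => t n * ∫⁻ y, edist y x ^ 2 ∂m.toMeasure) atTop (𝓝 0) := by
    simpa using ENNReal.Tendsto.mul_const htlim (Or.inr hmx.ne)
  refine tendsto_wnhds_of_coupling two_ne_zero _ hclim (Eventually.of_forall fun n => ?_)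
  have hm1 : Measurable fun y : E d => (y, y) := by fun_prop
  have hm2 : Measurable fun y : E d => (y, x) := by fun_prop
  refine ⟨(1 - t n) • m.toMeasure.map (fun y => (y, y)) + t n • m.toMeasure.map (fun y => (y, x)),
    ?_, ?_, le_of_eq ?_⟩
  · rw [Measure.map_add _ _ measurable_fst, Measure.map_smul, Measure.map_smul,
      Measure.map_map measurable_fst hm1, Measure.map_map measurable_fst hm2]
    change (1 - t n) • m.toMeasure.map id + t n • m.toMeasure.map id = _
    rw [Measure.map_id, ← add_smul, htt, one_smul]
  · rw [Measure.map_add _ _ measurable_snd, Measure.map_smul, Measure.map_smul,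
      Measure.map_map measurable_snd hm1, Measure.map_map measurable_snd hm2]
    change (1 - t n) • m.toMeasure.map id + t n • m.toMeasure.map (fun _ => x) = _
    rw [Measure.map_id, Measure.map_const, measure_univ, one_smul, ← hmix]
  · rw [lintegral_add_measure, lintegral_smul_measure, lintegral_smul_measure,
      lintegral_map (by fun_prop) hm1, lintegral_map (by fun_prop) hm2]
    simp

/-- Density of the ball mixtures one of whose balls is centred at a given point: a property that
is closed under Wasserstein limits and holds for them holds for all of `P_2(ℝᵈ)`. -/
lemma of_ballMixture (x : E d)
    (hcl : ∀ (m : PSpace d 2) (μ : ℕ → PSpace d 2), (∀ n, q (μ n)) →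
      Tendsto μ atTop (wnhds m) → q m)
    (h : ∀ (s : Finset (E d)) (w : E d → ENNReal) (r : ℝ), 0 < r → x ∈ s → w x ≠ 0 →
      ∑ i ∈ s, w i = 1 → ∀ m : PSpace d 2, m.toMeasure = ballMixture s w r → q m)
    (m : PSpace d 2) : q m := by
  refine of_finite_support_of_weight_pos x hcl (fun s w hx hwx hw m hm => ?_) m
  let r : ℕ → ℝ := fun n => 1 / ((n : ℝ) + 1)
  have hr : ∀ n, 0 < r n := fun n => by positivity
  have hrlim : Tendsto (fun n => ENNReal.ofReal (r n) ^ 2) atTop (𝓝 0) := by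
    have h1 : Tendsto r atTop (𝓝 0) := tendsto_one_div_add_atTop_nhds_zero_nat
    have h2 := ENNReal.tendsto_ofReal h1
    simpa using ENNReal.Tendsto.pow (n := 2) h2
  let μ : ℕ → PSpace d 2 := fun n => ⟨ballMixture s w (r n),
    isProbabilityMeasure_finset_smul s _ hw _ fun i => isProbabilityMeasure_cond_ball i (hr n), by
      have hbound : ∀ i ∈ s, ∫⁻ y, ‖y‖ₑ ^ 2
          ∂(ProbabilityTheory.cond volume (Metric.ball i (r n))) ≤
          ∑ j ∈ s, (‖j‖ₑ + ENNReal.ofReal (r n)) ^ 2 := fun i hi => by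
        refine (lintegral_cond_ball_le i (hr n) (c := (‖i‖ₑ + ENNReal.ofReal (r n)) ^ 2)
          fun y hy => ?_).trans
          (Finset.single_le_sum (f := fun j => (‖j‖ₑ + ENNReal.ofReal (r n)) ^ 2)
            (fun _ _ => zero_le) hi)
        gcongr
        have h1 : ‖y‖ ≤ ‖i‖ + r n := by
          have := norm_sub_le i (i - y)
          rw [dist_eq_norm] at hy
          simp only [sub_sub_cancel] at this
          linarith
        rw [← ofReal_norm, ← ofReal_norm, ← ENNReal.ofReal_add (norm_nonneg _) (hr n).le]
        exact ENNReal.ofReal_le_ofReal h1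
      refine (lintegral_finset_smul_le s w hw _ _ hbound).trans_lt ?_
      exact ENNReal.sum_lt_top.2 fun i _ => by finiteness⟩
  refine hcl m μ (fun n => h s w (r n) (hr n) hx hwx hw _ rfl) ?_
  refine tendsto_wnhds_of_coupling two_ne_zero _ hrlim (Eventually.of_forall fun n => ?_)
  have hmk : ∀ i : E d, Measurable (Prod.mk i : E d → E d × E d) := fun i => by fun_prop
  refine ⟨∑ i ∈ s, w i • (ProbabilityTheory.cond volume (Metric.ball i (r n))).map (Prod.mk i),
    ?_, ?_, ?_⟩
  · rw [map_finset_smul _ _ _ measurable_fst, hm]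
    refine Finset.sum_congr rfl fun i _ => ?_
    have := isProbabilityMeasure_cond_ball i (hr n)
    rw [Measure.map_map measurable_fst (hmk i)]
    change _ • Measure.map (fun _ => i) _ = _
    rw [Measure.map_const, measure_univ, one_smul]
  · rw [map_finset_smul _ _ _ measurable_snd]
    refine Finset.sum_congr rfl fun i _ => ?_
    rw [Measure.map_map measurable_snd (hmk i)]
    change _ • Measure.map id _ = _
    rw [Measure.map_id]
  · refine lintegral_finset_smul_le s w hw _ _ fun i _ => ?_
    rw [lintegral_map (by fun_prop) (hmk i)]
    refine lintegral_cond_ball_le i (hr n) fun y hy => ?_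
    gcongr
    rw [edist_dist]
    exact ENNReal.ofReal_le_ofReal hy.le

end Density

/-! ### The essential supremum of the density of a ball mixture -/

section DensityNorm

variable {d : ℕ}

/-- The density of `ballMixture s w r`. -/
noncomputable def ballMixtureDensity (s : Finset (E d)) (w : E d → ENNReal) (r : ℝ) (x : E d) :
    ENNReal :=
  ∑ i ∈ s, w i * (Metric.ball i r).indicator (fun _ => (volume (Metric.ball i r))⁻¹) x

variable {s : Finset (E d)} {w : E d → ENNReal} {r : ℝ}

lemma measurable_ballMixtureDensity : Measurable (ballMixtureDensity s w r) :=
  Finset.measurable_fun_sum _ fun _ _ =>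
    measurable_const.mul (measurable_const.indicator Metric.isOpen_ball.measurableSet)

lemma ballMixture_eq_withDensity :
    ballMixture s w r = volume.withDensity (ballMixtureDensity s w r) := by
  ext A hA
  rw [withDensity_apply _ hA, ballMixture, Measure.finsetSum_apply]
  simp only [ballMixtureDensity]
  have hm : ∀ i ∈ s, Measurable fun x : E d =>
      w i * (Metric.ball i r).indicator (fun _ => (volume (Metric.ball i r))⁻¹) x := fun i _ =>
    measurable_const.mul (measurable_const.indicator Metric.isOpen_ball.measurableSet)
  rw [lintegral_finsetSum _ hm]
  refine Finset.sum_congr rfl fun i _ => ?_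
  rw [lintegral_const_mul _ (measurable_const.indicator Metric.isOpen_ball.measurableSet),
    lintegral_indicator_const Metric.isOpen_ball.measurableSet, Measure.smul_apply, smul_eq_mul,
    ProbabilityTheory.cond_apply Metric.isOpen_ball.measurableSet,
    Measure.restrict_apply Metric.isOpen_ball.measurableSet]

lemma ballMixtureDensity_ne_top (hr : 0 < r) (hw : ∑ i ∈ s, w i = 1) (x : E d) :
    ballMixtureDensity s w r x ≠ ⊤ := by
  refine ENNReal.sum_ne_top.2 fun i hi => ENNReal.mul_ne_top ?_ ?_
  · exact ne_top_of_le_ne_top ENNReal.one_ne_top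
      (hw ▸ Finset.single_le_sum (fun _ _ => zero_le) hi)
  · refine ne_top_of_le_ne_top (ENNReal.inv_ne_top.2 (volume_ball_ne i hr).1)
      (indicator_le_self _ _ _)

/-- The density takes finitely many values and, the balls being open, does not decrease near a
point; so its maximum is attained on a whole ball. -/
lemma exists_ball_max_density : ∃ (x₀ : E d) (δ : ℝ), 0 < δ ∧
    (∀ x, ballMixtureDensity s w r x ≤ ballMixtureDensity s w r x₀) ∧
    ∀ x ∈ Metric.ball x₀ δ, ballMixtureDensity s w r x = ballMixtureDensity s w r x₀ := by
  classical
  have hfin : (range (ballMixtureDensity s w r)).Finite := by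
    refine (s.powerset.image fun u => ∑ i ∈ s, w i *
      (if i ∈ u then (volume (Metric.ball i r))⁻¹ else 0)).finite_toSet.subset ?_
    rintro _ ⟨x, rfl⟩
    refine Finset.mem_coe.2 (Finset.mem_image.2 ⟨s.filter fun i => x ∈ Metric.ball i r, ?_, ?_⟩)
    · simp
    · refine Finset.sum_congr rfl fun i hi => ?_
      simp [indicator_apply, hi]
  obtain ⟨_, ⟨x₀, rfl⟩, hmax⟩ := exists_max_image _ id hfin (range_nonempty _)
  have hnear : ∀ᶠ x in 𝓝 x₀, ballMixtureDensity s w r x₀ ≤ ballMixtureDensity s w r x := by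
    have h : ∀ᶠ x in 𝓝 x₀, ∀ i ∈ s, x₀ ∈ Metric.ball i r → x ∈ Metric.ball i r := by
      rw [Filter.eventually_all_finset]
      intro i _
      by_cases hx : x₀ ∈ Metric.ball i r
      · filter_upwards [Metric.isOpen_ball.mem_nhds hx] with x hx' _ using hx'
      · exact Eventually.of_forall fun x hx' => absurd hx' hx
    filter_upwards [h] with x hx
    refine Finset.sum_le_sum fun i hi => mul_le_mul_right ?_ _
    by_cases hx₀ : x₀ ∈ Metric.ball i r
    · rw [indicator_of_mem hx₀, indicator_of_mem (hx i hi hx₀)]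
    · rw [indicator_of_notMem hx₀]; exact zero_le
  obtain ⟨δ, hδ, hball⟩ := Metric.eventually_nhds_iff.1 hnear
  refine ⟨x₀, δ, hδ, fun x => hmax _ ⟨x, rfl⟩, fun x hx => ?_⟩
  exact le_antisymm (hmax _ ⟨x, rfl⟩) (hball hx)

lemma rnDeriv_ballMixture :
    (ballMixture s w r).rnDeriv volume =ᵐ[volume] ballMixtureDensity s w r := by
  rw [ballMixture_eq_withDensity]
  exact Measure.rnDeriv_withDensity _ measurable_ballMixtureDensity

lemma essSup_rnDeriv_ballMixture {x₀ : E d} {δ : ℝ} (hδ : 0 < δ)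
    (hmax : ∀ x, ballMixtureDensity s w r x ≤ ballMixtureDensity s w r x₀)
    (heq : ∀ x ∈ Metric.ball x₀ δ, ballMixtureDensity s w r x = ballMixtureDensity s w r x₀) :
    essSup ((ballMixture s w r).rnDeriv volume) volume = ballMixtureDensity s w r x₀ := by
  rw [essSup_congr_ae rnDeriv_ballMixture]
  refine le_antisymm (essSup_le_of_ae_le _ (Eventually.of_forall hmax)) ?_
  by_contra! hlt
  have h := ENNReal.ae_le_essSup (μ := volume) (ballMixtureDensity s w r)
  have h0 : volume (Metric.ball x₀ δ) = 0 := by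
    refine measure_mono_null (fun x hx => ?_) (ae_iff.1 h)
    simp only [not_le, mem_ofPred_eq]
    rwa [heq x hx]
  exact (volume_ball_ne x₀ hδ).1 h0

lemma ae_norm_le_ballMixture : ∃ R : ℝ, ∀ᵐ x ∂(ballMixture s w r), ‖x‖ ≤ R := by
  refine ⟨(∑ i ∈ s, ‖i‖) + r, ?_⟩
  have h : ∀ A : Set (E d), (∀ i ∈ s, ProbabilityTheory.cond volume (Metric.ball i r) A = 0) →
      ballMixture s w r A = 0 := fun A hA => by
    rw [ballMixture, Measure.finsetSum_apply]
    exact Finset.sum_eq_zero fun i hi => by rw [Measure.smul_apply, hA i hi, smul_zero]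
  refine h _ fun i hi => ae_iff.1 ((ae_cond_ball i r).mono fun y hy => ?_)
  have h1 := norm_sub_le i (i - y)
  have h2 : ‖i‖ ≤ ∑ i ∈ s, ‖i‖ :=
    Finset.single_le_sum (f := fun i : E d => ‖i‖) (fun _ _ => norm_nonneg _) hi
  rw [dist_eq_norm] at hy
  simp only [sub_sub_cancel] at h1
  exact h1.trans (add_le_add h2 hy.le)

/-- The centres of the balls of positive weight belong to the support of the mixture. -/
lemma eq_of_ae_ballMixture {x : E d} (hr : 0 < r) (hx : x ∈ s) (hwx : w x ≠ 0) {f : E d → ℝ}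
    (hf : Continuous f) {c : ℝ} (h : ∀ᵐ y ∂(ballMixture s w r), f y = c) : f x = c := by
  by_contra hne
  obtain ⟨ρ, hρ, hρf⟩ := Metric.eventually_nhds_iff.1 (hf.continuousAt.eventually_ne hne)
  have h0 : ballMixture s w r (Metric.ball x ρ) = 0 :=
    measure_mono_null (fun y hy => hρf hy) (ae_iff.1 h)
  rw [ballMixture, Measure.finsetSum_apply, Finset.sum_eq_zero_iff] at h0
  have h1 := h0 x hx
  rw [Measure.smul_apply, smul_eq_mul, mul_eq_zero, or_iff_right hwx,
    ProbabilityTheory.cond_apply Metric.isOpen_ball.measurableSet, mul_eq_zero,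
    or_iff_right (ENNReal.inv_ne_zero.2 (volume_ball_ne x hr).2)] at h1
  refine (volume_ball_ne x (lt_min hr hρ)).1 (measure_mono_null (fun y hy => ?_) h1)
  exact ⟨Metric.ball_subset_ball (min_le_left _ _) hy,
    Metric.ball_subset_ball (min_le_right _ _) hy⟩

section Random

variable {Ω : Type*} [MeasurableSpace Ω] {P : Measure Ω} [IsProbabilityMeasure P]

lemma integral_comp_eq_toReal_lintegral_law (X : L2 P d) {g : E d → ℝ} (hg : Continuous g)
    (hg0 : ∀ x, 0 ≤ g x) (hac : (law X).toMeasure ≪ volume) :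
    ∫ ω, g (X ω) ∂P = (∫⁻ x, (law X).toMeasure.rnDeriv volume x * ENNReal.ofReal (g x)).toReal := by
  have := (law X).isProb
  have h1 : ∫ ω, g (X ω) ∂P = ∫ x, g x ∂(law X).toMeasure :=
    (integral_map (measurable_coe_L2 X).aemeasurable hg.aestronglyMeasurable).symm
  rw [h1, integral_eq_lintegral_of_nonneg_ae (Eventually.of_forall hg0) hg.aestronglyMeasurable]
  conv_lhs => rw [← Measure.withDensity_rnDeriv_eq _ _ hac]
  rw [lintegral_withDensity_eq_lintegral_mul _ (Measure.measurable_rnDeriv _ _) (by fun_prop)]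
  rfl

/-- The duality between bounded densities and integrable functions. -/
lemma integral_comp_le_densNorm_mul {X : L2 P d} (hX : X ∈ LInftyAc P d) {g : E d → ℝ}
    (hg : Continuous g) (hg0 : ∀ x, 0 ≤ g x) (hgi : Integrable g) :
    ∫ ω, g (X ω) ∂P ≤ densNorm X * ∫ x, g x := by
  rw [integral_comp_eq_toReal_lintegral_law X hg hg0 hX.1, densNorm,
    integral_eq_lintegral_of_nonneg_ae (Eventually.of_forall hg0) hg.aestronglyMeasurable,
    ← ENNReal.toReal_mul]
  have hfin : ∫⁻ x, ENNReal.ofReal (g x) ≠ ⊤ :=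
    ((hasFiniteIntegral_iff_ofReal (Eventually.of_forall hg0)).1 hgi.2).ne
  refine ENNReal.toReal_mono (ENNReal.mul_ne_top hX.2.ne hfin) ?_
  rw [← lintegral_const_mul _ (by fun_prop)]
  refine lintegral_mono_ae ?_
  filter_upwards [ENNReal.ae_le_essSup (μ := volume) ((law X).toMeasure.rnDeriv volume)] with x hx
  gcongr

lemma mem_LInftyAc_of_ballMixture (hr : 0 < r) (hw : ∑ i ∈ s, w i = 1) {X : L2 P d}
    (hX : (law X).toMeasure = ballMixture s w r) : X ∈ LInftyAc P d := by
  obtain ⟨x₀, δ, hδ, hmax, heq⟩ := exists_ball_max_density (s := s) (w := w) (r := r)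
  constructor
  · rw [hX, ballMixture_eq_withDensity]
    exact withDensity_absolutelyContinuous _ _
  · rw [hX, essSup_rnDeriv_ballMixture hδ hmax heq]
    exact (ballMixtureDensity_ne_top hr hw x₀).lt_top

/-- A function `g` that certifies the value of `densNorm` at a ball mixture: a bump supported where
the density is maximal. By duality `X ↦ 𝔼[g(X)] / ∫ g` bounds `densNorm` from below, with equality
at the given random variable; this is what makes `densNorm` subdifferentiable there. -/
lemma exists_bump_densNorm {X : L2 P d} (hX : (law X).toMeasure = ballMixture s w r) :
    ∃ g : E d → ℝ, ContDiff ℝ 2 g ∧ HasCompactSupport g ∧ 0 < ∫ x, g x ∧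
      (∀ Y ∈ LInftyAc P d, ∫ ω, g (Y ω) ∂P ≤ densNorm Y * ∫ x, g x) ∧
      ∫ ω, g (X ω) ∂P = densNorm X * ∫ x, g x := by
  obtain ⟨x₀, δ, hδ, hmax, heq⟩ := exists_ball_max_density (s := s) (w := w) (r := r)
  let b : ContDiffBump x₀ := ⟨δ / 3, δ / 2, by positivity, by linarith⟩
  have hbi : Integrable b := b.integrable
  refine ⟨b, b.contDiff, b.hasCompactSupport, b.integral_pos, fun Y hY =>
    integral_comp_le_densNorm_mul hY b.continuous (fun _ => b.nonneg) hbi, ?_⟩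
  rw [integral_comp_eq_toReal_lintegral_law X b.continuous (fun _ => b.nonneg), densNorm, hX,
    integral_eq_lintegral_of_nonneg_ae (Eventually.of_forall fun _ => b.nonneg)
      b.continuous.aestronglyMeasurable, ← ENNReal.toReal_mul,
    essSup_rnDeriv_ballMixture hδ hmax heq,
    ← lintegral_const_mul _ b.continuous.measurable.ennreal_ofReal]
  · congr 1
    refine lintegral_congr_ae ?_
    filter_upwards [rnDeriv_ballMixture (s := s) (w := w) (r := r)] with x hx
    rw [hx]
    by_cases hxb : x ∈ Metric.ball x₀ δ
    · rw [heq x hxb]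
    · have : b x = 0 := by
        rw [← Function.notMem_support, b.support_eq]
        exact fun h => hxb (Metric.ball_subset_ball (show δ / 2 ≤ δ by linarith) h)
      simp [this]
  · rw [hX, ballMixture_eq_withDensity]
    exact withDensity_absolutelyContinuous _ _

end Random

end DensityNorm

/-! ### Estimates for square integrable random variables -/

section SquareIntegrable

variable {Ω : Type*} [MeasurableSpace Ω] {P : Measure Ω} {d : ℕ}

lemma integrable_norm_mul (A B : L2 P d) : Integrable (fun ω => ‖A ω‖ * ‖B ω‖) P :=
  (Lp.memLp A).norm.integrable_mul (Lp.memLp B).norm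

lemma integrable_norm_sq (A : L2 P d) : Integrable (fun ω => ‖A ω‖ ^ 2) P := by
  simpa only [sq] using integrable_norm_mul A A

lemma integral_norm_sq (A : L2 P d) : ∫ ω, ‖A ω‖ ^ 2 ∂P = ‖A‖ ^ 2 := by
  have h : inner ℝ A A = ∫ ω, inner ℝ (A ω) (A ω) ∂P := L2.inner_def A A
  simpa only [real_inner_self_eq_norm_sq] using h.symm

lemma integral_norm_mul_le (A B : L2 P d) : ∫ ω, ‖A ω‖ * ‖B ω‖ ∂P ≤ ‖A‖ * ‖B‖ := by
  have h := integral_mul_le_Lp_mul_Lq_of_nonneg (μ := P) (p := 2) (q := 2)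
    Real.HolderConjugate.two_two (f := fun ω => ‖A ω‖) (g := fun ω => ‖B ω‖)
    (Eventually.of_forall fun _ => norm_nonneg _) (Eventually.of_forall fun _ => norm_nonneg _)
    (by simpa using (Lp.memLp A).norm) (by simpa using (Lp.memLp B).norm)
  simp only [Real.rpow_ofNat, integral_norm_sq, ← Real.sqrt_eq_rpow,
    Real.sqrt_sq (norm_nonneg _)] at h
  exact h

variable [IsProbabilityMeasure P]

lemma integrable_norm (A : L2 P d) : Integrable (fun ω => ‖A ω‖) P :=
  ((Lp.memLp A).integrable one_le_two).norm

lemma norm_const_L2 (c : E d) : ‖(Lp.const 2 P c : L2 P d)‖ = ‖c‖ := by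
  simp [Lp.norm_const]

lemma integral_norm_le (A : L2 P d) : ∫ ω, ‖A ω‖ ∂P ≤ ‖A‖ := by
  have h : (∫ ω, ‖A ω‖ ∂P) ^ 2 ≤ ∫ ω, ‖A ω‖ ^ 2 ∂P := by
    have h0 := integral_nonneg (μ := P)
      (f := fun ω => (‖A ω‖ - ∫ ω, ‖A ω‖ ∂P) ^ 2) (fun _ => sq_nonneg _)
    have e : ∀ ω, (‖A ω‖ - ∫ ω, ‖A ω‖ ∂P) ^ 2 =
        (‖A ω‖ ^ 2 - 2 * (∫ ω, ‖A ω‖ ∂P) * ‖A ω‖) + (∫ ω, ‖A ω‖ ∂P) ^ 2 := fun ω => by ring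
    simp only [e] at h0
    have j1 : Integrable (fun ω => 2 * (∫ ω, ‖A ω‖ ∂P) * ‖A ω‖) P :=
      (integrable_norm A).const_mul _
    have j2 : Integrable (fun ω => ‖A ω‖ ^ 2 - 2 * (∫ ω, ‖A ω‖ ∂P) * ‖A ω‖) P :=
      (integrable_norm_sq A).sub j1
    rw [integral_add j2 (integrable_const _), integral_sub (integrable_norm_sq A) j1,
      integral_const_mul] at h0
    simp at h0
    nlinarith
  rw [integral_norm_sq] at h
  exact abs_le_of_sq_le_sq' h (norm_nonneg _) |>.2

lemma integrable_growth_mul (A B : L2 P d) (a b : ℝ) :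
    Integrable (fun ω => (a + b * ‖A ω‖) * ‖B ω‖) P := by
  have h : ∀ ω, (a + b * ‖A ω‖) * ‖B ω‖ = a * ‖B ω‖ + b * (‖A ω‖ * ‖B ω‖) := fun ω => by ring
  simp only [h]
  exact ((integrable_norm B).const_mul a).add ((integrable_norm_mul A B).const_mul b)

/-- The Cauchy–Schwarz inequality, for an integrand that is affine in the norm of `A`. -/
lemma norm_integral_le_of_growth {G : Type*} [NormedAddCommGroup G] [NormedSpace ℝ G]
    (A B : L2 P d) {a b : ℝ} (ha : 0 ≤ a) (hb : 0 ≤ b) {f : Ω → G}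
    (hf : ∀ᵐ ω ∂P, ‖f ω‖ ≤ (a + b * ‖A ω‖) * ‖B ω‖) :
    ‖∫ ω, f ω ∂P‖ ≤ (a + b * ‖A‖) * ‖B‖ := by
  refine (norm_integral_le_of_norm_le (integrable_growth_mul A B a b) hf).trans ?_
  have h : ∀ ω, (a + b * ‖A ω‖) * ‖B ω‖ = a * ‖B ω‖ + b * (‖A ω‖ * ‖B ω‖) := fun ω => by ring
  simp only [h]
  rw [integral_add ((integrable_norm B).const_mul a) ((integrable_norm_mul A B).const_mul b),
    integral_const_mul, integral_const_mul]
  have h1 := integral_norm_le B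
  have h2 := integral_norm_mul_le A B
  calc _ ≤ a * ‖B‖ + b * (‖A‖ * ‖B‖) := by gcongr
    _ = _ := by ring

end SquareIntegrable

/-! ### The mean value inequality for Lions derivatives -/

section MeanValue

variable {Ω : Type*} [MeasurableSpace Ω] {P : Measure Ω} [IsProbabilityMeasure P] {d : ℕ}
variable {G : Type*} [NormedAddCommGroup G] [NormedSpace ℝ G]

lemma HasLDerivAt.integrable_apply {V : PSpace d 2 → G} {Ψ : E d → E d →L[ℝ] G} {X : L2 P d}
    (h : HasLDerivAt P V Ψ (law X)) (Z : L2 P d) : Integrable (fun ω => Ψ (X ω) (Z ω)) P :=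
  ((h X rfl).1.norm.integrable_mul (Lp.memLp Z).norm).mono'
    (isBoundedBilinearMap_apply.continuous.comp_aestronglyMeasurable
      ((h X rfl).1.1.prodMk (Lp.memLp Z).1))
    (Eventually.of_forall fun _ => ContinuousLinearMap.le_opNorm _ _)

lemma HasLDerivAt.sub {V V' : PSpace d 2 → G} {Ψ Ψ' : E d → E d →L[ℝ] G} {m : PSpace d 2}
    (h : HasLDerivAt P V Ψ m) (h' : HasLDerivAt P V' Ψ' m) :
    HasLDerivAt P (fun m => V m - V' m) (fun y => Ψ y - Ψ' y) m := by
  rintro X rfl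
  obtain ⟨hm, T, hT, hd⟩ := h X rfl
  obtain ⟨hm', T', hT', hd'⟩ := h' X rfl
  refine ⟨hm.sub hm', T - T', fun Z => ?_, hd.sub hd'⟩
  simp only [sub_apply, hT, hT']
  exact (integral_sub (h.integrable_apply Z) (h'.integrable_apply Z)).symm

/-- The mean value inequality along the segment from `A` to `A + B` in `L²`. -/
lemma norm_sub_sub_le_of_hasLDerivAt {V : PSpace d 2 → G} {Ψ : PSpace d 2 → E d → E d →L[ℝ] G}
    (hV : ∀ m, HasLDerivAt P V (Ψ m) m) (A B : L2 P d) {φ φ' : ℝ → G}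
    (hφ : ∀ s, HasDerivAt φ (φ' s) s) {M : ℝ}
    (hM : ∀ s ∈ Icc (0 : ℝ) 1,
      ‖∫ ω, Ψ (law (A + s • B)) ((A + s • B) ω) (B ω) ∂P - φ' s‖ ≤ M) :
    ‖V (law (A + B)) - V (law A) - (φ 1 - φ 0)‖ ≤ M := by
  have hderiv : ∀ s : ℝ, HasDerivAt (fun s : ℝ => V (law (A + s • B)) - φ s)
      (∫ ω, Ψ (law (A + s • B)) ((A + s • B) ω) (B ω) ∂P - φ' s) s := by
    intro s
    obtain ⟨-, T, hT, hd⟩ := hV (law (A + s • B)) (A + s • B) rfl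
    have hl : HasDerivAt (fun s : ℝ => A + s • B) B s := by
      simpa using ((hasDerivAt_id s).smul_const B).const_add A
    rw [← hT]
    exact (hd.comp_hasDerivAt s hl).sub (hφ s)
  have h := norm_image_sub_le_of_norm_deriv_le_segment_01'
    (fun s _ => (hderiv s).hasDerivWithinAt) (fun s hs => hM s (Ico_subset_Icc_self hs))
  have e : V (law (A + B)) - V (law A) - (φ 1 - φ 0) =
      V (law (A + (1 : ℝ) • B)) - φ 1 - (V (law (A + (0 : ℝ) • B)) - φ 0) := by
    rw [one_smul, zero_smul, add_zero]; abel
  rw [e]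
  exact h

end MeanValue

/-! ### Local bounds for the derivatives -/

section LocalBounds

variable {Ω : Type*} [MeasurableSpace Ω] {P : Measure Ω} {d : ℕ}

lemma norm_add_smul_sub_le {X X₀ : L2 P d} {r : ℝ} (hX : ‖X - X₀‖ ≤ r) {s : ℝ}
    (hs : s ∈ Icc (0 : ℝ) 1) : ‖X₀ + s • (X - X₀) - X₀‖ ≤ r := by
  rw [add_sub_cancel_left, norm_smul, Real.norm_of_nonneg hs.1]
  exact (mul_le_of_le_one_left (norm_nonneg _) hs.2).trans hX

lemma norm_le_of_sub_le {X X₀ : L2 P d} {r : ℝ} (hX : ‖X - X₀‖ ≤ r) (hr : r ≤ 1) :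
    ‖X‖ ≤ ‖X₀‖ + 1 := by
  have := norm_add_le (X - X₀) X₀
  rw [sub_add_cancel] at this
  linarith

variable [IsProbabilityMeasure P]
variable {U : E d → PSpace d 2 → ℝ} {DmU : E d → PSpace d 2 → E d → E d}
  {DymU DxmU : E d → PSpace d 2 → E d → E d →L[ℝ] E d}
  {DmmU : E d → PSpace d 2 → E d → E d → E d →L[ℝ] E d}

/-- The growth bounds of `HasContDerivs`, with a common constant `C`, for `x` in the ball of radius
`R` and for the laws of the random variables in the ball of radius `r` around `X₀`. -/
structure GrowthBound (DmU : E d → PSpace d 2 → E d → E d)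
    (DymU DxmU : E d → PSpace d 2 → E d → E d →L[ℝ] E d)
    (DmmU : E d → PSpace d 2 → E d → E d → E d →L[ℝ] E d)
    (X₀ : L2 P d) (R C r : ℝ) : Prop where
  nonneg : 0 ≤ C
  pos : 0 < r
  le_one : r ≤ 1
  dm : ∀ x : E d, ‖x‖ ≤ R → ∀ X : L2 P d, ‖X - X₀‖ ≤ r → ∀ y,
    ‖DmU x (law X) y‖ ≤ C * (1 + ‖y‖)
  dym : ∀ x : E d, ‖x‖ ≤ R → ∀ X : L2 P d, ‖X - X₀‖ ≤ r → ∀ y,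
    ‖DymU x (law X) y‖ ≤ C * (1 + ‖y‖ ^ 2)
  dxm : ∀ x : E d, ‖x‖ ≤ R → ∀ X : L2 P d, ‖X - X₀‖ ≤ r → ∀ y,
    ‖DxmU x (law X) y‖ ≤ C * (1 + ‖y‖)
  dmm : ∀ x : E d, ‖x‖ ≤ R → ∀ X : L2 P d, ‖X - X₀‖ ≤ r → ∀ y y',
    ‖DmmU x (law X) y y'‖ ≤ C * (1 + ‖y‖) * (1 + ‖y'‖)

lemma HasContDerivs.exists_growthBound (hU : HasContDerivs P U DmU DymU DxmU DmmU)
    (X₀ : L2 P d) (R : ℝ) : ∃ C r, GrowthBound DmU DymU DxmU DmmU X₀ R C r := by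
  let q : Set (E d) → Prop := fun s => ∃ C r : ℝ, 0 ≤ C ∧ 0 < r ∧ ∀ x ∈ s, ∀ X : L2 P d,
    ‖X - X₀‖ ≤ r → ∀ y y' : E d,
      ‖DmU x (law X) y‖ ≤ C * (1 + ‖y‖) ∧ ‖DymU x (law X) y‖ ≤ C * (1 + ‖y‖ ^ 2) ∧
      ‖DxmU x (law X) y‖ ≤ C * (1 + ‖y‖) ∧
      ‖DmmU x (law X) y y'‖ ≤ C * (1 + ‖y‖) * (1 + ‖y'‖)
  have hq : q (Metric.closedBall 0 R) := by
    refine (isCompact_closedBall (0 : E d) R).induction_on (p := q)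
      ⟨0, 1, le_rfl, one_pos, by simp⟩ ?_ ?_ ?_
    · rintro s t hst ⟨C, r, hC, hr, h⟩
      exact ⟨C, r, hC, hr, fun x hx => h x (hst hx)⟩
    · rintro s t ⟨C, r, hC, hr, h⟩ ⟨C', r', hC', hr', h'⟩
      refine ⟨max C C', min r r', hC.trans (le_max_left _ _), lt_min hr hr', ?_⟩
      rintro x (hx | hx) X hX y y'
      · obtain ⟨h1, h2, h3, h4⟩ := h x hx X (hX.trans (min_le_left _ _)) y y'
        have := le_max_left C C'
        exact ⟨h1.trans (by gcongr), h2.trans (by gcongr), h3.trans (by gcongr),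
          h4.trans (by gcongr)⟩
      · obtain ⟨h1, h2, h3, h4⟩ := h' x hx X (hX.trans (min_le_right _ _)) y y'
        have := le_max_right C C'
        exact ⟨h1.trans (by gcongr), h2.trans (by gcongr), h3.trans (by gcongr),
          h4.trans (by gcongr)⟩
    · intro x _
      obtain ⟨C, hC⟩ := hU.growth x (law X₀)
      have hcont : Tendsto (fun p : E d × L2 P d => (p.1, law p.2)) (𝓝 (x, X₀))
          (𝓝 (x, law X₀)) :=
        (continuous_fst.prodMk (continuous_law.comp continuous_snd)).tendsto (x, X₀)
      obtain ⟨ε, hε, hball⟩ := Metric.eventually_nhds_iff.1 (hcont.eventually hC)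
      refine ⟨Metric.ball x ε, mem_nhdsWithin_of_mem_nhds (Metric.ball_mem_nhds _ hε),
        max C 0, ε / 2, le_max_right _ _, by positivity, fun x' hx' X hX y y' => ?_⟩
      have hlt : dist (x', X) (x, X₀) < ε := by
        rw [Prod.dist_eq, max_lt_iff]
        exact ⟨hx', by rw [dist_eq_norm]; linarith⟩
      obtain ⟨h1, h2, h3, h4⟩ := hball hlt y y'
      have := le_max_left C 0
      exact ⟨h1.trans (by gcongr), h2.trans (by gcongr), h3.trans (by gcongr),
        h4.trans (by gcongr)⟩
  obtain ⟨C, r, hC, hr, h⟩ := hq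
  have hmem : ∀ x : E d, ‖x‖ ≤ R → x ∈ Metric.closedBall (0 : E d) R := fun x hx => by simpa using hx
  have hle : ∀ X : L2 P d, ‖X - X₀‖ ≤ min r 1 → ‖X - X₀‖ ≤ r := fun X hX =>
    hX.trans (min_le_left _ _)
  exact ⟨C, min r 1, hC, lt_min hr one_pos, min_le_right _ _,
    fun x hx X hX y => (h x (hmem x hx) X (hle X hX) y 0).1,
    fun x hx X hX y => (h x (hmem x hx) X (hle X hX) y 0).2.1,
    fun x hx X hX y => (h x (hmem x hx) X (hle X hX) y 0).2.2.1,
    fun x hx X hX y y' => (h x (hmem x hx) X (hle X hX) y y').2.2.2⟩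

section

variable {X₀ : L2 P d} {R C r : ℝ}

lemma HasContDerivs.norm_DmU_sub_law_le (hU : HasContDerivs P U DmU DymU DxmU DmmU)
    (hB : GrowthBound DmU DymU DxmU DmmU X₀ R C r) {x : E d} (hx : ‖x‖ ≤ R) {X : L2 P d}
    (hX : ‖X - X₀‖ ≤ r) (y : E d) :
    ‖DmU x (law X) y - DmU x (law X₀) y‖ ≤ C * (1 + ‖y‖) * (2 + ‖X₀‖) * ‖X - X₀‖ := by
  have hC := hB.nonneg
  have h := norm_sub_sub_le_of_hasLDerivAt (fun m => hU.hasDeriv_mm x m y) X₀ (X - X₀)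
    (φ := fun _ => 0) (φ' := fun _ => 0) (fun s => hasDerivAt_const _ _)
    (M := C * (1 + ‖y‖) * (2 + ‖X₀‖) * ‖X - X₀‖) ?_
  · simpa using h
  intro s hs
  rw [sub_zero]
  have hXs := norm_add_smul_sub_le hX hs
  refine (norm_integral_le_of_growth (X₀ + s • (X - X₀)) (X - X₀) (a := C * (1 + ‖y‖))
    (b := C * (1 + ‖y‖)) (by positivity) (by positivity) (Eventually.of_forall fun ω => ?_)).trans ?_
  · refine (ContinuousLinearMap.le_opNorm _ _).trans ?_
    gcongr
    refine (hB.dmm x hx _ hXs y _).trans_eq (by ring)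
  · have : 1 + ‖X₀ + s • (X - X₀)‖ ≤ 2 + ‖X₀‖ := by
      have := norm_le_of_sub_le hXs hB.le_one
      linarith
    calc _ = C * (1 + ‖y‖) * (1 + ‖X₀ + s • (X - X₀)‖) * ‖X - X₀‖ := by ring
      _ ≤ _ := by gcongr

lemma HasContDerivs.norm_DmU_sub_fst_le (hU : HasContDerivs P U DmU DymU DxmU DmmU)
    (hB : GrowthBound DmU DymU DxmU DmmU X₀ R C r) {x x' : E d} (hx : ‖x‖ ≤ R) (hx' : ‖x'‖ ≤ R)
    {X : L2 P d} (hX : ‖X - X₀‖ ≤ r) (y : E d) :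
    ‖DmU x' (law X) y - DmU x (law X) y‖ ≤ C * (1 + ‖y‖) * ‖x' - x‖ :=
  Convex.norm_image_sub_le_of_norm_hasFDerivWithin_le (s := Metric.closedBall 0 R)
    (fun z _ => (hU.hasDeriv_xm z (law X) y).hasFDerivWithinAt)
    (fun z hz => hB.dxm z (by simpa using hz) X hX y) (convex_closedBall _ _)
    (by simpa using hx) (by simpa using hx')

lemma HasContDerivs.norm_DmU_sub_snd_le (hU : HasContDerivs P U DmU DymU DxmU DmmU)
    (hB : GrowthBound DmU DymU DxmU DmmU X₀ R C r) {x : E d} (hx : ‖x‖ ≤ R)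
    {X : L2 P d} (hX : ‖X - X₀‖ ≤ r) {R₀ : ℝ} {y : E d} (hy : ‖y‖ ≤ R₀) (ζ : E d) :
    ‖DmU x (law X) (y + ζ) - DmU x (law X) y‖ ≤ C * (4 + 4 * R₀ + R₀ ^ 2) * ‖ζ‖ := by
  have hC := hB.nonneg
  have hR₀ : 0 ≤ R₀ := (norm_nonneg _).trans hy
  rcases le_total ‖ζ‖ 1 with hζ | hζ
  · have h := Convex.norm_image_sub_le_of_norm_hasFDerivWithin_le
      (s := Metric.closedBall (0 : E d) (R₀ + 1)) (C := C * (1 + (R₀ + 1) ^ 2))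
      (fun z _ => (hU.hasDeriv_ym x (law X) z).hasFDerivWithinAt)
      (fun z hz => (hB.dym x hx X hX z).trans (by
        have : ‖z‖ ≤ R₀ + 1 := by simpa using hz
        gcongr)) (convex_closedBall _ _) (x := y) (y := y + ζ)
      (by simpa using hy.trans (by linarith))
      (by simpa using (norm_add_le y ζ).trans (add_le_add hy hζ))
    rw [add_sub_cancel_left] at h
    have h4 : 1 + (R₀ + 1) ^ 2 ≤ 4 + 4 * R₀ + R₀ ^ 2 := by nlinarith
    refine h.trans ?_
    gcongr
  · have h1 := hB.dm x hx X hX (y + ζ)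
    have h2 := hB.dm x hx X hX y
    have h3 := norm_add_le y ζ
    calc _ ≤ ‖DmU x (law X) (y + ζ)‖ + ‖DmU x (law X) y‖ := norm_sub_le _ _
      _ ≤ C * (1 + (R₀ + ‖ζ‖)) + C * (1 + R₀) :=
          add_le_add (h1.trans (by gcongr; linarith)) (h2.trans (by gcongr))
      _ = C * ((2 + 2 * R₀) + ‖ζ‖) := by ring
      _ ≤ C * ((4 + 4 * R₀ + R₀ ^ 2) * ‖ζ‖) := by
          gcongr
          nlinarith [mul_nonneg hR₀ (sub_nonneg.2 hζ), sq_nonneg R₀,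
            mul_nonneg (sq_nonneg R₀) (norm_nonneg ζ)]
      _ = _ := by ring

/-- The Lipschitz estimate for `D_m U` at a point whose last variable is bounded. The displacement
`ζ` of that variable is arbitrary: large ones are covered by the linear growth of `D_m U`. -/
lemma HasContDerivs.exists_norm_DmU_sub_le (hU : HasContDerivs P U DmU DymU DxmU DmmU)
    (hB : GrowthBound DmU DymU DxmU DmmU X₀ R C r) (R₀ : ℝ) :
    ∃ K, 0 ≤ K ∧ ∀ x x' : E d, ‖x‖ ≤ R → ‖x'‖ ≤ R → ∀ X : L2 P d, ‖X - X₀‖ ≤ r →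
      ∀ y ζ : E d, ‖y‖ ≤ R₀ →
      ‖DmU x' (law X) (y + ζ) - DmU x (law X₀) y‖ ≤ K * (‖x' - x‖ + ‖X - X₀‖ + ‖ζ‖) := by
  have hC := hB.nonneg
  set k : ℝ := max R₀ 0
  set ρ : ℝ := max R 0
  set K : ℝ := C * (1 + k) * (2 + ‖X₀‖) + C * (4 + 4 * k + k ^ 2) + C * (1 + k) + C * (2 * ρ)
    with hK
  have hk : 0 ≤ k := le_max_right _ _
  have hρ : 0 ≤ ρ := le_max_right _ _
  have a1 : 0 ≤ C * (1 + k) * (2 + ‖X₀‖) := by positivity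
  have a2 : 0 ≤ C * (4 + 4 * k + k ^ 2) := by positivity
  have a3 : 0 ≤ C * (1 + k) := by positivity
  have a4 : 0 ≤ C * (2 * ρ) := by positivity
  refine ⟨K, by positivity, fun x x' hx hx' X hX y ζ hy => ?_⟩
  have hy' : ‖y‖ ≤ k := hy.trans (le_max_left _ _)
  have h1 := hU.norm_DmU_sub_law_le hB hx hX y
  have h2 := hU.norm_DmU_sub_snd_le hB hx hX hy' ζ
  have h3 := hU.norm_DmU_sub_fst_le hB hx hx' hX (y + ζ)
  have h1' : C * (1 + ‖y‖) * (2 + ‖X₀‖) * ‖X - X₀‖ ≤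
      C * (1 + k) * (2 + ‖X₀‖) * ‖X - X₀‖ := by gcongr
  have hxx : ‖x' - x‖ ≤ 2 * ρ := by
    have := norm_sub_le x' x
    have : R ≤ ρ := le_max_left _ _
    linarith
  have h3' : C * (1 + ‖y + ζ‖) * ‖x' - x‖ ≤ C * (1 + k) * ‖x' - x‖ + C * (2 * ρ) * ‖ζ‖ := by
    have h4 : 1 + ‖y + ζ‖ ≤ 1 + k + ‖ζ‖ := by
      have := norm_add_le y ζ
      linarith
    calc C * (1 + ‖y + ζ‖) * ‖x' - x‖ ≤ C * (1 + k + ‖ζ‖) * ‖x' - x‖ := by gcongr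
      _ = C * (1 + k) * ‖x' - x‖ + C * ‖x' - x‖ * ‖ζ‖ := by ring
      _ ≤ _ := by gcongr
  have htri : ‖DmU x' (law X) (y + ζ) - DmU x (law X₀) y‖ ≤
      ‖DmU x' (law X) (y + ζ) - DmU x (law X) (y + ζ)‖ +
      ‖DmU x (law X) (y + ζ) - DmU x (law X) y‖ + ‖DmU x (law X) y - DmU x (law X₀) y‖ := by
    refine (norm_add₃_le).trans' (le_of_eq ?_)
    congr 1
    abel
  have n1 := norm_nonneg (x' - x)
  have n2 := norm_nonneg (X - X₀)
  have n3 := norm_nonneg ζ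
  have : K * (‖x' - x‖ + ‖X - X₀‖ + ‖ζ‖) ≥ (C * (1 + k) * (2 + ‖X₀‖)) * ‖X - X₀‖ +
      C * (4 + 4 * k + k ^ 2) * ‖ζ‖ + C * (1 + k) * ‖x' - x‖ + C * (2 * ρ) * ‖ζ‖ := by
    rw [hK]
    generalize C * (1 + k) * (2 + ‖X₀‖) = b1 at *
    generalize C * (4 + 4 * k + k ^ 2) = b2 at *
    generalize C * (1 + k) = b3 at *
    generalize C * (2 * ρ) = b4 at *
    nlinarith [mul_nonneg a1 n1, mul_nonneg a1 n3, mul_nonneg a2 n1, mul_nonneg a2 n2,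
      mul_nonneg a3 n2, mul_nonneg a3 n3, mul_nonneg a4 n1, mul_nonneg a4 n2]
  linarith

lemma HasContDerivs.hasGradientAt_Dx (hU : HasContDerivs P U DmU DymU DxmU DmmU) (x : E d)
    (m : PSpace d 2) : HasGradientAt (fun x => U x m) (Dx U x m) x :=
  (((hU.contDiff_x m).differentiable (by norm_num)) x).hasGradientAt

/-- `D_x U` is Lipschitz in the law at `law X₀`: the map `x ↦ U x (law X) - U x (law X₀)` has a
Lipschitz constant of the order of `‖X - X₀‖`, by the bound on `D²_xm U`. -/
lemma HasContDerivs.norm_Dx_sub_law_le (hU : HasContDerivs P U DmU DymU DxmU DmmU)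
    (hB : GrowthBound DmU DymU DxmU DmmU X₀ R C r) {x : E d} (hx : ‖x‖ < R) {X : L2 P d}
    (hX : ‖X - X₀‖ ≤ r) :
    ‖Dx U x (law X) - Dx U x (law X₀)‖ ≤ C * (2 + ‖X₀‖) * ‖X - X₀‖ := by
  have hC := hB.nonneg
  have hder := (hU.hasGradientAt_Dx x (law X)).hasFDerivAt.sub
    (hU.hasGradientAt_Dx x (law X₀)).hasFDerivAt
  have hn : ‖Dx U x (law X) - Dx U x (law X₀)‖ =
      ‖InnerProductSpace.toDual ℝ (E d) (Dx U x (law X)) -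
        InnerProductSpace.toDual ℝ (E d) (Dx U x (law X₀))‖ := by
    rw [← map_sub, LinearIsometryEquiv.norm_map]
  rw [hn]
  refine hder.le_of_lip' (by positivity) ?_
  have hnear : ∀ᶠ x' in 𝓝 x, ‖x'‖ < R :=
    (continuous_norm.tendsto x).eventually (gt_mem_nhds hx)
  filter_upwards [hnear] with x' hx'
  have h := norm_sub_sub_le_of_hasLDerivAt
    (fun m => (hU.hasDeriv_m x' m).sub (hU.hasDeriv_m x m)) X₀ (X - X₀)
    (φ := fun _ => 0) (φ' := fun _ => 0) (fun s => hasDerivAt_const _ _)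
    (M := C * (2 + ‖X₀‖) * ‖X - X₀‖ * ‖x' - x‖) ?_
  · refine le_trans (le_of_eq ?_) h
    congr 1
    rw [add_sub_cancel, sub_zero, sub_zero]
    simp only [Pi.sub_apply]
    ring
  intro s hs
  rw [sub_zero]
  have hXs := norm_add_smul_sub_le hX hs
  refine (norm_integral_le_of_growth (X₀ + s • (X - X₀)) (X - X₀) (a := C * ‖x' - x‖)
    (b := C * ‖x' - x‖) (by positivity) (by positivity) (Eventually.of_forall fun ω => ?_)).trans ?_
  · rw [← map_sub]
    refine (ContinuousLinearMap.le_opNorm _ _).trans ?_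
    rw [innerSL_apply_norm]
    gcongr
    refine (hU.norm_DmU_sub_fst_le hB hx.le hx'.le hXs _).trans_eq (by ring)
  · have : 1 + ‖X₀ + s • (X - X₀)‖ ≤ 2 + ‖X₀‖ := by
      have := norm_le_of_sub_le hXs hB.le_one
      linarith
    calc _ = C * (1 + ‖X₀ + s • (X - X₀)‖) * ‖X - X₀‖ * ‖x' - x‖ := by ring
      _ ≤ _ := by gcongr

end

end LocalBounds

/-! ### First-order expansion with a second-order remainder -/

section Expansion

variable {Ω : Type*} [MeasurableSpace Ω] {P : Measure Ω} [IsProbabilityMeasure P] {d : ℕ}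
variable {U : E d → PSpace d 2 → ℝ} {DmU : E d → PSpace d 2 → E d → E d}
  {DymU DxmU : E d → PSpace d 2 → E d → E d →L[ℝ] E d}
  {DmmU : E d → PSpace d 2 → E d → E d → E d →L[ℝ] E d}

lemma HasContDerivs.contDiff_Dx (hU : HasContDerivs P U DmU DymU DxmU DmmU) (m : PSpace d 2) :
    ContDiff ℝ 1 fun x => Dx U x m := by
  have h : ContDiff ℝ 1 (fderiv ℝ fun x => U x m) := (hU.contDiff_x m).fderiv_right (by norm_num)
  exact ((InnerProductSpace.toDual ℝ (E d)).symm.contDiff).comp h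

lemma HasContDerivs.hasFDerivAt_Dx (hU : HasContDerivs P U DmU DymU DxmU DmmU) (x : E d)
    (m : PSpace d 2) : HasFDerivAt (fun x => Dx U x m) (fderiv ℝ (fun x => Dx U x m) x) x :=
  ((hU.contDiff_Dx m).differentiable (by norm_num) x).hasFDerivAt

lemma HasContDerivs.continuous_DmU (hU : HasContDerivs P U DmU DymU DxmU DmmU) (x : E d)
    (m : PSpace d 2) : Continuous (DmU x m) :=
  hU.cont_Dm.comp (by fun_prop : Continuous fun y : E d => (x, m, y))

lemma HasContDerivs.integrable_inner_DmU (hU : HasContDerivs P U DmU DymU DxmU DmmU) (x : E d)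
    (X Z : L2 P d) : Integrable (fun ω => (inner ℝ (DmU x (law X) (X ω)) (Z ω) : ℝ)) P := by
  simpa using (hU.hasDeriv_m x (law X)).integrable_apply Z

lemma HasContDerivs.integrable_DmU (hU : HasContDerivs P U DmU DymU DxmU DmmU) (x : E d)
    (X : L2 P d) : Integrable (fun ω => DmU x (law X) (X ω)) P := by
  refine (((hU.hasDeriv_m x (law X)) X rfl).1.integrable one_le_two).norm.mono'
    ((hU.continuous_DmU x _).measurable.comp (measurable_coe_L2 X)).aestronglyMeasurable
    (Eventually.of_forall fun ω => ?_)
  rw [innerSL_apply_norm]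

/-- The expansion of `U` between `(x + c, law (X₀ + c))` and `(x + w, law (X₀ + Z))`: its error is
of second order, and linear in the distance between the two points. -/
lemma HasContDerivs.exists_expansion_bound (hU : HasContDerivs P U DmU DymU DxmU DmmU)
    (X₀ : L2 P d) {R₀ : ℝ} (hX₀ : ∀ᵐ ω ∂P, ‖X₀ ω‖ ≤ R₀) (R : ℝ) :
    ∃ K r : ℝ, 0 ≤ K ∧ 0 < r ∧ r ≤ 1 ∧ ∀ x : E d, ‖x‖ ≤ R → ∀ w : E d, ‖w‖ ≤ 1 →
      ∀ c : E d, ‖c‖ ≤ r → ∀ Z : L2 P d, ‖Z‖ ≤ r →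
      |U (x + w) (law (X₀ + Z)) - U (x + c) (law (X₀ + Lp.const 2 P c))
        - inner ℝ (Dx U x (law X₀)) (w - c)
        - ∫ ω, inner ℝ (DmU x (law X₀) (X₀ ω)) ((Z - Lp.const 2 P c : L2 P d) ω) ∂P| ≤
      K * (‖c‖ + (‖w - c‖ + ‖Z - Lp.const 2 P c‖)) * (‖w - c‖ + ‖Z - Lp.const 2 P c‖) := by
  obtain ⟨C, r, hB⟩ := hU.exists_growthBound X₀ (R + 4)
  obtain ⟨K₁, hK₁, hLip⟩ := hU.exists_norm_DmU_sub_le hB R₀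
  have hcontDxx : Continuous fun x => fderiv ℝ (fun x => Dx U x (law X₀)) x :=
    (hU.contDiff_Dx (law X₀)).continuous_fderiv (by norm_num)
  obtain ⟨L₂, hL₂⟩ := (isCompact_closedBall (0 : E d) (R + 4)).exists_bound_of_continuousOn
    hcontDxx.continuousOn
  have hC := hB.nonneg
  set L₁ : ℝ := C * (2 + ‖X₀‖) with hL₁
  have hL₁0 : 0 ≤ L₁ := by positivity
  refine ⟨3 * K₁ + L₁ + max L₂ 0, r, by positivity, hB.pos, hB.le_one,
    fun x hx w hw c hc Z hZ => ?_⟩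
  set cc : L2 P d := Lp.const 2 P c with hcc
  have hccn : ‖cc‖ = ‖c‖ := norm_const_L2 c
  set B : L2 P d := Z - cc with hBdef
  have hc1 : ‖c‖ ≤ 1 := hc.trans hB.le_one
  -- the variation of the law
  have hγ : ‖U (x + w) (law (X₀ + cc + B)) - U (x + w) (law (X₀ + cc)) -
      ((1 : ℝ) * (∫ ω, inner ℝ (DmU x (law X₀) (X₀ ω)) (B ω) ∂P)
        - (0 : ℝ) * (∫ ω, inner ℝ (DmU x (law X₀) (X₀ ω)) (B ω) ∂P))‖ ≤
      K₁ * (‖w‖ + 2 * (‖c‖ + ‖B‖)) * ‖B‖ := by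
    refine norm_sub_sub_le_of_hasLDerivAt (fun m => hU.hasDeriv_m (x + w) m) (X₀ + cc) B
      (φ := fun s => s * ∫ ω, inner ℝ (DmU x (law X₀) (X₀ ω)) (B ω) ∂P)
      (φ' := fun _ => ∫ ω, inner ℝ (DmU x (law X₀) (X₀ ω)) (B ω) ∂P)
      (fun s => by simpa using (hasDerivAt_id s).mul_const _) fun s hs => ?_
    set A : L2 P d := X₀ + cc + s • B with hA
    have hAX : A - X₀ = cc + s • B := by rw [hA]; abel
    have hAn : ‖A - X₀‖ ≤ ‖c‖ + ‖B‖ := by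
      rw [hAX, ← hccn]
      refine (norm_add_le _ _).trans ?_
      gcongr
      rw [norm_smul, Real.norm_of_nonneg hs.1]
      exact mul_le_of_le_one_left (norm_nonneg _) hs.2
    have hAr : ‖A - X₀‖ ≤ r := by
      have e : A - X₀ = (1 - s) • cc + s • Z := by
        rw [hAX, hBdef, smul_sub, sub_smul, one_smul]; abel
      rw [e]
      refine (norm_add_le _ _).trans ?_
      rw [norm_smul, norm_smul, Real.norm_of_nonneg hs.1, Real.norm_of_nonneg (sub_nonneg.2 hs.2),
        hccn]
      nlinarith [mul_le_mul_of_nonneg_left hc (sub_nonneg.2 hs.2),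
        mul_le_mul_of_nonneg_left hZ hs.1]
    have hxw : ‖x + w‖ ≤ R + 4 := (norm_add_le _ _).trans (by linarith)
    simp only [innerSL_apply_apply]
    rw [← integral_sub (hU.integrable_inner_DmU _ A B) (hU.integrable_inner_DmU _ X₀ B)]
    refine (norm_integral_le_of_growth (A - X₀) B (a := K₁ * (‖w‖ + ‖A - X₀‖)) (b := K₁)
      (by positivity) hK₁ ?_).trans ?_
    · filter_upwards [hX₀, Lp.coeFn_sub A X₀] with ω h1 h2
      rw [← inner_sub_left]
      refine (norm_inner_le_norm _ _).trans ?_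
      gcongr
      have h3 := hLip x (x + w) (by linarith) hxw A hAr (X₀ ω) (A ω - X₀ ω) h1
      rw [add_sub_cancel, add_sub_cancel_left] at h3
      rw [h2, Pi.sub_apply]
      refine h3.trans_eq (by ring)
    · have h5 : ‖w‖ + ‖A - X₀‖ + ‖A - X₀‖ ≤ ‖w‖ + 2 * (‖c‖ + ‖B‖) := by linarith
      calc _ = K₁ * (‖w‖ + ‖A - X₀‖ + ‖A - X₀‖) * ‖B‖ := by ring
        _ ≤ _ := by gcongr
  -- the variation of the space variable
  set ρ : ℝ := ‖c‖ + ‖w - c‖ with hρ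
  have hwc : ‖w‖ ≤ ρ := by
    have := norm_add_le c (w - c)
    rwa [add_sub_cancel] at this
  have hρ3 : ρ ≤ 3 := by
    have := norm_sub_le w c
    linarith
  have hα : ‖U (x + w) (law (X₀ + cc)) - U (x + c) (law (X₀ + cc)) -
      (InnerProductSpace.toDual ℝ (E d) (Dx U x (law X₀))) (x + w - (x + c))‖ ≤
      (L₁ * ‖c‖ + max L₂ 0 * ρ) * ‖x + w - (x + c)‖ := by
    refine Convex.norm_image_sub_le_of_norm_hasFDerivWithin_le' (s := Metric.closedBall x ρ)
      (fun z _ => (hU.hasGradientAt_Dx z (law (X₀ + cc))).hasFDerivAt.hasFDerivWithinAt)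
      (fun z hz => ?_) (convex_closedBall _ _)
      (by simp [hρ]) (by simpa using hwc)
    have hzx : ‖z - x‖ ≤ ρ := by simpa [dist_eq_norm] using hz
    have hz4 : ‖z‖ < R + 4 := by
      have := norm_add_le (z - x) x
      rw [sub_add_cancel] at this
      linarith
    rw [← map_sub, LinearIsometryEquiv.norm_map]
    have h1 := hU.norm_Dx_sub_law_le hB hz4 (X := X₀ + cc)
      (by rw [add_sub_cancel_left, hccn]; exact hc)
    rw [add_sub_cancel_left, hccn] at h1
    have h2 : ‖Dx U z (law X₀) - Dx U x (law X₀)‖ ≤ max L₂ 0 * ‖z - x‖ :=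
      Convex.norm_image_sub_le_of_norm_hasFDerivWithin_le
        (s := Metric.closedBall (0 : E d) (R + 4))
        (fun z _ => (hU.hasFDerivAt_Dx z (law X₀)).hasFDerivWithinAt)
        (fun z hz => (hL₂ z hz).trans (le_max_left _ _)) (convex_closedBall _ _)
        (by simpa using hx.trans (by linarith)) (by simpa using hz4.le)
    have h3 : max L₂ 0 * ‖z - x‖ ≤ max L₂ 0 * ρ := by gcongr
    calc _ = ‖(Dx U z (law (X₀ + cc)) - Dx U z (law X₀)) +
          (Dx U z (law X₀) - Dx U x (law X₀))‖ := by congr 1; abel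
      _ ≤ _ := (norm_add_le _ _).trans (by linarith)
  rw [add_sub_add_left_eq_sub] at hα
  have hZ' : X₀ + cc + B = X₀ + Z := by rw [hBdef]; abel
  rw [hZ', one_mul, zero_mul, sub_zero, Real.norm_eq_abs] at hγ
  rw [InnerProductSpace.toDual_apply_apply, Real.norm_eq_abs] at hα
  set κ := ∫ ω, inner ℝ (DmU x (law X₀) (X₀ ω)) (B ω) ∂P
  have htri : |U (x + w) (law (X₀ + Z)) - U (x + c) (law (X₀ + cc))
      - inner ℝ (Dx U x (law X₀)) (w - c) - κ| ≤
      K₁ * (‖w‖ + 2 * (‖c‖ + ‖B‖)) * ‖B‖ + (L₁ * ‖c‖ + max L₂ 0 * ρ) * ‖w - c‖ := by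
    refine le_trans (le_of_eq ?_) ((abs_add_le _ _).trans (add_le_add hγ hα))
    congr 1
    ring
  refine htri.trans ?_
  set q := ‖w - c‖
  have hq : 0 ≤ q := norm_nonneg _
  have hb : 0 ≤ ‖B‖ := norm_nonneg _
  have hcn : 0 ≤ ‖c‖ := norm_nonneg _
  have hl : 0 ≤ max L₂ 0 := le_max_right _ _
  have e1 : K₁ * (‖w‖ + 2 * (‖c‖ + ‖B‖)) * ‖B‖ ≤ K₁ * (3 * (‖c‖ + (q + ‖B‖))) * (q + ‖B‖) := by
    have h1 : ‖w‖ + 2 * (‖c‖ + ‖B‖) ≤ 3 * (‖c‖ + (q + ‖B‖)) := by linarith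
    have h2 : ‖B‖ ≤ q + ‖B‖ := by linarith
    gcongr
  have e2 : (L₁ * ‖c‖ + max L₂ 0 * ρ) * q ≤
      (L₁ * (‖c‖ + (q + ‖B‖)) + max L₂ 0 * (‖c‖ + (q + ‖B‖))) * (q + ‖B‖) := by
    have h1 : ‖c‖ ≤ ‖c‖ + (q + ‖B‖) := by linarith
    have h2 : ρ ≤ ‖c‖ + (q + ‖B‖) := by linarith
    have h3 : q ≤ q + ‖B‖ := by linarith
    gcongr
  calc _ ≤ _ := add_le_add e1 e2
    _ = _ := by ring

end Expansion

/-! ### Second-order expansion along translations -/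

section Taylor

variable {Ω : Type*} [MeasurableSpace Ω] {P : Measure Ω} [IsProbabilityMeasure P] {d : ℕ}
variable {U : E d → PSpace d 2 → ℝ} {DmU : E d → PSpace d 2 → E d → E d}
  {DymU DxmU : E d → PSpace d 2 → E d → E d →L[ℝ] E d}
  {DmmU : E d → PSpace d 2 → E d → E d → E d →L[ℝ] E d}

/-- A parametric form of differentiability at `0`: if the derivatives of the maps `f χ` converge,
jointly in the parameter and the point, then their increments are uniformly linear. -/
lemma isLittleO_sub_of_hasFDerivAt {α F G : Type*} [NormedAddCommGroup F] [NormedSpace ℝ F]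
    [NormedAddCommGroup G] [NormedSpace ℝ G] {l : Filter α} {v : α → F} (hv : Tendsto v l (𝓝 0))
    {f : α → F → G} {f' : α → F → F →L[ℝ] G} (hf : ∀ χ z, HasFDerivAt (f χ) (f' χ z) z)
    {φ : F →L[ℝ] G} (hφ : Tendsto (fun q : α × F => f' q.1 q.2) (l ×ˢ 𝓝 0) (𝓝 φ)) :
    (fun χ => f χ (v χ) - f χ 0 - φ (v χ)) =o[l] v := by
  refine Asymptotics.isLittleO_iff.2 fun ε hε => ?_
  obtain ⟨A, hA, B, hB, hAB⟩ := eventually_prod_iff.1 (Metric.tendsto_nhds.1 hφ ε hε)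
  obtain ⟨δ, hδ, hδB⟩ := Metric.eventually_nhds_iff_ball.1 hB
  filter_upwards [hA, hv.eventually (Metric.ball_mem_nhds 0 hδ)] with χ hχ hvχ
  have h := Convex.norm_image_sub_le_of_norm_hasFDerivWithin_le' (s := Metric.ball (0 : F) δ)
    (fun z _ => (hf χ z).hasFDerivWithinAt)
    (fun z hz => (dist_eq_norm (f' χ z) φ) ▸ (hAB hχ (hδB z hz)).le) (convex_ball _ _)
    (Metric.mem_ball_self hδ) hvχ
  simpa using h

/-- The second-order Taylor formula for a function with gradient field `D`, of which only
differentiability at the base point is needed. -/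
lemma isLittleO_taylor_two {f : E d → ℝ} {D : E d → E d} (hf : ∀ x, HasGradientAt f (D x) x)
    {x : E d} {A : E d →L[ℝ] E d} (hA : HasFDerivAt D A x) :
    (fun c => f (x + c) - f x - inner ℝ (D x) c - 1 / 2 * inner ℝ (A c) c)
      =o[𝓝 0] fun c => ‖c‖ ^ 2 := by
  refine Asymptotics.isLittleO_iff.2 fun ε hε => ?_
  have h1 := Asymptotics.isLittleO_iff.1 (hasFDerivAt_iff_isLittleO_nhds_zero.1 hA) hε
  obtain ⟨δ, hδ, h2⟩ := Metric.eventually_nhds_iff_ball.1 h1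
  filter_upwards [Metric.ball_mem_nhds 0 hδ] with c hc
  have hder : ∀ s : ℝ, HasDerivAt (fun s : ℝ => f (x + s • c) - s * inner ℝ (D x) c
      - s ^ 2 / 2 * inner ℝ (A c) c)
      (inner ℝ (D (x + s • c) - D x - A (s • c)) c) s := by
    intro s
    have hl : HasDerivAt (fun s : ℝ => x + s • c) c s := by
      simpa using ((hasDerivAt_id s).smul_const c).const_add x
    have h3 := (hf (x + s • c)).hasFDerivAt.comp_hasDerivAt s hl
    have h4 := (hasDerivAt_id s).mul_const (inner ℝ (D x) c)
    have h5 := (((hasDerivAt_id s).pow 2).div_const 2).mul_const (inner ℝ (A c) c)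
    refine ((h3.sub h4).sub h5).congr_deriv ?_
    simp only [InnerProductSpace.toDual_apply_apply, inner_sub_left, map_smul, inner_smul_left,
      id, conj_trivial]
    ring
  have h := norm_image_sub_le_of_norm_deriv_le_segment_01'
    (fun s _ => (hder s).hasDerivWithinAt) (C := ε * ‖c‖ ^ 2) (fun s hs => by
      have hsc : ‖s • c‖ ≤ ‖c‖ := by
        rw [norm_smul, Real.norm_of_nonneg hs.1]
        exact mul_le_of_le_one_left (norm_nonneg _) hs.2.le
      have h6 := h2 (s • c) (by
        rw [mem_ball_zero_iff] at hc ⊢; exact hsc.trans_lt hc)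
      calc _ ≤ ‖D (x + s • c) - D x - A (s • c)‖ * ‖c‖ := norm_inner_le_norm _ _
        _ ≤ (ε * ‖c‖) * ‖c‖ := by
            gcongr
            exact h6.trans (by gcongr)
        _ = _ := by ring)
  rw [norm_pow, norm_norm]
  refine le_trans (le_of_eq ?_) h
  congr 1
  simp only [one_smul, zero_smul, add_zero]
  ring

lemma const_smul_L2 (s : ℝ) (c : E d) :
    (Lp.const 2 P (s • c) : L2 P d) = s • Lp.const 2 P c :=
  map_smul (Lp.constL 2 P ℝ) s c

lemma const_zero_L2 : (Lp.const 2 P (0 : E d) : L2 P d) = 0 := map_zero (Lp.const 2 P)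

lemma continuous_const_L2 : Continuous fun c : E d => (Lp.const 2 P c : L2 P d) :=
  (Lp.constL 2 P ℝ).continuous

lemma HasContDerivs.integrable_DmmU (hU : HasContDerivs P U DmU DymU DxmU DmmU) (x : E d)
    (X : L2 P d) (y : E d) : Integrable (fun ω => DmmU x (law X) y (X ω)) P :=
  (hU.hasDeriv_mm x (law X) y X rfl).1.integrable one_le_two

/-- The derivative of `D_m U` with respect to a common translation of its last variable and of the
random variable that defines the law, together with an independent translation of `x`. -/
lemma HasContDerivs.hasFDerivAt_DmU_translate (hU : HasContDerivs P U DmU DymU DxmU DmmU)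
    (X₀ : L2 P d) (x y : E d) :
    HasFDerivAt (fun p : E d × E d => DmU (x + p.1) (law (X₀ + Lp.const 2 P p.2)) (y + p.2))
      ((DxmU x (law X₀) y).comp (ContinuousLinearMap.fst ℝ (E d) (E d)) +
        (DymU x (law X₀) y + ∫ ω, DmmU x (law X₀) y (X₀ ω) ∂P).comp
          (ContinuousLinearMap.snd ℝ (E d) (E d))) 0 := by
  set M : E d →L[ℝ] E d := ∫ ω, DmmU x (law X₀) y (X₀ ω) ∂P with hM
  let L : E d → PSpace d 2 := fun b => law (X₀ + Lp.const 2 P b)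
  have hL : Continuous L := continuous_law.comp (continuous_const.add continuous_const_L2)
  have hL0 : L 0 = law X₀ := by simp only [L, const_zero_L2, add_zero]
  -- the translation of the law
  have h3 : HasFDerivAt (fun b : E d => DmU x (L b) y) M 0 := by
    obtain ⟨-, T, hT, hd⟩ := hU.hasDeriv_mm x (law X₀) y X₀ rfl
    have hl : HasFDerivAt (fun b : E d => X₀ + Lp.const 2 P b)
        (Lp.constL 2 P ℝ : E d →L[ℝ] L2 P d) 0 :=
      (Lp.constL 2 P ℝ : E d →L[ℝ] L2 P d).hasFDerivAt.const_add X₀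
    have hd' : HasFDerivAt (fun Z : L2 P d => DmU x (law Z) y) T
        (X₀ + (Lp.const 2 P (0 : E d) : L2 P d)) := by
      rwa [const_zero_L2, add_zero]
    refine (hd'.comp (0 : E d) hl).congr_fderiv ?_
    ext1 c
    rw [hM, ContinuousLinearMap.integral_apply (hU.integrable_DmmU x X₀ y)]
    change T (Lp.const 2 P c) = _
    rw [hT]
    refine integral_congr_ae ?_
    filter_upwards [Lp.coeFn_const (p := 2) (μ := P) c] with ω hω
    rw [hω]; rfl
  have o3 : (fun p : E d × E d => DmU x (L p.2) y - DmU x (L 0) y - M p.2) =o[𝓝 0] fun p => p := by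
    have h := (hasFDerivAt_iff_isLittleO_nhds_zero.1 h3).comp_tendsto
      (continuous_snd.tendsto (0 : E d × E d))
    simp only [Function.comp_def, zero_add] at h
    exact h.trans_isBigO (Asymptotics.isBigO_of_le _ fun p => norm_snd_le p)
  -- the translation of the last variable
  have o2 : (fun p : E d × E d => DmU x (L p.2) (y + p.2) - DmU x (L p.2) (y + 0)
      - DymU x (law X₀) y p.2) =o[𝓝 0] fun p => p := by
    have h := isLittleO_sub_of_hasFDerivAt (l := 𝓝 (0 : E d × E d)) (v := fun p => p.2)
      (continuous_snd.tendsto (0 : E d × E d)) (f := fun p e => DmU x (L p.2) (y + e))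
      (f' := fun p e => DymU x (L p.2) (y + e)) (φ := DymU x (law X₀) y)
      (fun p e => (hasFDerivAt_comp_add_left y).2 (hU.hasDeriv_ym x (L p.2) (y + e))) (by
        have hc : Continuous fun q : (E d × E d) × E d => DymU x (L q.1.2) (y + q.2) :=
          hU.cont_Dym.comp (continuous_const.prodMk
            ((hL.comp (continuous_snd.comp continuous_fst)).prodMk
              (continuous_const.add continuous_snd)))
        have := hc.tendsto (0, 0)
        simpa [nhds_prod_eq, hL0] using this)
    exact h.trans_isBigO (Asymptotics.isBigO_of_le _ fun p => norm_snd_le p)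
  -- the translation of `x`
  have o1 : (fun p : E d × E d => DmU (x + p.1) (L p.2) (y + p.2) - DmU (x + 0) (L p.2) (y + p.2)
      - DxmU x (law X₀) y p.1) =o[𝓝 0] fun p => p := by
    have h := isLittleO_sub_of_hasFDerivAt (l := 𝓝 (0 : E d × E d)) (v := fun p => p.1)
      (continuous_fst.tendsto (0 : E d × E d)) (f := fun p a => DmU (x + a) (L p.2) (y + p.2))
      (f' := fun p a => DxmU (x + a) (L p.2) (y + p.2)) (φ := DxmU x (law X₀) y)
      (fun p a => (hasFDerivAt_comp_add_left (f := fun z => DmU z (L p.2) (y + p.2)) x).2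
        (hU.hasDeriv_xm (x + a) (L p.2) (y + p.2))) (by
        have hc : Continuous fun q : (E d × E d) × E d => DxmU (x + q.2) (L q.1.2) (y + q.1.2) :=
          hU.cont_Dxm.comp ((continuous_const.add continuous_snd).prodMk
            ((hL.comp (continuous_snd.comp continuous_fst)).prodMk
              (continuous_const.add (continuous_snd.comp continuous_fst))))
        have := hc.tendsto (0, 0)
        simpa [nhds_prod_eq, hL0] using this)
    exact h.trans_isBigO (Asymptotics.isBigO_of_le _ fun p => norm_fst_le p)
  refine hasFDerivAt_iff_isLittleO_nhds_zero.2 (((o1.add o2).add o3).congr_left fun p => ?_)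
  simp only [add_zero, zero_add, Prod.fst_zero, Prod.snd_zero, L, const_zero_L2,
    add_apply, ContinuousLinearMap.comp_apply, ContinuousLinearMap.coe_fst',
    ContinuousLinearMap.coe_snd']
  abel

/-- The second derivative of `c ↦ U (x + c) (law (X₀ + c))` at `0`, up to symmetrisation: only the
associated quadratic form and the trace are used, so the two mixed terms are merged into one. -/
noncomputable def translationHessian (U : E d → PSpace d 2 → ℝ)
    (DymU DxmU : E d → PSpace d 2 → E d → E d →L[ℝ] E d)
    (DmmU : E d → PSpace d 2 → E d → E d → E d →L[ℝ] E d) (X₀ : L2 P d) (x : E d) :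
    E d →L[ℝ] E d :=
  fderiv ℝ (fun x => Dx U x (law X₀)) x + (2 : ℝ) • ∫ ω, DxmU x (law X₀) (X₀ ω) ∂P +
    ∫ ω, (DymU x (law X₀) (X₀ ω) + ∫ ω', DmmU x (law X₀) (X₀ ω) (X₀ ω') ∂P) ∂P

lemma HasContDerivs.stronglyMeasurable_integral_DmmU
    (hU : HasContDerivs P U DmU DymU DxmU DmmU) (X₀ : L2 P d) :
    StronglyMeasurable fun q : E d × E d => ∫ ω', DmmU q.1 (law X₀) q.2 (X₀ ω') ∂P := by
  have h : Measurable fun p : (E d × E d) × Ω => DmmU p.1.1 (law X₀) p.1.2 (X₀ p.2) := by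
    have hc : Continuous fun p : (E d × E d) × E d => DmmU p.1.1 (law X₀) p.1.2 p.2 :=
      hU.cont_Dmm.comp (by fun_prop :
        Continuous fun p : (E d × E d) × E d => (p.1.1, law X₀, p.1.2, p.2))
    exact hc.measurable.comp (measurable_fst.prodMk ((measurable_coe_L2 X₀).comp measurable_snd))
  exact h.stronglyMeasurable.integral_prod_right'

/-- The two halves of the translation Hessian that involve the law arise as the derivative of
`(a, b) ↦ 𝔼[D_m U(x + a, law (X₀ + b), X₀ + b)]`. -/
lemma HasContDerivs.hasFDerivAt_integral_DmU (hU : HasContDerivs P U DmU DymU DxmU DmmU)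
    (X₀ : L2 P d) {R₀ : ℝ} (hX₀ : ∀ᵐ ω ∂P, ‖X₀ ω‖ ≤ R₀) (x : E d) :
    HasFDerivAt (fun p : E d × E d =>
        ∫ ω, DmU (x + p.1) (law (X₀ + Lp.const 2 P p.2)) (X₀ ω + p.2) ∂P)
      ((∫ ω, DxmU x (law X₀) (X₀ ω) ∂P).comp (ContinuousLinearMap.fst ℝ (E d) (E d)) +
        (∫ ω, (DymU x (law X₀) (X₀ ω) + ∫ ω', DmmU x (law X₀) (X₀ ω) (X₀ ω') ∂P) ∂P).comp
          (ContinuousLinearMap.snd ℝ (E d) (E d))) 0 := by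
  obtain ⟨C, r, hB⟩ := hU.exists_growthBound X₀ (‖x‖ + 1)
  obtain ⟨K, hK, hLip⟩ := hU.exists_norm_DmU_sub_le hB R₀
  have hXm := measurable_coe_L2 X₀
  have mx : StronglyMeasurable fun ω => DxmU x (law X₀) (X₀ ω) :=
    ((hU.cont_Dxm.comp (by fun_prop : Continuous fun y : E d => (x, law X₀, y))).measurable.comp
      hXm).stronglyMeasurable
  have my : StronglyMeasurable fun ω => DymU x (law X₀) (X₀ ω) :=
    ((hU.cont_Dym.comp (by fun_prop : Continuous fun y : E d => (x, law X₀, y))).measurable.comp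
      hXm).stronglyMeasurable
  have mm : StronglyMeasurable fun ω => ∫ ω', DmmU x (law X₀) (X₀ ω) (X₀ ω') ∂P :=
    (hU.stronglyMeasurable_integral_DmmU X₀).comp_measurable (measurable_const.prodMk hXm)
  have hs : {p : E d × E d | ‖p‖ < r} ∈ 𝓝 (0 : E d × E d) := by
    simpa [Metric.ball, dist_zero_right] using Metric.ball_mem_nhds (0 : E d × E d) hB.pos
  obtain ⟨hint, hder⟩ := hasFDerivAt_integral_of_dominated_loc_of_lip' (μ := P) (𝕜 := ℝ)
    (x₀ := (0 : E d × E d)) (bound := fun _ => 3 * K)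
    (F := fun p ω => DmU (x + p.1) (law (X₀ + Lp.const 2 P p.2)) (X₀ ω + p.2))
    (F' := fun ω => (DxmU x (law X₀) (X₀ ω)).comp (ContinuousLinearMap.fst ℝ (E d) (E d)) +
        (DymU x (law X₀) (X₀ ω) + ∫ ω', DmmU x (law X₀) (X₀ ω) (X₀ ω') ∂P).comp
          (ContinuousLinearMap.snd ℝ (E d) (E d))) hs
    (fun p _ => ((hU.continuous_DmU _ _).measurable.comp
      (hXm.add measurable_const)).aestronglyMeasurable)
    (by simpa [const_zero_L2] using hU.integrable_DmU x X₀)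
    (by
      refine StronglyMeasurable.aestronglyMeasurable (.add ?_ ?_)
      · exact (continuous_id.clm_comp continuous_const).comp_stronglyMeasurable mx
      · exact (continuous_id.clm_comp continuous_const).comp_stronglyMeasurable (my.add mm))
    (by
      filter_upwards [hX₀] with ω hω p hp
      have hp1 := norm_fst_le p
      have hp2 := norm_snd_le p
      have hpr : ‖p‖ < r := hp
      have h := hLip x (x + p.1) (by linarith)
        ((norm_add_le _ _).trans (by linarith [hB.le_one])) (X₀ + Lp.const 2 P p.2)
        (by rw [add_sub_cancel_left, norm_const_L2]; linarith) (X₀ ω) p.2 hω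
      rw [add_sub_cancel_left, add_sub_cancel_left, norm_const_L2] at h
      simp only [Prod.fst_zero, Prod.snd_zero, add_zero, const_zero_L2, sub_zero]
      refine h.trans ?_
      calc K * (‖p.1‖ + ‖p.2‖ + ‖p.2‖) ≤ K * (‖p‖ + ‖p‖ + ‖p‖) := by gcongr
        _ = _ := by ring)
    (integrable_const _)
    (Eventually.of_forall fun ω => hU.hasFDerivAt_DmU_translate X₀ x (X₀ ω))
  refine hder.congr_fderiv ?_
  have hinl : Integrable (fun ω => DxmU x (law X₀) (X₀ ω)) P := by
    have h := (ContinuousLinearMap.compL ℝ (E d) (E d × E d) (E d)).flip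
      (ContinuousLinearMap.inl ℝ (E d) (E d)) |>.integrable_comp hint
    refine h.congr (Eventually.of_forall fun ω => ?_)
    ext1 c
    simp
  have hinr : Integrable (fun ω => DymU x (law X₀) (X₀ ω) +
      ∫ ω', DmmU x (law X₀) (X₀ ω) (X₀ ω') ∂P) P := by
    have h := (ContinuousLinearMap.compL ℝ (E d) (E d × E d) (E d)).flip
      (ContinuousLinearMap.inr ℝ (E d) (E d)) |>.integrable_comp hint
    refine h.congr (Eventually.of_forall fun ω => ?_)
    ext1 c
    simp
  refine ContinuousLinearMap.ext fun p => ?_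
  rw [ContinuousLinearMap.integral_apply hint]
  simp only [add_apply, ContinuousLinearMap.comp_apply, ContinuousLinearMap.coe_fst',
    ContinuousLinearMap.coe_snd']
  rw [ContinuousLinearMap.integral_apply hinl, ContinuousLinearMap.integral_apply hinr]
  simp only [add_apply]
  exact integral_add (hinl.apply_continuousLinearMap p.1) (hinr.apply_continuousLinearMap p.2)

/-- The second-order expansion of `U` along simultaneous translations of `x` and of the law. -/
lemma HasContDerivs.isLittleO_translate (hU : HasContDerivs P U DmU DymU DxmU DmmU)
    (X₀ : L2 P d) {R₀ : ℝ} (hX₀ : ∀ᵐ ω ∂P, ‖X₀ ω‖ ≤ R₀) (x : E d) :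
    (fun c : E d => U (x + c) (law (X₀ + Lp.const 2 P c)) - U x (law X₀)
        - inner ℝ (Dx U x (law X₀)) c
        - ∫ ω, inner ℝ (DmU x (law X₀) (X₀ ω)) c ∂P
        - 1 / 2 * inner ℝ (translationHessian U DymU DxmU DmmU X₀ x c) c)
      =o[𝓝 0] fun c => ‖c‖ ^ 2 := by
  set D₀ : E d := ∫ ω, DmU x (law X₀) (X₀ ω) ∂P with hD₀
  set A₁ : E d →L[ℝ] E d := ∫ ω, DxmU x (law X₀) (X₀ ω) ∂P with hA₁
  set A₂ : E d →L[ℝ] E d := ∫ ω, (DymU x (law X₀) (X₀ ω) +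
    ∫ ω', DmmU x (law X₀) (X₀ ω) (X₀ ω') ∂P) ∂P with hA₂
  have ox := isLittleO_taylor_two (fun x => hU.hasGradientAt_Dx x (law X₀))
    (hU.hasFDerivAt_Dx x (law X₀))
  have om : (fun c : E d => U (x + c) (law (X₀ + Lp.const 2 P c)) - U (x + c) (law X₀)
      - (inner ℝ D₀ c + inner ℝ (A₁ c) c + 1 / 2 * inner ℝ (A₂ c) c)) =o[𝓝 0]
      fun c => ‖c‖ ^ 2 := by
    refine Asymptotics.isLittleO_iff.2 fun ε hε => ?_
    have h1 := Asymptotics.isLittleO_iff.1 (hasFDerivAt_iff_isLittleO_nhds_zero.1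
      (hU.hasFDerivAt_integral_DmU X₀ hX₀ x)) hε
    obtain ⟨δ, hδ, h2⟩ := Metric.eventually_nhds_iff_ball.1 h1
    filter_upwards [Metric.ball_mem_nhds 0 hδ] with c hc
    have hder : ∀ s : ℝ, HasDerivAt (fun s : ℝ => s * (inner ℝ D₀ c + inner ℝ (A₁ c) c)
        + s ^ 2 / 2 * inner ℝ (A₂ c) c) (inner ℝ (D₀ + A₁ c + A₂ (s • c)) c) s := by
      intro s
      have h4 := (hasDerivAt_id s).mul_const (inner ℝ D₀ c + inner ℝ (A₁ c) c)
      have h5 := (((hasDerivAt_id s).pow 2).div_const 2).mul_const (inner ℝ (A₂ c) c)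
      refine (h4.add h5).congr_deriv ?_
      simp only [inner_add_left, map_smul, inner_smul_left, id, conj_trivial]
      ring
    have h := norm_sub_sub_le_of_hasLDerivAt (fun m => hU.hasDeriv_m (x + c) m) X₀
      (Lp.const 2 P c : L2 P d) hder (M := ε * ‖c‖ ^ 2) ?_
    · rw [norm_pow, norm_norm]
      refine le_trans (le_of_eq ?_) h
      congr 1
      ring
    intro s hs
    have hsc : ‖s • c‖ ≤ ‖c‖ := by
      rw [norm_smul, Real.norm_of_nonneg hs.1]
      exact mul_le_of_le_one_left (norm_nonneg _) hs.2
    have hp : ‖((c, s • c) : E d × E d)‖ ≤ ‖c‖ := max_le le_rfl hsc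
    have h6 := h2 (c, s • c) (by
      rw [mem_ball_zero_iff] at hc ⊢; exact hp.trans_lt hc)
    simp only [zero_add, Prod.fst_zero, Prod.snd_zero, add_zero, const_zero_L2, const_smul_L2,
      add_apply, ContinuousLinearMap.comp_apply, ContinuousLinearMap.coe_fst',
      ContinuousLinearMap.coe_snd'] at h6
    set B : L2 P d := X₀ + s • Lp.const 2 P c with hB
    have hBω : ∀ᵐ ω ∂P, B ω = X₀ ω + s • c := by
      filter_upwards [Lp.coeFn_add X₀ (s • Lp.const 2 P c : L2 P d),
        Lp.coeFn_smul s (Lp.const 2 P c : L2 P d), Lp.coeFn_const (p := 2) (μ := P) c]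
        with ω e1 e2 e3
      rw [hB, e1, Pi.add_apply, e2, Pi.smul_apply, e3]
      rfl
    have hI : ∫ ω, DmU (x + c) (law B) (X₀ ω + s • c) ∂P = ∫ ω, DmU (x + c) (law B) (B ω) ∂P :=
      integral_congr_ae (hBω.mono fun ω hω => by simp only [hω])
    have e : ∫ ω, (innerSL ℝ (DmU (x + c) (law B) (B ω))) ((Lp.const 2 P c : L2 P d) ω) ∂P =
        inner ℝ (∫ ω, DmU (x + c) (law B) (B ω) ∂P) c := by
      rw [real_inner_comm, ← integral_inner (hU.integrable_DmU (x + c) B)]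
      refine integral_congr_ae ?_
      filter_upwards [Lp.coeFn_const (p := 2) (μ := P) c] with ω hω
      rw [hω, innerSL_apply_apply, real_inner_comm]
      rfl
    rw [e, ← inner_sub_left, ← hI]
    calc _ ≤ ‖∫ ω, DmU (x + c) (law B) (X₀ ω + s • c) ∂P - (D₀ + A₁ c + A₂ (s • c))‖ * ‖c‖ :=
          norm_inner_le_norm _ _
      _ ≤ (ε * ‖c‖) * ‖c‖ := by
          gcongr
          refine le_trans (le_of_eq ?_) (h6.trans (by gcongr))
          congr 1
          abel
      _ = _ := by ring
  refine (ox.add om).congr_left fun c => ?_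
  have e : ∫ ω, inner ℝ (DmU x (law X₀) (X₀ ω)) c ∂P = inner ℝ D₀ c := by
    rw [hD₀, real_inner_comm, ← integral_inner (hU.integrable_DmU x X₀)]
    simp only [real_inner_comm]
  rw [e, translationHessian, ← hA₁, ← hA₂]
  simp only [add_apply, smul_apply, inner_add_left, inner_smul_left,
    conj_trivial]
  ring

end Taylor

/-! ### Averaged expansion of the lift -/

section IntegratedExpansion

variable {Ω : Type*} [MeasurableSpace Ω] {P : Measure Ω} [IsProbabilityMeasure P] {d : ℕ}
variable {U : E d → PSpace d 2 → ℝ} {DmU : E d → PSpace d 2 → E d → E d}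
  {DymU DxmU : E d → PSpace d 2 → E d → E d →L[ℝ] E d}
  {DmmU : E d → PSpace d 2 → E d → E d → E d →L[ℝ] E d}

/-- The derivative at `X₀`, in the direction `Z`, of the lift of `U x`. -/
noncomputable def lawDeriv (DmU : E d → PSpace d 2 → E d → E d) (X₀ : L2 P d) (x : E d)
    (Z : L2 P d) : ℝ :=
  ∫ ω, inner ℝ (DmU x (law X₀) (X₀ ω)) (Z ω) ∂P

lemma HasContDerivs.measurable_DmU_prod (hU : HasContDerivs P U DmU DymU DxmU DmmU)
    (X₀ : L2 P d) : Measurable fun q : E d × Ω => DmU q.1 (law X₀) (X₀ q.2) :=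
  (hU.cont_Dm.comp (by fun_prop : Continuous fun q : E d × E d => (q.1, law X₀, q.2))).measurable.comp
    (measurable_fst.prodMk ((measurable_coe_L2 X₀).comp measurable_snd))

lemma HasContDerivs.stronglyMeasurable_lawDeriv (hU : HasContDerivs P U DmU DymU DxmU DmmU)
    (X₀ Z : L2 P d) : StronglyMeasurable fun x => lawDeriv DmU X₀ x Z := by
  have h : Measurable fun q : E d × Ω => (inner ℝ (DmU q.1 (law X₀) (X₀ q.2)) (Z q.2) : ℝ) :=
    (hU.measurable_DmU_prod X₀).inner ((measurable_coe_L2 Z).comp measurable_snd)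
  exact h.stronglyMeasurable.integral_prod_right'

lemma HasContDerivs.lawDeriv_sub (hU : HasContDerivs P U DmU DymU DxmU DmmU)
    (X₀ : L2 P d) (x : E d) (Z Z' : L2 P d) :
    lawDeriv DmU X₀ x (Z - Z') = lawDeriv DmU X₀ x Z - lawDeriv DmU X₀ x Z' := by
  rw [lawDeriv, lawDeriv, lawDeriv,
    ← integral_sub (hU.integrable_inner_DmU x X₀ Z) (hU.integrable_inner_DmU x X₀ Z')]
  refine integral_congr_ae ?_
  filter_upwards [Lp.coeFn_sub Z Z'] with ω hω
  rw [hω, Pi.sub_apply, inner_sub_right]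

lemma lawDeriv_const (X₀ : L2 P d) (x c : E d) :
    lawDeriv DmU X₀ x (Lp.const 2 P c) = ∫ ω, inner ℝ (DmU x (law X₀) (X₀ ω)) c ∂P := by
  refine integral_congr_ae ?_
  filter_upwards [Lp.coeFn_const (p := 2) (μ := P) c] with ω hω
  rw [hω]; rfl

lemma HasContDerivs.exists_lawDeriv_bound (hU : HasContDerivs P U DmU DymU DxmU DmmU)
    (X₀ : L2 P d) (R : ℝ) :
    ∃ K, 0 ≤ K ∧ ∀ x : E d, ‖x‖ ≤ R → ∀ Z : L2 P d, |lawDeriv DmU X₀ x Z| ≤ K * ‖Z‖ := by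
  obtain ⟨C, r, hB⟩ := hU.exists_growthBound X₀ R
  have hC := hB.nonneg
  refine ⟨C + C * ‖X₀‖, by positivity, fun x hx Z => ?_⟩
  rw [lawDeriv, ← Real.norm_eq_abs]
  refine norm_integral_le_of_growth X₀ Z hC hC (Eventually.of_forall fun ω => ?_)
  refine (norm_inner_le_norm _ _).trans ?_
  gcongr
  refine (hB.dm x hx X₀ (by simpa using hB.pos.le) (X₀ ω)).trans_eq (by ring)

lemma HasContDerivs.stronglyMeasurable_translationHessian
    (hU : HasContDerivs P U DmU DymU DxmU DmmU) (X₀ : L2 P d) :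
    StronglyMeasurable fun x => translationHessian U DymU DxmU DmmU X₀ x := by
  have hX : Measurable fun q : E d × Ω => X₀ q.2 := (measurable_coe_L2 X₀).comp measurable_snd
  have h1 : StronglyMeasurable fun x => fderiv ℝ (fun x => Dx U x (law X₀)) x :=
    ((hU.contDiff_Dx (law X₀)).continuous_fderiv (by norm_num)).stronglyMeasurable
  have m2 : Measurable fun q : E d × Ω => DxmU q.1 (law X₀) (X₀ q.2) :=
    (hU.cont_Dxm.comp (by fun_prop : Continuous fun q : E d × E d =>
      (q.1, law X₀, q.2))).measurable.comp (measurable_fst.prodMk hX)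
  have m3 : Measurable fun q : E d × Ω => DymU q.1 (law X₀) (X₀ q.2) :=
    (hU.cont_Dym.comp (by fun_prop : Continuous fun q : E d × E d =>
      (q.1, law X₀, q.2))).measurable.comp (measurable_fst.prodMk hX)
  have m4 : StronglyMeasurable fun q : E d × Ω =>
      ∫ ω', DmmU q.1 (law X₀) (X₀ q.2) (X₀ ω') ∂P :=
    (hU.stronglyMeasurable_integral_DmmU X₀).comp_measurable (measurable_fst.prodMk hX)
  exact (h1.add (m2.stronglyMeasurable.integral_prod_right'.const_smul (2 : ℝ))).add
    (m3.stronglyMeasurable.add m4).integral_prod_right'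

lemma HasContDerivs.exists_translationHessian_bound
    (hU : HasContDerivs P U DmU DymU DxmU DmmU) (X₀ : L2 P d) {R₀ : ℝ}
    (hX₀ : ∀ᵐ ω ∂P, ‖X₀ ω‖ ≤ R₀) (R : ℝ) :
    ∃ K, ∀ x : E d, ‖x‖ ≤ R → ‖translationHessian U DymU DxmU DmmU X₀ x‖ ≤ K := by
  obtain ⟨C, r, hB⟩ := hU.exists_growthBound X₀ R
  have hC := hB.nonneg
  have hr : ‖X₀ - X₀‖ ≤ r := by simpa using hB.pos.le
  obtain ⟨L, hL⟩ := (isCompact_closedBall (0 : E d) R).exists_bound_of_continuousOn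
    ((hU.contDiff_Dx (law X₀)).continuous_fderiv (by norm_num)).continuousOn
  refine ⟨L + 2 * (C * (1 + R₀)) + (C * (1 + R₀ ^ 2) + C * (1 + R₀) * (1 + R₀)),
    fun x hx => ?_⟩
  have b2 : ‖∫ ω, DxmU x (law X₀) (X₀ ω) ∂P‖ ≤ C * (1 + R₀) := by
    refine (norm_integral_le_of_norm_le_const (C := C * (1 + R₀)) ?_).trans_eq (by simp)
    filter_upwards [hX₀] with ω hω
    exact (hB.dxm x hx X₀ hr _).trans (by gcongr)
  have b3 : ‖∫ ω, (DymU x (law X₀) (X₀ ω) + ∫ ω', DmmU x (law X₀) (X₀ ω) (X₀ ω') ∂P) ∂P‖ ≤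
      C * (1 + R₀ ^ 2) + C * (1 + R₀) * (1 + R₀) := by
    refine (norm_integral_le_of_norm_le_const
      (C := C * (1 + R₀ ^ 2) + C * (1 + R₀) * (1 + R₀)) ?_).trans_eq (by simp)
    filter_upwards [hX₀] with ω hω
    have hR₀ : 0 ≤ R₀ := (norm_nonneg _).trans hω
    refine (norm_add_le _ _).trans (add_le_add ?_ ?_)
    · exact (hB.dym x hx X₀ hr _).trans (by gcongr)
    · refine (norm_integral_le_of_norm_le_const (C := C * (1 + R₀) * (1 + R₀)) ?_).trans_eq
        (by simp)
      filter_upwards [hX₀] with ω' hω'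
      exact (hB.dmm x hx X₀ hr _ _).trans (by gcongr)
  refine (norm_add_le _ _).trans (add_le_add ((norm_add_le _ _).trans (add_le_add ?_ ?_)) b3)
  · exact hL x (by simpa using hx)
  · rw [norm_smul, Real.norm_of_nonneg (by norm_num)]
    gcongr

lemma HasContDerivs.integrable_translationHessian
    (hU : HasContDerivs P U DmU DymU DxmU DmmU) (X₀ ξ : L2 P d) {R₀ R : ℝ}
    (hX₀ : ∀ᵐ ω ∂P, ‖X₀ ω‖ ≤ R₀) (hξ : ∀ᵐ ω ∂P, ‖ξ ω‖ ≤ R) :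
    Integrable (fun ω => translationHessian U DymU DxmU DmmU X₀ (ξ ω)) P := by
  obtain ⟨K, hK⟩ := hU.exists_translationHessian_bound X₀ hX₀ R
  exact Integrable.of_bound
    ((hU.stronglyMeasurable_translationHessian X₀).comp_measurable
      (measurable_coe_L2 ξ)).aestronglyMeasurable K (hξ.mono fun ω hω => hK _ hω)

lemma norm_Dx_le_of_lipschitz {L : NNReal} {m : PSpace d 2} (hL : LipschitzWith L fun x => U x m)
    (x : E d) : ‖Dx U x m‖ ≤ L := by
  rw [Dx, gradient, LinearIsometryEquiv.norm_map]
  exact norm_fderiv_le_of_lipschitz ℝ hL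

/-- The increment of `U` from `(x, law X₀)` to `(x + w, law (X₀ + Z))`, minus its linear part. -/
noncomputable def remainder (U : E d → PSpace d 2 → ℝ) (DmU : E d → PSpace d 2 → E d → E d)
    (X₀ : L2 P d) (x w : E d) (Z : L2 P d) : ℝ :=
  U (x + w) (law (X₀ + Z)) - U x (law X₀) - inner ℝ (Dx U x (law X₀)) w - lawDeriv DmU X₀ x Z

lemma HasContDerivs.continuous_fst (hU : HasContDerivs P U DmU DymU DxmU DmmU) (m : PSpace d 2) :
    Continuous fun x => U x m := (hU.contDiff_x m).continuous

lemma HasContDerivs.continuous_Dx (hU : HasContDerivs P U DmU DymU DxmU DmmU) (m : PSpace d 2) :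
    Continuous fun x => Dx U x m := (hU.contDiff_Dx m).continuous

lemma HasContDerivs.integrable_U_comp (hU : HasContDerivs P U DmU DymU DxmU DmmU) {CU : ℝ}
    (hCU : ∀ x m, |U x m| ≤ CU) (m : PSpace d 2) {f : Ω → E d} (hf : Measurable f) :
    Integrable (fun ω => U (f ω) m) P :=
  Integrable.of_bound ((hU.continuous_fst m).measurable.comp hf).aestronglyMeasurable CU
    (Eventually.of_forall fun _ => hCU _ _)

lemma HasContDerivs.integrable_inner_Dx (hU : HasContDerivs P U DmU DymU DxmU DmmU) {L : NNReal}
    (hL : ∀ m, LipschitzWith L fun x => U x m) (m : PSpace d 2) {f : Ω → E d} (hf : Measurable f)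
    (W : L2 P d) : Integrable (fun ω => (inner ℝ (Dx U (f ω) m) (W ω) : ℝ)) P := by
  refine ((integrable_norm W).const_mul (L : ℝ)).mono'
    (((hU.continuous_Dx m).measurable.comp hf).inner (measurable_coe_L2 W)).aestronglyMeasurable
    (Eventually.of_forall fun ω => (norm_inner_le_norm _ _).trans ?_)
  gcongr
  exact norm_Dx_le_of_lipschitz (hL m) _

lemma HasContDerivs.integrable_lawDeriv (hU : HasContDerivs P U DmU DymU DxmU DmmU)
    (X₀ ξ Z : L2 P d) {R : ℝ} (hξ : ∀ᵐ ω ∂P, ‖ξ ω‖ ≤ R) :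
    Integrable (fun ω => lawDeriv DmU X₀ (ξ ω) Z) P := by
  obtain ⟨K, -, hK⟩ := hU.exists_lawDeriv_bound X₀ R
  exact Integrable.of_bound ((hU.stronglyMeasurable_lawDeriv X₀ Z).comp_measurable
    (measurable_coe_L2 ξ)).aestronglyMeasurable (K * ‖Z‖) (hξ.mono fun ω hω => hK _ hω Z)

lemma HasContDerivs.integrable_remainder (hU : HasContDerivs P U DmU DymU DxmU DmmU) {CU : ℝ}
    (hCU : ∀ x m, |U x m| ≤ CU) {L : NNReal} (hL : ∀ m, LipschitzWith L fun x => U x m)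
    (X₀ ξ Z W : L2 P d) {R : ℝ} (hξ : ∀ᵐ ω ∂P, ‖ξ ω‖ ≤ R) :
    Integrable (fun ω => remainder U DmU X₀ (ξ ω) (W ω) Z) P :=
  (((hU.integrable_U_comp hCU _ ((measurable_coe_L2 ξ).add (measurable_coe_L2 W))).sub
    (hU.integrable_U_comp hCU _ (measurable_coe_L2 ξ))).sub
    (hU.integrable_inner_Dx hL _ (measurable_coe_L2 ξ) W)).sub (hU.integrable_lawDeriv X₀ ξ Z hξ)

/-- Pointwise comparison of the remainder with that of a constant translation. Displacements `w`
of norm at least `1` are far from the small translation `c`, so there the boundedness and the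
Lipschitz continuity of `U` suffice. -/
lemma HasContDerivs.exists_remainder_sub_le (hU : HasContDerivs P U DmU DymU DxmU DmmU) {CU : ℝ}
    (hCU : ∀ x m, |U x m| ≤ CU) {L : NNReal} (hL : ∀ m, LipschitzWith L fun x => U x m)
    (X₀ : L2 P d) {R₀ : ℝ} (hX₀ : ∀ᵐ ω ∂P, ‖X₀ ω‖ ≤ R₀) (R : ℝ) :
    ∃ K r : ℝ, 0 ≤ K ∧ 0 < r ∧ ∀ x : E d, ‖x‖ ≤ R → ∀ w c : E d, ‖c‖ ≤ r → ∀ Z : L2 P d, ‖Z‖ ≤ r →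
      |remainder U DmU X₀ x w Z - remainder U DmU X₀ x c (Lp.const 2 P c)| ≤
      K * ((‖c‖ + (‖w - c‖ + ‖Z - Lp.const 2 P c‖)) * (‖w - c‖ + ‖Z - Lp.const 2 P c‖)) := by
  obtain ⟨K, r, hK, hr, hr1, hexp⟩ := hU.exists_expansion_bound X₀ hX₀ R
  obtain ⟨Kl, hKl, hl⟩ := hU.exists_lawDeriv_bound X₀ R
  have hCU0 : 0 ≤ CU := (abs_nonneg _).trans (hCU 0 (law X₀))
  refine ⟨K + (16 * CU + 6 * L + 8 * Kl), min r (1 / 2), by positivity, by positivity,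
    fun x hx w c hc Z hZ => ?_⟩
  have hcr : ‖c‖ ≤ r := hc.trans (min_le_left _ _)
  have hc2 : ‖c‖ ≤ 1 / 2 := hc.trans (min_le_right _ _)
  have hZr : ‖Z‖ ≤ r := hZ.trans (min_le_left _ _)
  set t := ‖Z - Lp.const 2 P c‖
  set u := ‖w - c‖
  have ht : 0 ≤ t := norm_nonneg _
  have hu : 0 ≤ u := norm_nonneg _
  have hcn : 0 ≤ ‖c‖ := norm_nonneg _
  have hprod : 0 ≤ (‖c‖ + (u + t)) * (u + t) := by positivity
  have hrest : 0 ≤ 16 * CU + 6 * L + 8 * Kl := by positivity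
  rw [add_mul]
  rcases le_or_gt ‖w‖ 1 with hw | hw
  · have h := hexp x hx w hw c hcr Z hZr
    have e : remainder U DmU X₀ x w Z - remainder U DmU X₀ x c (Lp.const 2 P c) =
        U (x + w) (law (X₀ + Z)) - U (x + c) (law (X₀ + Lp.const 2 P c))
        - inner ℝ (Dx U x (law X₀)) (w - c) - lawDeriv DmU X₀ x (Z - Lp.const 2 P c) := by
      rw [hU.lawDeriv_sub, remainder, remainder, inner_sub_right]
      ring
    rw [e]
    refine h.trans ?_
    rw [mul_assoc]
    exact le_add_of_nonneg_right (mul_nonneg hrest hprod)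
  · have hwu : ‖w‖ ≤ u + ‖c‖ := by
      have := norm_add_le (w - c) c
      rwa [sub_add_cancel] at this
    have hu2 : 1 / 2 ≤ u := by linarith
    have hrem : ∀ (v : E d) (Y : L2 P d), |remainder U DmU X₀ x v Y| ≤
        2 * CU + L * ‖v‖ + Kl * ‖Y‖ := by
      intro v Y
      have h1 := hCU (x + v) (law (X₀ + Y))
      have h2 := hCU x (law X₀)
      have h3 : |inner ℝ (Dx U x (law X₀)) v| ≤ L * ‖v‖ :=
        (abs_real_inner_le_norm _ _).trans
          (mul_le_mul_of_nonneg_right (norm_Dx_le_of_lipschitz (hL _) _) (norm_nonneg _))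
      have h4 := hl x hx Y
      rw [remainder]
      rw [abs_le] at *
      constructor <;> linarith [h1.1, h1.2, h2.1, h2.2, h3.1, h3.2, h4.1, h4.2]
    have h1 := hrem w Z
    have h2 := hrem c (Lp.const 2 P c)
    rw [norm_const_L2] at h2
    have hu1 : 1 ≤ 4 * u ^ 2 := by nlinarith
    have huu : u ≤ 2 * u ^ 2 := by nlinarith
    have hL0 : (0 : ℝ) ≤ L := L.2
    have hZ1 : ‖Z‖ ≤ 1 := hZr.trans hr1
    have b1 : (L : ℝ) * ‖w‖ ≤ L * (u + 1 / 2) := by gcongr; exact hwu.trans (by linarith)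
    have b2 : (L : ℝ) * ‖c‖ ≤ L * (1 / 2) := by gcongr
    have b3 : Kl * ‖Z‖ ≤ Kl * 1 := by gcongr
    have b4 : Kl * ‖c‖ ≤ Kl * 1 := by gcongr; linarith
    have c1 : 4 * CU ≤ 16 * CU * u ^ 2 := by nlinarith
    have c2 : (L : ℝ) * (u + 1) ≤ 6 * L * u ^ 2 := by nlinarith
    have c3 : 2 * Kl ≤ 8 * Kl * u ^ 2 := by nlinarith
    have hmain : |remainder U DmU X₀ x w Z - remainder U DmU X₀ x c (Lp.const 2 P c)| ≤
        (16 * CU + 6 * L + 8 * Kl) * u ^ 2 := by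
      refine (abs_sub _ _).trans ?_
      linarith
    have hsq : u ^ 2 ≤ (‖c‖ + (u + t)) * (u + t) := by
      rw [sq]
      gcongr
      · linarith
      · linarith
    calc _ ≤ (16 * CU + 6 * L + 8 * Kl) * u ^ 2 := hmain
      _ ≤ (16 * CU + 6 * L + 8 * Kl) * ((‖c‖ + (u + t)) * (u + t)) := by gcongr
      _ ≤ _ := le_add_of_nonneg_left (mul_nonneg hK hprod)

lemma measurable_remainder_const (hU : HasContDerivs P U DmU DymU DxmU DmmU)
    (X₀ : L2 P d) (c : E d) (Z : L2 P d) : Measurable fun x => remainder U DmU X₀ x c Z := by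
  have h1 : Measurable fun x => U (x + c) (law (X₀ + Z)) :=
    ((hU.continuous_fst _).comp (continuous_add_const c)).measurable
  have h2 : Measurable fun x => U x (law X₀) := (hU.continuous_fst _).measurable
  have h3 : Measurable fun x => (inner ℝ (Dx U x (law X₀)) c : ℝ) :=
    ((hU.continuous_Dx _).inner continuous_const).measurable
  exact ((h1.sub h2).sub h3).sub (hU.stronglyMeasurable_lawDeriv X₀ Z).measurable

/-- The pointwise expansion along translations survives averaging, by dominated convergence: the
remainder is uniformly of second order, by comparison with the zero translation. -/
lemma HasContDerivs.isLittleO_integral_remainder (hU : HasContDerivs P U DmU DymU DxmU DmmU)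
    {CU : ℝ} (hCU : ∀ x m, |U x m| ≤ CU) {L : NNReal} (hL : ∀ m, LipschitzWith L fun x => U x m)
    (X₀ ξ : L2 P d) {R₀ R : ℝ} (hX₀ : ∀ᵐ ω ∂P, ‖X₀ ω‖ ≤ R₀) (hξ : ∀ᵐ ω ∂P, ‖ξ ω‖ ≤ R) :
    (fun c : E d => ∫ ω, remainder U DmU X₀ (ξ ω) c (Lp.const 2 P c) ∂P -
        1 / 2 * inner ℝ ((∫ ω, translationHessian U DymU DxmU DmmU X₀ (ξ ω) ∂P) c) c)
      =o[𝓝 0] fun c => ‖c‖ ^ 2 := by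
  obtain ⟨K, r, hK, hr, hrem⟩ := hU.exists_remainder_sub_le hCU hL X₀ hX₀ R
  obtain ⟨KA, hKA⟩ := hU.exists_translationHessian_bound X₀ hX₀ R
  have hAint := hU.integrable_translationHessian X₀ ξ hX₀ hξ
  let e : E d → Ω → ℝ := fun c ω => remainder U DmU X₀ (ξ ω) c (Lp.const 2 P c) -
    1 / 2 * inner ℝ (translationHessian U DymU DxmU DmmU X₀ (ξ ω) c) c
  have hrem0 : ∀ x, remainder U DmU X₀ x 0 (Lp.const 2 P (0 : E d)) = 0 := fun x => by
    rw [remainder, lawDeriv_const]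
    simp [const_zero_L2]
  have hAc : ∀ c : E d, Integrable (fun ω => (inner ℝ
      (translationHessian U DymU DxmU DmmU X₀ (ξ ω) c) c : ℝ)) P := fun c =>
    (hAint.apply_continuousLinearMap c).inner_const c
  have hem : ∀ c, AEStronglyMeasurable (e c) P := fun c =>
    ((measurable_remainder_const hU X₀ c _).comp (measurable_coe_L2 ξ)).aestronglyMeasurable.sub
      ((hAc c).aestronglyMeasurable.const_mul _)
  have hremb : ∀ x : E d, ‖x‖ ≤ R → ∀ c : E d, ‖c‖ ≤ r →
      |remainder U DmU X₀ x c (Lp.const 2 P c)| ≤ 4 * K * ‖c‖ ^ 2 := by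
    intro x hx c hc
    have h := hrem x hx c 0 (by simpa using hr.le) (Lp.const 2 P c)
      (by rw [norm_const_L2]; exact hc)
    rw [hrem0, const_zero_L2, sub_zero, sub_zero, sub_zero, norm_zero, norm_const_L2] at h
    refine h.trans_eq (by ring)
  have hlim : Tendsto (fun c => ∫ ω, e c ω / ‖c‖ ^ 2 ∂P) (𝓝 0) (𝓝 (∫ _, (0 : ℝ) ∂P)) := by
    refine tendsto_integral_filter_of_dominated_convergence (fun _ => 4 * K + 1 / 2 * KA)
      (Eventually.of_forall fun c => ?_) ?_ (integrable_const _) ?_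
    · simpa only [div_eq_mul_inv] using (hem c).mul_const _
    · filter_upwards [Metric.closedBall_mem_nhds (0 : E d) hr] with c hc
      have hcr : ‖c‖ ≤ r := by simpa using hc
      filter_upwards [hξ] with ω hω
      rcases eq_or_ne c 0 with rfl | hc0
      · have : 0 ≤ KA := (norm_nonneg _).trans (hKA _ hω)
        simp only [norm_zero, ne_eq, OfNat.ofNat_ne_zero, not_false_eq_true, zero_pow, div_zero]
        positivity
      · have hcpos : 0 < ‖c‖ ^ 2 := by positivity
        rw [norm_div, Real.norm_of_nonneg hcpos.le, div_le_iff₀ hcpos]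
        have h1 := hremb (ξ ω) hω c hcr
        have h2 : |inner ℝ (translationHessian U DymU DxmU DmmU X₀ (ξ ω) c) c| ≤ KA * ‖c‖ ^ 2 := by
          refine (abs_real_inner_le_norm _ _).trans ?_
          rw [sq, ← mul_assoc]
          gcongr
          exact (ContinuousLinearMap.le_opNorm _ _).trans (by gcongr; exact hKA _ hω)
        refine (abs_sub _ _).trans ?_
        rw [abs_mul, abs_of_nonneg (show (0 : ℝ) ≤ 1 / 2 by norm_num)]
        linarith
    · refine Eventually.of_forall fun ω => ?_
      refine ((hU.isLittleO_translate X₀ hX₀ (ξ ω)).congr_left fun c => ?_).tendsto_div_nhds_zero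
      simp only [e, remainder, lawDeriv_const]
  simp only [integral_zero] at hlim
  refine Asymptotics.isLittleO_iff.2 fun ε hε => ?_
  filter_upwards [Metric.tendsto_nhds.1 hlim ε hε, Metric.closedBall_mem_nhds (0 : E d) hr]
    with c hc hcr
  have hcr' : ‖c‖ ≤ r := by simpa using hcr
  have hri : Integrable (fun ω => remainder U DmU X₀ (ξ ω) c (Lp.const 2 P c)) P :=
    Integrable.of_bound ((measurable_remainder_const hU X₀ c _).comp
      (measurable_coe_L2 ξ)).aestronglyMeasurable _ (hξ.mono fun ω hω => hremb _ hω c hcr')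
  have heq : ∫ ω, e c ω ∂P = ∫ ω, remainder U DmU X₀ (ξ ω) c (Lp.const 2 P c) ∂P -
        1 / 2 * inner ℝ ((∫ ω, translationHessian U DymU DxmU DmmU X₀ (ξ ω) ∂P) c) c := by
    simp only [e]
    rw [integral_sub hri ((hAc c).const_mul _), integral_const_mul,
      ContinuousLinearMap.integral_apply hAint]
    congr 2
    rw [real_inner_comm, ← integral_inner (hAint.apply_continuousLinearMap c)]
    simp only [real_inner_comm]
  rw [← heq]
  rcases eq_or_ne c 0 with rfl | hc0
  · have h0 : ∀ ω, e 0 ω = 0 := fun ω => by simp only [e, hrem0]; simp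
    simp [h0]
  · have hcpos : 0 < ‖c‖ ^ 2 := by positivity
    rw [dist_zero_right, integral_div, norm_div, Real.norm_of_nonneg hcpos.le,
      div_lt_iff₀ hcpos] at hc
    rw [Real.norm_of_nonneg hcpos.le]
    exact hc.le

/-- The expansion of `(W, Z) ↦ 𝔼[U(ξ + W, law (X₀ + Z))]` at bounded random variables. The quadratic
part along the constants is sharp, up to the arbitrarily small `δ`; in the complementary
directions the error is merely of second order. -/
lemma HasContDerivs.exists_integral_remainder_bound (hU : HasContDerivs P U DmU DymU DxmU DmmU)
    {CU : ℝ} (hCU : ∀ x m, |U x m| ≤ CU) {L : NNReal} (hL : ∀ m, LipschitzWith L fun x => U x m)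
    (X₀ ξ : L2 P d) {R₀ R : ℝ} (hX₀ : ∀ᵐ ω ∂P, ‖X₀ ω‖ ≤ R₀) (hξ : ∀ᵐ ω ∂P, ‖ξ ω‖ ≤ R)
    {δ : ℝ} (hδ : 0 < δ) :
    ∃ K r : ℝ, 0 ≤ K ∧ 0 < r ∧ ∀ (c : E d) (Z W : L2 P d), ‖c‖ ≤ r → ‖Z‖ ≤ r →
      |∫ ω, remainder U DmU X₀ (ξ ω) (W ω) Z ∂P -
        1 / 2 * inner ℝ ((∫ ω, translationHessian U DymU DxmU DmmU X₀ (ξ ω) ∂P) c) c| ≤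
      δ * ‖c‖ ^ 2 + K * (‖W - Lp.const 2 P c‖ ^ 2 + ‖Z - Lp.const 2 P c‖ ^ 2) := by
  obtain ⟨K, r, hK, hr, hrem⟩ := hU.exists_remainder_sub_le hCU hL X₀ hX₀ R
  have ho := Asymptotics.isLittleO_iff.1 (hU.isLittleO_integral_remainder hCU hL X₀ ξ hX₀ hξ)
    (half_pos hδ)
  obtain ⟨η, hη, hball⟩ := Metric.eventually_nhds_iff.1 ho
  refine ⟨2 * (K ^ 2 / (2 * δ) + K), min r (η / 2), by positivity, by positivity,
    fun c Z W hc hZ => ?_⟩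
  have hcr : ‖c‖ ≤ r := hc.trans (min_le_left _ _)
  have hZr : ‖Z‖ ≤ r := hZ.trans (min_le_left _ _)
  have h2 := hball (y := c) (by
    rw [dist_zero_right]
    have := hc.trans (min_le_right _ _)
    linarith)
  rw [Real.norm_of_nonneg (by positivity : 0 ≤ ‖c‖ ^ 2), Real.norm_eq_abs] at h2
  set B : L2 P d := W - Lp.const 2 P c with hB
  set t := ‖Z - Lp.const 2 P c‖ with ht
  have ht0 : 0 ≤ t := norm_nonneg _
  have hBω : ∀ᵐ ω ∂P, B ω = W ω - c := by
    filter_upwards [Lp.coeFn_sub W (Lp.const 2 P c), Lp.coeFn_const (p := 2) (μ := P) c]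
      with ω e1 e2
    rw [hB, e1, Pi.sub_apply, e2]; rfl
  have i1 := hU.integrable_remainder hCU hL X₀ ξ Z W hξ
  have i2 : Integrable (fun ω => remainder U DmU X₀ (ξ ω) c (Lp.const 2 P c)) P := by
    refine (hU.integrable_remainder hCU hL X₀ ξ (Lp.const 2 P c) (Lp.const 2 P c) hξ).congr ?_
    filter_upwards [Lp.coeFn_const (p := 2) (μ := P) c] with ω e2
    rw [e2]; rfl
  have hexpand : ∀ ω, K * ((‖c‖ + (‖B ω‖ + t)) * (‖B ω‖ + t)) =
      K * ‖B ω‖ ^ 2 + (K * (‖c‖ + 2 * t) * ‖B ω‖ + K * (‖c‖ * t + t ^ 2)) := fun ω => by ring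
  have j1 : Integrable (fun ω => K * ‖B ω‖ ^ 2) P := (integrable_norm_sq B).const_mul _
  have j2 : Integrable (fun ω => K * (‖c‖ + 2 * t) * ‖B ω‖) P := (integrable_norm B).const_mul _
  have j3 : Integrable (fun ω => K * (‖c‖ + 2 * t) * ‖B ω‖ + K * (‖c‖ * t + t ^ 2)) P :=
    j2.add (integrable_const _)
  have h1 : |∫ ω, remainder U DmU X₀ (ξ ω) (W ω) Z ∂P -
      ∫ ω, remainder U DmU X₀ (ξ ω) c (Lp.const 2 P c) ∂P| ≤
      K * (‖c‖ * (‖B‖ + t) + (‖B‖ + t) ^ 2) := by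
    rw [← integral_sub i1 i2, ← Real.norm_eq_abs]
    refine (norm_integral_le_of_norm_le (j1.add j3) ?_).trans ?_
    · filter_upwards [hξ, hBω] with ω h3 h4
      have h5 := hrem (ξ ω) h3 (W ω) c hcr Z hZr
      rw [← h4, hexpand] at h5
      exact h5
    · simp only [Pi.add_apply]
      rw [integral_add j1 j3, integral_add j2 (integrable_const _), integral_const_mul,
        integral_const_mul, integral_norm_sq]
      have h6 := integral_norm_le B
      have h7 : K * (‖c‖ + 2 * t) * ∫ ω, ‖B ω‖ ∂P ≤ K * (‖c‖ + 2 * t) * ‖B‖ := by gcongr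
      simp only [integral_const, probReal_univ, smul_eq_mul, one_mul]
      refine (add_le_add le_rfl (add_le_add h7 le_rfl)).trans_eq ?_
      ring
  set b := ‖B‖
  have hb0 : 0 ≤ b := norm_nonneg _
  have hyoung : K * (‖c‖ * (b + t)) ≤ δ / 2 * ‖c‖ ^ 2 + K ^ 2 / (2 * δ) * (b + t) ^ 2 := by
    have h8 := sq_nonneg (δ * ‖c‖ - K * (b + t))
    have h9 : δ / 2 * ‖c‖ ^ 2 + K ^ 2 / (2 * δ) * (b + t) ^ 2 - K * (‖c‖ * (b + t)) =
        (δ * ‖c‖ - K * (b + t)) ^ 2 / (2 * δ) := by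
      field_simp
      ring
    have h10 : 0 ≤ (δ * ‖c‖ - K * (b + t)) ^ 2 / (2 * δ) := by positivity
    linarith
  have hsq : (b + t) ^ 2 ≤ 2 * (b ^ 2 + t ^ 2) := by nlinarith [sq_nonneg (b - t)]
  have hk0 : 0 ≤ K ^ 2 / (2 * δ) + K := by positivity
  have hfin : (K ^ 2 / (2 * δ) + K) * (b + t) ^ 2 ≤
      (K ^ 2 / (2 * δ) + K) * (2 * (b ^ 2 + t ^ 2)) := by gcongr
  have htri := abs_add_le (∫ ω, remainder U DmU X₀ (ξ ω) (W ω) Z ∂P -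
      ∫ ω, remainder U DmU X₀ (ξ ω) c (Lp.const 2 P c) ∂P)
    (∫ ω, remainder U DmU X₀ (ξ ω) c (Lp.const 2 P c) ∂P -
        1 / 2 * inner ℝ ((∫ ω, translationHessian U DymU DxmU DmmU X₀ (ξ ω) ∂P) c) c)
  rw [sub_add_sub_cancel] at htri
  nlinarith

end IntegratedExpansion

/-! ### Elements of the second-order subdifferential -/

section SubjetElement

variable {Ω : Type*} [MeasurableSpace Ω] {P : Measure Ω} [IsProbabilityMeasure P] {d : ℕ}
variable {U : E d → PSpace d 2 → ℝ} {DmU : E d → PSpace d 2 → E d → E d}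
  {DymU DxmU : E d → PSpace d 2 → E d → E d →L[ℝ] E d}
  {DmmU : E d → PSpace d 2 → E d → E d → E d →L[ℝ] E d}

lemma exists_L2_of_bound {f : Ω → E d} (hf : AEStronglyMeasurable f P) {K : ℝ}
    (hK : ∀ᵐ ω ∂P, ‖f ω‖ ≤ K) : ∃ V : L2 P d, V =ᵐ[P] f :=
  ⟨(MemLp.of_bound hf K hK).toLp f, MemLp.coeFn_toLp _⟩

lemma HasContDerivs.exists_DmU_bound (hU : HasContDerivs P U DmU DymU DxmU DmmU)
    (X₀ : L2 P d) {R₀ : ℝ} (hX₀ : ∀ᵐ ω ∂P, ‖X₀ ω‖ ≤ R₀) (R : ℝ) :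
    ∃ K, ∀ᵐ ω ∂P, ∀ x : E d, ‖x‖ ≤ R → ‖DmU x (law X₀) (X₀ ω)‖ ≤ K := by
  obtain ⟨C, r, hB⟩ := hU.exists_growthBound X₀ R
  have hC := hB.nonneg
  refine ⟨C * (1 + R₀), hX₀.mono fun ω hω x hx => ?_⟩
  exact (hB.dm x hx X₀ (by simpa using hB.pos.le) _).trans (by gcongr)

/-- By Fubini, the average over `ξ` of the derivative in the measure of `U ξ` is again
represented by an element of `L²`. -/
lemma HasContDerivs.exists_inner_eq_integral_lawDeriv
    (hU : HasContDerivs P U DmU DymU DxmU DmmU) (X₀ ξ : L2 P d) {R₀ R : ℝ}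
    (hX₀ : ∀ᵐ ω ∂P, ‖X₀ ω‖ ≤ R₀) (hξ : ∀ᵐ ω ∂P, ‖ξ ω‖ ≤ R) :
    ∃ G : L2 P d, (∃ K, ∀ᵐ ω ∂P, ‖G ω‖ ≤ K) ∧
      ∀ Z : L2 P d, inner ℝ G Z = ∫ ω, lawDeriv DmU X₀ (ξ ω) Z ∂P := by
  obtain ⟨K, hK⟩ := hU.exists_DmU_bound X₀ hX₀ R
  have hm : Measurable fun q : Ω × Ω => DmU (ξ q.2) (law X₀) (X₀ q.1) :=
    (hU.measurable_DmU_prod X₀).comp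
      (((measurable_coe_L2 ξ).comp measurable_snd).prodMk measurable_fst)
  have hb : ∀ᵐ ω ∂P, ‖∫ ω', DmU (ξ ω') (law X₀) (X₀ ω) ∂P‖ ≤ K := by
    filter_upwards [hK] with ω hω
    refine (norm_integral_le_of_norm_le_const (C := K) ?_).trans_eq (by simp)
    filter_upwards [hξ] with ω' hω' using hω _ hω'
  obtain ⟨G, hG⟩ := exists_L2_of_bound
    hm.stronglyMeasurable.integral_prod_right'.aestronglyMeasurable hb
  refine ⟨G, ⟨K, by filter_upwards [hG, hb] with ω h1 h2; rwa [h1]⟩, fun Z => ?_⟩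
  have hint : Integrable (fun q : Ω × Ω => (inner ℝ (DmU (ξ q.2) (law X₀) (X₀ q.1)) (Z q.1) : ℝ))
      (P.prod P) := by
    refine (((integrable_norm Z).const_mul K).comp_fst P).mono'
      (hm.inner ((measurable_coe_L2 Z).comp measurable_fst)).aestronglyMeasurable ?_
    have h1 : ∀ᵐ q ∂P.prod P, ∀ x : E d, ‖x‖ ≤ R → ‖DmU x (law X₀) (X₀ q.1)‖ ≤ K :=
      Measure.quasiMeasurePreserving_fst.ae hK
    have h2 : ∀ᵐ q ∂P.prod P, ‖ξ q.2‖ ≤ R := Measure.quasiMeasurePreserving_snd.ae hξ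
    filter_upwards [h1, h2] with q h3 h4
    refine (norm_inner_le_norm _ _).trans ?_
    gcongr
    exact h3 _ h4
  simp only [lawDeriv]
  rw [← integral_integral_swap (f := fun ω ω' =>
    (inner ℝ (DmU (ξ ω') (law X₀) (X₀ ω)) (Z ω) : ℝ)) hint, L2.inner_def]
  refine integral_congr_ae ?_
  filter_upwards [hG, hK] with ω h1 h2
  have hi : Integrable (fun ω' => DmU (ξ ω') (law X₀) (X₀ ω)) P :=
    Integrable.of_bound (hm.comp measurable_prodMk_left).aestronglyMeasurable K
      (hξ.mono fun ω' h => h2 _ h)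
  rw [h1, real_inner_comm, ← integral_inner hi]
  simp only [real_inner_comm]

/-- Second-order expansion of `(W, Z) ↦ 𝔼[U(ξ + W, law (X₀ + Z))]` at `(0, 0)`. -/
lemma HasContDerivs.exists_integral_expansion (hU : HasContDerivs P U DmU DymU DxmU DmmU)
    {CU : ℝ} (hCU : ∀ x m, |U x m| ≤ CU) {L : NNReal} (hL : ∀ m, LipschitzWith L fun x => U x m)
    (X₀ ξ V G : L2 P d) {R₀ R : ℝ} (hX₀ : ∀ᵐ ω ∂P, ‖X₀ ω‖ ≤ R₀) (hξ : ∀ᵐ ω ∂P, ‖ξ ω‖ ≤ R)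
    (hV : V =ᵐ[P] fun ω => Dx U (ξ ω) (law X₀))
    (hG : ∀ Z : L2 P d, inner ℝ G Z = ∫ ω, lawDeriv DmU X₀ (ξ ω) Z ∂P) {δ : ℝ} (hδ : 0 < δ) :
    ∃ K r : ℝ, 0 ≤ K ∧ 0 < r ∧ ∀ (c : E d) (Z W : L2 P d), ‖c‖ ≤ r → ‖Z‖ ≤ r →
      |∫ ω, U ((ξ + W : L2 P d) ω) (law (X₀ + Z)) ∂P - ∫ ω, U (ξ ω) (law X₀) ∂P
        - inner ℝ V W - inner ℝ G Z -
        1 / 2 * inner ℝ ((∫ ω, translationHessian U DymU DxmU DmmU X₀ (ξ ω) ∂P) c) c| ≤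
      δ * ‖c‖ ^ 2 + K * (‖W - Lp.const 2 P c‖ ^ 2 + ‖Z - Lp.const 2 P c‖ ^ 2) := by
  obtain ⟨K, r, hK, hr, h⟩ := hU.exists_integral_remainder_bound hCU hL X₀ ξ hX₀ hξ hδ
  refine ⟨K, r, hK, hr, fun c Z W hc hZ => ?_⟩
  have i1 := hU.integrable_U_comp hCU (law (X₀ + Z))
    ((measurable_coe_L2 ξ).add (measurable_coe_L2 W))
  have i2 := hU.integrable_U_comp hCU (law X₀) (measurable_coe_L2 ξ)
  have i3 := hU.integrable_inner_Dx hL (law X₀) (measurable_coe_L2 ξ) W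
  have i4 := hU.integrable_lawDeriv X₀ ξ Z hξ
  have e1 : ∫ ω, U ((ξ + W : L2 P d) ω) (law (X₀ + Z)) ∂P =
      ∫ ω, U (ξ ω + W ω) (law (X₀ + Z)) ∂P := by
    refine integral_congr_ae ?_
    filter_upwards [Lp.coeFn_add ξ W] with ω hω
    rw [hω]; rfl
  have e2 : (inner ℝ V W : ℝ) = ∫ ω, inner ℝ (Dx U (ξ ω) (law X₀)) (W ω) ∂P := by
    rw [L2.inner_def]
    refine integral_congr_ae ?_
    filter_upwards [hV] with ω hω
    rw [hω]
  have e3 : ∫ ω, remainder U DmU X₀ (ξ ω) (W ω) Z ∂P =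
      ∫ ω, U ((ξ + W : L2 P d) ω) (law (X₀ + Z)) ∂P - ∫ ω, U (ξ ω) (law X₀) ∂P
        - inner ℝ V W - inner ℝ G Z := by
    rw [e1, e2, hG]
    simp only [remainder]
    exact (integral_sub ((i1.sub i2).sub i3) i4).trans (congrArg (· - _)
      ((integral_sub (i1.sub i2) i3).trans (congrArg (· - _) (integral_sub i1 i2))))
  rw [← e3]
  exact h c Z W hc hZ

/-- The essential supremum of the density is bounded below, with equality at `X₀`, by a smooth
functional; this yields a quadratic lower bound at `X₀`. -/
lemma exists_densNorm_lower_bound {s : Finset (E d)} {w : E d → ENNReal} {r : ℝ} {X₀ : L2 P d} (hX₀ : (law X₀).toMeasure = ballMixture s w r) :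
    ∃ (D : L2 P d) (K : ℝ), 0 ≤ K ∧ (∀ᵐ ω ∂P, ‖D ω‖ ≤ K) ∧ ∀ Z : L2 P d, X₀ + Z ∈ LInftyAc P d →
      densNorm X₀ + inner ℝ D Z - K * ‖Z‖ ^ 2 ≤ densNorm (X₀ + Z) := by
  obtain ⟨g, hg, hgs, hI, hle, heq⟩ := exists_bump_densNorm (P := P) hX₀
  set I := ∫ x, g x
  obtain ⟨M, hM⟩ := (hgs.fderiv (𝕜 := ℝ)).exists_bound_of_continuous
    (hg.continuous_fderiv (by norm_num))
  obtain ⟨B, hB⟩ := hgs.exists_bound_of_continuous hg.continuous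
  obtain ⟨L, hL⟩ := (hg.fderiv_right (m := 1) (by norm_num)).lipschitzWith_of_hasCompactSupport
    (hgs.fderiv (𝕜 := ℝ)) (by norm_num)
  have hgi : ∀ Y : L2 P d, Integrable (fun ω => g (Y ω)) P := fun Y =>
    Integrable.of_bound (hg.continuous.measurable.comp (measurable_coe_L2 Y)).aestronglyMeasurable
      B (Eventually.of_forall fun _ => hB _)
  have hgrad : Continuous (gradient g) :=
    (InnerProductSpace.toDual ℝ (E d)).symm.continuous.comp (hg.continuous_fderiv (by norm_num))
  have hnorm : ∀ x, ‖gradient g x‖ ≤ M := fun x => by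
    rw [gradient, LinearIsometryEquiv.norm_map]; exact hM x
  have hM0 : 0 ≤ M := (norm_nonneg _).trans (hM 0)
  obtain ⟨D, hD⟩ := exists_L2_of_bound (P := P) (f := fun ω => gradient g (X₀ ω))
    (hgrad.measurable.comp (measurable_coe_L2 X₀)).aestronglyMeasurable
    (Eventually.of_forall fun _ => hnorm _)
  have htaylor : ∀ x z : E d, g x + inner ℝ (gradient g x) z - L * ‖z‖ ^ 2 ≤ g (x + z) := by
    intro x z
    have h := (convex_closedBall x ‖z‖).norm_image_sub_le_of_norm_fderiv_le' (𝕜 := ℝ) (f := g)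
      (φ := fderiv ℝ g x) (C := L * ‖z‖) (x := x) (y := x + z)
      (fun y _ => (hg.differentiable (by norm_num)) y)
      (fun y hy => (hL.norm_sub_le y x).trans (by
        gcongr; rwa [Metric.mem_closedBall, dist_eq_norm] at hy)) (by simp) (by simp)
    rw [add_sub_cancel_left, Real.norm_eq_abs] at h
    have h2 : (inner ℝ (gradient g x) z : ℝ) = fderiv ℝ g x z := by
      rw [gradient, InnerProductSpace.toDual_symm_apply]
    have h3 := (abs_le.1 h).1
    rw [h2]
    linarith
  have hkey : ∀ Z : L2 P d, ∫ ω, g (X₀ ω) ∂P + inner ℝ D Z - L * ‖Z‖ ^ 2 ≤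
      ∫ ω, g ((X₀ + Z : L2 P d) ω) ∂P := by
    intro Z
    have i2 : Integrable (fun ω => (inner ℝ (D ω) (Z ω) : ℝ)) P := L2.integrable_inner D Z
    have i3 : Integrable (fun ω => L * ‖Z ω‖ ^ 2) P := (integrable_norm_sq Z).const_mul _
    have e : ∫ ω, (g (X₀ ω) + inner ℝ (D ω) (Z ω) - L * ‖Z ω‖ ^ 2) ∂P =
        ∫ ω, g (X₀ ω) ∂P + inner ℝ D Z - L * ‖Z‖ ^ 2 := by
      have i1 : Integrable (fun ω => g (X₀ ω) + (inner ℝ (D ω) (Z ω) : ℝ)) P := (hgi X₀).add i2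
      rw [integral_sub i1 i3, integral_add (hgi X₀) i2, integral_const_mul,
        integral_norm_sq, L2.inner_def]
    rw [← e]
    refine integral_mono_ae (((hgi X₀).add i2).sub i3) (hgi _) ?_
    filter_upwards [hD, Lp.coeFn_add X₀ Z] with ω h1 h2
    rw [h1, h2]
    exact htaylor _ _
  have hDn : ∀ᵐ ω ∂P, ‖(I⁻¹ • D : L2 P d) ω‖ ≤ I⁻¹ * M := by
    filter_upwards [hD, Lp.coeFn_smul I⁻¹ D] with ω h1 h2
    rw [h2, Pi.smul_apply, norm_smul, h1, Real.norm_of_nonneg (by positivity)]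
    gcongr
    exact hnorm _
  refine ⟨I⁻¹ • D, I⁻¹ * M + I⁻¹ * L, by positivity,
    hDn.mono fun ω h => h.trans (le_add_of_nonneg_right (by positivity)), fun Z hZ => ?_⟩
  have h1 := (hkey Z).trans (hle _ hZ)
  rw [heq] at h1
  have h2 : densNorm X₀ + I⁻¹ * inner ℝ D Z - I⁻¹ * L * ‖Z‖ ^ 2 ≤ densNorm (X₀ + Z) := by
    have h3 := mul_le_mul_of_nonneg_left h1 (inv_pos.2 hI).le
    have h4 : I⁻¹ * (densNorm (X₀ + Z) * I) = densNorm (X₀ + Z) := by field_simp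
    have h5 : I⁻¹ * (densNorm X₀ * I + inner ℝ D Z - L * ‖Z‖ ^ 2) =
        densNorm X₀ + I⁻¹ * inner ℝ D Z - I⁻¹ * L * ‖Z‖ ^ 2 := by field_simp
    rwa [h4, h5] at h3
  rw [real_inner_smul_left]
  have h6 : 0 ≤ I⁻¹ * M * ‖Z‖ ^ 2 := by positivity
  linarith

/-- The adjoint of the inclusion of the constants in the second factor. -/
noncomputable def sndMean (P : Measure Ω) [IsProbabilityMeasure P] (d : ℕ) :
    L2Pair P d →L[ℝ] E d :=
  (ContinuousLinearMap.adjoint (Lp.constL 2 P ℝ : E d →L[ℝ] L2 P d)).comp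
    (WithLp.sndL 2 ℝ (L2 P d) (L2 P d))

/-- The inclusion of `E d` in `L² × L²` as pairs of equal constants. -/
noncomputable def constPairL (P : Measure Ω) [IsProbabilityMeasure P] (d : ℕ) :
    E d →L[ℝ] L2Pair P d :=
  ((WithLp.prodContinuousLinearEquiv 2 ℝ (L2 P d) (L2 P d)).symm :
    L2 P d × L2 P d →L[ℝ] L2Pair P d).comp
    ((Lp.constL 2 P ℝ : E d →L[ℝ] L2 P d).prod (Lp.constL 2 P ℝ : E d →L[ℝ] L2 P d))

/-- The difference between a pair and the pair of constants given by the mean of its second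
component. -/
noncomputable def offDiag (P : Measure Ω) [IsProbabilityMeasure P] (d : ℕ) :
    L2Pair P d →L[ℝ] L2Pair P d :=
  ContinuousLinearMap.id ℝ _ - (constPairL P d).comp (sndMean P d)

/-- The inner product as a bounded bilinear form. -/
noncomputable def innerForm (K : Type*) [NormedAddCommGroup K] [InnerProductSpace ℝ K] :
    K →L[ℝ] K →L[ℝ] ℝ :=
  (isBoundedBilinearMap_inner (𝕜 := ℝ) (E := K)).toContinuousLinearMap

/-- The form `⟨T c, c'⟩ - b ⟨π h, π h'⟩`, where `c`, `c'` are the means of `h`, `h'` and `π` removes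
the corresponding constants. -/
noncomputable def meanForm (P : Measure Ω) [IsProbabilityMeasure P] {d : ℕ} (T : E d →L[ℝ] E d)
    (b : ℝ) : L2Pair P d →L[ℝ] L2Pair P d →L[ℝ] ℝ :=
  (innerForm (E d)).bilinearComp (T.comp (sndMean P d)) (sndMean P d) -
    b • (innerForm (L2Pair P d)).bilinearComp (offDiag P d) (offDiag P d)

lemma meanForm_apply (T : E d →L[ℝ] E d) (b : ℝ) (h h' : L2Pair P d) :
    meanForm P T b h h' = inner ℝ (T (sndMean P d h)) (sndMean P d h') -
      b * inner ℝ (offDiag P d h) (offDiag P d h') := rfl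

lemma norm_sndMean_le (h : L2Pair P d) : ‖sndMean P d h‖ ≤ ‖h‖ := by
  have h1 : ‖(Lp.constL 2 P ℝ : E d →L[ℝ] L2 P d)‖ ≤ 1 :=
    ContinuousLinearMap.opNorm_le_bound _ zero_le_one fun c => by
      rw [one_mul]; exact (norm_const_L2 c).le
  have h2 : ‖h.snd‖ ≤ ‖h‖ := by
    refine (abs_le_of_sq_le_sq' ?_ (norm_nonneg h)).2
    rw [WithLp.prod_norm_sq_eq_of_L2 h]
    exact le_add_of_nonneg_left (sq_nonneg _)
  calc ‖sndMean P d h‖ ≤ ‖ContinuousLinearMap.adjoint (Lp.constL 2 P ℝ : E d →L[ℝ] L2 P d)‖ *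
        ‖h.snd‖ := (ContinuousLinearMap.adjoint
          (Lp.constL 2 P ℝ : E d →L[ℝ] L2 P d)).le_opNorm h.snd
    _ ≤ 1 * ‖h‖ := by
        rw [LinearIsometryEquiv.norm_map]
        gcongr
    _ = ‖h‖ := one_mul _

lemma sndMean_constPairL (c : E d) : sndMean P d (constPairL P d c) = c := by
  refine ext_inner_right ℝ fun v => ?_
  change (inner ℝ (ContinuousLinearMap.adjoint (Lp.constL 2 P ℝ : E d →L[ℝ] L2 P d)
    (Lp.const 2 P c)) v : ℝ) = _
  rw [ContinuousLinearMap.adjoint_inner_left]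
  change (inner ℝ (Lp.const 2 P c) (Lp.const 2 P v) : ℝ) = _
  rw [L2.inner_def]
  refine (integral_congr_ae (g := fun _ => (inner ℝ c v : ℝ)) ?_).trans (by simp)
  filter_upwards [Lp.coeFn_const (p := 2) (μ := P) c, Lp.coeFn_const (p := 2) (μ := P) v]
    with ω e1 e2
  rw [e1, e2]; rfl

lemma constPairL_single (k : Fin d) :
    constPairL P d (EuclideanSpace.single k (1 : ℝ)) = constPair P k := rfl

lemma Lam_meanForm (T : E d →L[ℝ] E d) (b : ℝ) : Lam (meanForm P T b) = tr T := by
  rw [Lam, tr, LinearMap.trace_eq_sum_inner _ (EuclideanSpace.basisFun (Fin d) ℝ)]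
  refine Finset.sum_congr rfl fun k _ => ?_
  have h : offDiag P d (constPair P k) = 0 := by
    rw [← constPairL_single, offDiag, sub_apply, ContinuousLinearMap.comp_apply,
      sndMean_constPairL, ContinuousLinearMap.id_apply, sub_self]
  rw [meanForm_apply, h, inner_zero_left, mul_zero, sub_zero, ← constPairL_single,
    sndMean_constPairL, EuclideanSpace.basisFun_apply, real_inner_comm]
  rfl

lemma norm_offDiag_sq (h : L2Pair P d) : ‖offDiag P d h‖ ^ 2 =
    ‖h.fst - Lp.const 2 P (sndMean P d h)‖ ^ 2 + ‖h.snd - Lp.const 2 P (sndMean P d h)‖ ^ 2 :=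
  WithLp.prod_norm_sq_eq_of_L2 _

lemma subset_closedSubjet {K : Type*} [NormedAddCommGroup K] [InnerProductSpace ℝ K] {S : Set K}
    {φ : K → ℝ} {x : K} (hx : x ∈ S) : subjet S φ x ⊆ closedSubjet S φ x :=
  fun q hq => ⟨fun _ => x, fun _ => q, fun _ => ⟨hx, hq⟩, tendsto_const_nhds, tendsto_const_nhds,
    tendsto_const_nhds⟩

/-- An element of the subdifferential of `Û^ε` at `(X₀, y)`, where `X₀` has a nice law and `y` is a
constant. Its value on pairs of equal constants is, up to the small `δ` and `ε`, the difference of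
the second derivatives of `U` along joint translations. -/
lemma HasContDerivs.exists_mem_subjet (hU : HasContDerivs P U DmU DymU DxmU DmmU)
    {CU : ℝ} (hCU : ∀ x m, |U x m| ≤ CU) {L : NNReal} (hL : ∀ m, LipschitzWith L fun x => U x m)
    (X₀ η V G G' V' D : L2 P d) {R₀ R : ℝ} (hX₀ : ∀ᵐ ω ∂P, ‖X₀ ω‖ ≤ R₀) (hη : ∀ᵐ ω ∂P, ‖η ω‖ ≤ R)
    (hV : V =ᵐ[P] fun ω => Dx U (X₀ ω) (law X₀)) (hV' : V' =ᵐ[P] fun ω => Dx U (η ω) (law X₀))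
    (hG : ∀ Z : L2 P d, inner ℝ G Z = ∫ ω, lawDeriv DmU X₀ (X₀ ω) Z ∂P)
    (hG' : ∀ Z : L2 P d, inner ℝ G' Z = ∫ ω, lawDeriv DmU X₀ (η ω) Z ∂P)
    {K : ℝ} (hD : ∀ Z : L2 P d, X₀ + Z ∈ LInftyAc P d →
      densNorm X₀ + inner ℝ D Z - K * ‖Z‖ ^ 2 ≤ densNorm (X₀ + Z)) (hK : 0 ≤ K)
    {δ ε : ℝ} (hδ : 0 < δ) (hε : 0 ≤ ε) :
    ∃ b : ℝ, (meanForm P (∫ ω, translationHessian U DymU DxmU DmmU X₀ (X₀ ω) ∂P -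
        ∫ ω, translationHessian U DymU DxmU DmmU X₀ (η ω) ∂P -
        (4 * δ + 4 * ε * K) • ContinuousLinearMap.id ℝ (E d)) b,
      WithLp.toLp 2 (V + G - G' + ε • D, -V')) ∈
      subjet {z : L2Pair P d | z.fst ∈ LInftyAc P d} (hatUeps U ε) (WithLp.toLp 2 (X₀, η)) := by
  obtain ⟨K₁, r₁, hK₁, hr₁, h₁⟩ := hU.exists_integral_expansion hCU hL X₀ X₀ V G hX₀ hX₀ hV hG hδ
  obtain ⟨K₂, r₂, hK₂, hr₂, h₂⟩ := hU.exists_integral_expansion hCU hL X₀ η V' G' hX₀ hη hV' hG' hδ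
  refine ⟨2 * (2 * K₁ + K₂) + 4 * ε * K, fun δ' hδ' => ?_⟩
  rw [eventually_nhdsWithin_iff]
  filter_upwards [Metric.closedBall_mem_nhds (WithLp.toLp 2 (X₀, η) : L2Pair P d)
    (lt_min hr₁ hr₂)] with z hz hzS
  have hz' : ‖z - WithLp.toLp 2 (X₀, η)‖ ≤ min r₁ r₂ := by
    rwa [Metric.mem_closedBall, dist_eq_norm] at hz
  set h : L2Pair P d := z - WithLp.toLp 2 (X₀, η) with hh
  set c := sndMean P d h with hc
  have hcn : ‖c‖ ≤ min r₁ r₂ := (norm_sndMean_le h).trans hz'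
  have hZn : ‖h.fst‖ ≤ min r₁ r₂ := by
    refine le_trans (abs_le_of_sq_le_sq' ?_ (norm_nonneg h)).2 hz'
    rw [WithLp.prod_norm_sq_eq_of_L2 h]
    exact le_add_of_nonneg_right (sq_nonneg _)
  have hz1 : z.fst = X₀ + h.fst := by simp [hh]
  have hz2 : z.snd = η + h.snd := by simp [hh]
  have a1 := h₁ c h.fst h.fst (hcn.trans (min_le_left _ _)) (hZn.trans (min_le_left _ _))
  have a2 := h₂ c h.fst h.snd (hcn.trans (min_le_right _ _)) (hZn.trans (min_le_right _ _))
  have hzS' : X₀ + h.fst ∈ LInftyAc P d := by rw [← hz1]; exact hzS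
  have a3 := hD h.fst hzS'
  have hU1 : hatU U z = ∫ ω, U ((X₀ + h.fst : L2 P d) ω) (law (X₀ + h.fst)) ∂P -
      ∫ ω, U ((η + h.snd : L2 P d) ω) (law (X₀ + h.fst)) ∂P := by
    rw [hatU, hz1, hz2]
    exact integral_sub (hU.integrable_U_comp hCU _ (measurable_coe_L2 _))
      (hU.integrable_U_comp hCU _ (measurable_coe_L2 _))
  have hU0 : hatU U (WithLp.toLp 2 (X₀, η)) = ∫ ω, U (X₀ ω) (law X₀) ∂P -
      ∫ ω, U (η ω) (law X₀) ∂P :=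
    integral_sub (hU.integrable_U_comp hCU _ (measurable_coe_L2 _))
      (hU.integrable_U_comp hCU _ (measurable_coe_L2 _))
  have hp : (inner ℝ (WithLp.toLp 2 (V + G - G' + ε • D, -V') : L2Pair P d) h : ℝ) =
      inner ℝ V h.fst + inner ℝ G h.fst - inner ℝ G' h.fst + ε * inner ℝ D h.fst -
        inner ℝ V' h.snd := by
    rw [WithLp.prod_inner_apply]
    change (inner ℝ (V + G - G' + ε • D) h.fst : ℝ) + inner ℝ (-V') h.snd = _
    rw [inner_add_left, inner_sub_left, inner_add_left, real_inner_smul_left, inner_neg_left]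
    ring
  have hsq : ‖h.fst‖ ^ 2 ≤ 2 * ‖h.fst - Lp.const 2 P c‖ ^ 2 + 2 * ‖c‖ ^ 2 := by
    have := norm_add_le (h.fst - Lp.const 2 P c) (Lp.const 2 P c)
    rw [sub_add_cancel, norm_const_L2] at this
    nlinarith [norm_nonneg h.fst, norm_nonneg c, norm_nonneg (h.fst - Lp.const 2 P c),
      sq_nonneg (‖h.fst - Lp.const 2 P c‖ - ‖c‖)]
  have hεK : ε * K * ‖h.fst‖ ^ 2 ≤
      ε * K * (2 * ‖h.fst - Lp.const 2 P c‖ ^ 2 + 2 * ‖c‖ ^ 2) := by gcongr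
  have hform : meanForm P (∫ ω, translationHessian U DymU DxmU DmmU X₀ (X₀ ω) ∂P -
        ∫ ω, translationHessian U DymU DxmU DmmU X₀ (η ω) ∂P -
        (4 * δ + 4 * ε * K) • ContinuousLinearMap.id ℝ (E d)) (2 * (2 * K₁ + K₂) + 4 * ε * K) h h =
      inner ℝ ((∫ ω, translationHessian U DymU DxmU DmmU X₀ (X₀ ω) ∂P) c) c -
      inner ℝ ((∫ ω, translationHessian U DymU DxmU DmmU X₀ (η ω) ∂P) c) c -
      (4 * δ + 4 * ε * K) * ‖c‖ ^ 2 - (2 * (2 * K₁ + K₂) + 4 * ε * K) *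
        (‖h.fst - Lp.const 2 P c‖ ^ 2 + ‖h.snd - Lp.const 2 P c‖ ^ 2) := by
    rw [meanForm_apply, real_inner_self_eq_norm_sq, norm_offDiag_sq, ← hc, sub_apply, sub_apply,
      inner_sub_left, inner_sub_left, smul_apply, ContinuousLinearMap.id_apply,
      real_inner_smul_left, real_inner_self_eq_norm_sq]
  simp only [hatUeps]
  rw [hform, hp, hU1, hU0, hz1]
  have b1 := (abs_le.1 a1).1
  have b2 := (abs_le.1 a2).2
  have b3 := mul_le_mul_of_nonneg_left a3 hε
  have b4 : 0 ≤ δ' * ‖h‖ ^ 2 := by positivity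
  have q1 := sq_nonneg ‖h.fst - Lp.const 2 P c‖
  have q2 := sq_nonneg ‖h.snd - Lp.const 2 P c‖
  have b5 : 0 ≤ K₁ * ‖h.snd - Lp.const 2 P c‖ ^ 2 := by positivity
  have b5' : 0 ≤ K₂ * ‖h.snd - Lp.const 2 P c‖ ^ 2 := by positivity
  have b6 : 0 ≤ ε * K * ‖h.snd - Lp.const 2 P c‖ ^ 2 := by positivity
  have e0 : densNorm (WithLp.toLp 2 (X₀, η) : L2Pair P d).fst = densNorm X₀ := rfl
  rw [e0]
  set n₁ := ‖h.fst - Lp.const 2 P c‖ ^ 2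
  set n₂ := ‖h.snd - Lp.const 2 P c‖ ^ 2
  linarith

end SubjetElement

/-! ### The residual of the equation -/

section Residual

variable {Ω : Type*} [MeasurableSpace Ω] {P : Measure Ω} [IsProbabilityMeasure P] {d : ℕ}
variable {U : E d → PSpace d 2 → ℝ} {DmU : E d → PSpace d 2 → E d → E d}
  {DymU DxmU : E d → PSpace d 2 → E d → E d →L[ℝ] E d}
  {DmmU : E d → PSpace d 2 → E d → E d → E d →L[ℝ] E d}

lemma pure_le_wnhds (m : PSpace d 2) : pure m ≤ wnhds m := by
  have hid : Measurable fun x : E d => (x, x) := measurable_id.prodMk measurable_id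
  have h : Tendsto (fun _ : Unit => m) (pure ()) (wnhds m) :=
    tendsto_wnhds_of_coupling two_ne_zero (fun _ => 0) tendsto_const_nhds
      (Eventually.of_forall fun _ => ⟨m.toMeasure.map fun x => (x, x), by
        rw [Measure.map_map measurable_fst hid]; exact Measure.map_id, by
        rw [Measure.map_map measurable_snd hid]; exact Measure.map_id, by
        rw [lintegral_map (by fun_prop) hid]; simp⟩)
  rwa [Tendsto, map_pure] at h

lemma one_add_mul_le {C : ℝ} (hC : 0 ≤ C) (a : ℝ) : C * (1 + a) ≤ 2 * C * (1 + a ^ 2) := by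
  have : 1 + a ≤ 2 * (1 + a ^ 2) := by nlinarith [sq_nonneg (a - 1), sq_nonneg a]
  calc C * (1 + a) ≤ C * (2 * (1 + a ^ 2)) := by gcongr
    _ = _ := by ring

/-- Functions `f(x, m, y)` whose integral in `y` against `m` depends continuously on `(x, m)`: they
are continuous and, locally uniformly in `(x, m)`, have at most quadratic growth in `y`. -/
structure QuadIntegrand (f : E d → PSpace d 2 → E d → ℝ) : Prop where
  tendsto : ∀ x m y, Tendsto (fun q : (E d × PSpace d 2) × E d => f q.1.1 q.1.2 q.2)
    ((𝓝 x ×ˢ wnhds m) ×ˢ 𝓝 y) (𝓝 (f x m y))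
  growth : ∀ x m, ∃ C : ℝ, ∀ᶠ q : E d × PSpace d 2 in 𝓝 x ×ˢ wnhds m, ∀ y,
    |f q.1 q.2 y| ≤ C * (1 + ‖y‖ ^ 2)

lemma pure_le_nhds_prod_wnhds (x : E d) (m : PSpace d 2) : pure (x, m) ≤ 𝓝 x ×ˢ wnhds m := by
  rw [← prod_pure_pure]
  exact Filter.prod_mono (pure_le_nhds x) (pure_le_wnhds m)

lemma nhds_prod_wnhds_le (x : E d) (m : PSpace d 2) : 𝓝 x ×ˢ wnhds m ≤ 𝓝 (x, m) := by
  rw [nhds_prod_eq]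
  exact Filter.prod_mono le_rfl (wnhds_le_nhds m)

lemma tendsto_of_continuous {f : E d → PSpace d 2 → E d → ℝ}
    (hf : Continuous fun q : E d × PSpace d 2 × E d => f q.1 q.2.1 q.2.2) (x : E d)
    (m : PSpace d 2) (y : E d) :
    Tendsto (fun q : (E d × PSpace d 2) × E d => f q.1.1 q.1.2 q.2)
      ((𝓝 x ×ˢ wnhds m) ×ˢ 𝓝 y) (𝓝 (f x m y)) := by
  have hc : Continuous fun q : (E d × PSpace d 2) × E d => f q.1.1 q.1.2 q.2 :=
    hf.comp (by fun_prop : Continuous fun q : (E d × PSpace d 2) × E d => (q.1.1, q.1.2, q.2))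
  have hle : (𝓝 x ×ˢ wnhds m) ×ˢ 𝓝 y ≤ 𝓝 ((x, m), y) := by
    rw [nhds_prod_eq (x := (x, m))]
    exact Filter.prod_mono (nhds_prod_wnhds_le x m) le_rfl
  exact (hc.tendsto ((x, m), y)).mono_left hle

namespace QuadIntegrand

variable {f : E d → PSpace d 2 → E d → ℝ}

lemma continuous (hf : QuadIntegrand f) (x : E d) (m : PSpace d 2) : Continuous (f x m) := by
  refine continuous_iff_continuousAt.2 fun y => (hf.tendsto x m y).comp (f := fun y => ((x, m), y))
    (Tendsto.prodMk ?_ tendsto_id)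
  exact tendsto_const_pure.mono_right (pure_le_nhds_prod_wnhds x m)

lemma exists_bound (hf : QuadIntegrand f) (x : E d) (m : PSpace d 2) :
    ∃ C : ℝ, ∀ y, |f x m y| ≤ C * (1 + ‖y‖ ^ 2) := by
  obtain ⟨C, hC⟩ := hf.growth x m
  exact ⟨C, pure_le_nhds_prod_wnhds x m hC⟩

lemma integrable (hf : QuadIntegrand f) (x : E d) (m : PSpace d 2) :
    Integrable (f x m) m.toMeasure := by
  obtain ⟨C, hC⟩ := hf.exists_bound x m
  exact m.integrable_of_growth (hf.continuous x m) hC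

lemma tendsto_integral (hf : QuadIntegrand f) (x : E d) (m : PSpace d 2) :
    Tendsto (fun q : E d × PSpace d 2 => ∫ y, f q.1 q.2 y ∂q.2.toMeasure) (𝓝 x ×ˢ wnhds m)
      (𝓝 (∫ y, f x m y ∂m.toMeasure)) := by
  obtain ⟨C, hC⟩ := hf.growth x m
  exact tendsto_integral_of_tendsto_wnhds (μ := Prod.snd) (f := fun q y => f q.1 q.2 y)
    tendsto_snd (hf.continuous x m)
    (Eventually.of_forall fun q => hf.continuous q.1 q.2) (hf.tendsto x m) hC
    (pure_le_nhds_prod_wnhds x m hC)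

end QuadIntegrand

/-- The trace as a bounded linear form. -/
noncomputable def trL (d : ℕ) : (E d →L[ℝ] E d) →L[ℝ] ℝ :=
  LinearMap.toContinuousLinearMap
    ((LinearMap.trace ℝ (E d)).comp (ContinuousLinearMap.coeLM ℝ))

lemma trL_apply (A : E d →L[ℝ] E d) : trL d A = tr A := rfl

lemma abs_tr_le (A : E d →L[ℝ] E d) : |tr A| ≤ ‖trL d‖ * ‖A‖ := (trL d).le_opNorm A

lemma continuous_tr : Continuous (tr : (E d →L[ℝ] E d) → ℝ) := (trL d).continuous

lemma HasContDerivs.exists_growth (hU : HasContDerivs P U DmU DymU DxmU DmmU) (x : E d)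
    (m : PSpace d 2) : ∃ C : ℝ, 0 ≤ C ∧ ∀ᶠ q : E d × PSpace d 2 in 𝓝 x ×ˢ wnhds m, ∀ y y' : E d,
    ‖DmU q.1 q.2 y‖ ≤ C * (1 + ‖y‖) ∧
    ‖DymU q.1 q.2 y‖ ≤ C * (1 + ‖y‖ ^ 2) ∧
    ‖DxmU q.1 q.2 y‖ ≤ C * (1 + ‖y‖) ∧
    ‖DmmU q.1 q.2 y y'‖ ≤ C * (1 + ‖y‖) * (1 + ‖y'‖) := by
  obtain ⟨C, hC⟩ := hU.growth x m
  have h0 := (hC.self_of_nhds 0 0).1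
  rw [norm_zero, add_zero, mul_one] at h0
  exact ⟨C, (norm_nonneg _).trans h0, nhds_prod_wnhds_le x m hC⟩

lemma HasContDerivs.quadIntegrand_ym (hU : HasContDerivs P U DmU DymU DxmU DmmU) :
    QuadIntegrand fun x m y => tr (DymU x m y) := by
  refine ⟨tendsto_of_continuous (continuous_tr.comp hU.cont_Dym), fun x m => ?_⟩
  obtain ⟨C, -, hC⟩ := hU.exists_growth x m
  refine ⟨‖trL d‖ * C, hC.mono fun q hq y => (abs_tr_le _).trans ?_⟩
  rw [mul_assoc]
  gcongr
  exact (hq y 0).2.1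

lemma HasContDerivs.quadIntegrand_xm (hU : HasContDerivs P U DmU DymU DxmU DmmU) :
    QuadIntegrand fun x m y => tr (DxmU x m y) := by
  refine ⟨tendsto_of_continuous (continuous_tr.comp hU.cont_Dxm), fun x m => ?_⟩
  obtain ⟨C, hC0, hC⟩ := hU.exists_growth x m
  refine ⟨‖trL d‖ * (2 * C), hC.mono fun q hq y => (abs_tr_le _).trans ?_⟩
  rw [mul_assoc]
  gcongr
  exact (hq y 0).2.2.1.trans (one_add_mul_le hC0 _)

/-- The inner integral of the second Lions derivative, as a function of `(x, m, y)`. -/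
lemma HasContDerivs.tendsto_integral_mm (hU : HasContDerivs P U DmU DymU DxmU DmmU) (x : E d)
    (m : PSpace d 2) (y : E d) :
    Tendsto (fun q : (E d × PSpace d 2) × E d => ∫ y', tr (DmmU q.1.1 q.1.2 q.2 y')
      ∂q.1.2.toMeasure) ((𝓝 x ×ˢ wnhds m) ×ˢ 𝓝 y)
      (𝓝 (∫ y', tr (DmmU x m y y') ∂m.toMeasure)) := by
  obtain ⟨C, hC0, hC⟩ := hU.exists_growth x m
  have hc : Continuous fun q : ((E d × PSpace d 2) × E d) × E d =>
      tr (DmmU q.1.1.1 q.1.1.2 q.1.2 q.2) :=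
    continuous_tr.comp (hU.cont_Dmm.comp (by fun_prop : Continuous
      fun q : ((E d × PSpace d 2) × E d) × E d => (q.1.1.1, q.1.1.2, q.1.2, q.2)))
  have hle : (𝓝 x ×ˢ wnhds m) ×ˢ 𝓝 y ≤ 𝓝 ((x, m), y) := by
    rw [nhds_prod_eq (x := (x, m))]
    exact Filter.prod_mono (nhds_prod_wnhds_le x m) le_rfl
  have hb : ∀ (q : E d × PSpace d 2) (z : E d), ‖z‖ ≤ ‖y‖ + 1 → (∀ y', ‖DmmU q.1 q.2 z y'‖ ≤
      C * (1 + ‖z‖) * (1 + ‖y'‖)) → ∀ y', |tr (DmmU q.1 q.2 z y')| ≤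
      ‖trL d‖ * (2 * (C * (1 + (‖y‖ + 1)))) * (1 + ‖y'‖ ^ 2) := by
    intro q z hz h y'
    refine (abs_tr_le _).trans ?_
    rw [mul_assoc]
    gcongr
    refine (h y').trans ((one_add_mul_le (by positivity) _).trans ?_)
    gcongr
  refine tendsto_integral_of_tendsto_wnhds (μ := fun q : (E d × PSpace d 2) × E d => q.1.2)
    (f := fun q y' => tr (DmmU q.1.1 q.1.2 q.2 y')) (tendsto_snd.comp tendsto_fst)
    (hc.comp (by fun_prop : Continuous fun y' : E d => (((x, m), y), y')))
    (Eventually.of_forall fun q => hc.comp (by fun_prop : Continuous fun y' : E d => (q, y')))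
    (fun y' => ?_) (C := ‖trL d‖ * (2 * (C * (1 + (‖y‖ + 1))))) ?_ ?_
  · refine (hc.tendsto (((x, m), y), y')).mono_left ?_
    rw [nhds_prod_eq (x := ((x, m), y))]
    exact Filter.prod_mono hle le_rfl
  · have h1 : ∀ᶠ z in 𝓝 y, ‖z‖ ≤ ‖y‖ + 1 :=
      (continuous_norm.tendsto y).eventually (ge_mem_nhds (by linarith))
    filter_upwards [hC.prod_mk h1] with q hq
    exact hb q.1 q.2 hq.2 fun y' => (hq.1 q.2 y').2.2.2
  · exact hb (x, m) y (by linarith) fun y' => (pure_le_nhds_prod_wnhds x m hC y y').2.2.2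

lemma HasContDerivs.quadIntegrand_mm (hU : HasContDerivs P U DmU DymU DxmU DmmU) :
    QuadIntegrand fun x m y => ∫ y', tr (DmmU x m y y') ∂m.toMeasure := by
  refine ⟨hU.tendsto_integral_mm, fun x m => ?_⟩
  obtain ⟨C, hC0, hC⟩ := hU.exists_growth x m
  have hc1 : Continuous fun y : E d => 1 + ‖y‖ := by fun_prop
  have hb1 : ∀ y : E d, |1 + ‖y‖| ≤ 2 * (1 + ‖y‖ ^ 2) := fun y => by
    rw [abs_of_nonneg (by positivity)]
    simpa using one_add_mul_le zero_le_one ‖y‖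
  have ht : Tendsto (fun m' : PSpace d 2 => ∫ y, (1 + ‖y‖) ∂m'.toMeasure) (wnhds m)
      (𝓝 (∫ y, (1 + ‖y‖) ∂m.toMeasure)) :=
    tendsto_integral_of_tendsto_wnhds (f := fun _ y => 1 + ‖y‖) tendsto_id hc1
      (Eventually.of_forall fun _ => hc1) (fun y => (hc1.tendsto y).comp tendsto_snd)
      (Eventually.of_forall fun _ => hb1) hb1
  set M := ∫ y, (1 + ‖y‖) ∂m.toMeasure + 1
  have hM : ∀ᶠ q : E d × PSpace d 2 in 𝓝 x ×ˢ wnhds m, ∫ y, (1 + ‖y‖) ∂q.2.toMeasure ≤ M :=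
    tendsto_snd.eventually (ht.eventually (ge_mem_nhds (by simp [M])))
  refine ⟨2 * (‖trL d‖ * C * M), ?_⟩
  filter_upwards [hC, hM] with q hq hqM y
  have hM0 : 0 ≤ M := (integral_nonneg fun y => by positivity).trans hqM
  have h1 : |∫ y', tr (DmmU q.1 q.2 y y') ∂q.2.toMeasure| ≤
      ‖trL d‖ * C * (1 + ‖y‖) * ∫ y', (1 + ‖y'‖) ∂q.2.toMeasure := by
    rw [← integral_const_mul, ← Real.norm_eq_abs]
    refine norm_integral_le_of_norm_le ((q.2.integrable_of_growth hc1 hb1).const_mul _)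
      (Eventually.of_forall fun y' => (abs_tr_le _).trans ?_)
    rw [mul_assoc, mul_assoc, ← mul_assoc C]
    gcongr
    exact (hq y y').2.2.2
  calc _ ≤ ‖trL d‖ * C * (1 + ‖y‖) * M := h1.trans (by gcongr)
    _ = (‖trL d‖ * C * M) * (1 + ‖y‖) := by ring
    _ ≤ _ := one_add_mul_le (by positivity) _

lemma continuous_Dp {H : E d → E d → ℝ} (hH : ContDiff ℝ 1 fun z : E d × E d => H z.1 z.2) :
    Continuous fun z : E d × E d => Dp H z.1 z.2 := by
  have h1 : ∀ p x, fderiv ℝ (fun p' => H p' x) p =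
      (fderiv ℝ (fun z : E d × E d => H z.1 z.2) (p, x)).comp
        (ContinuousLinearMap.inl ℝ (E d) (E d)) := fun p x => by
    have h := ((hH.differentiable (by norm_num)) (p, x)).hasFDerivAt.comp (f := fun p' => (p', x)) p
      (hasFDerivAt_prodMk_left p x)
    exact h.fderiv
  have h2 : Continuous fun z : E d × E d => (fderiv ℝ (fun z : E d × E d => H z.1 z.2) z).comp
      (ContinuousLinearMap.inl ℝ (E d) (E d)) :=
    (hH.continuous_fderiv (by norm_num)).clm_comp continuous_const
  simp only [Dp, gradient, h1]
  exact (InnerProductSpace.toDual ℝ (E d)).symm.continuous.comp h2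

lemma HasContDerivs.quadIntegrand_drift (hU : HasContDerivs P U DmU DymU DxmU DmmU)
    {H : E d → E d → ℝ} (hH : ContDiff ℝ 1 fun z : E d × E d => H z.1 z.2)
    (hDpH : ∀ r : ℝ, ∃ C : ℝ, ∀ p x : E d, ‖p‖ ≤ r → ‖Dp H p x‖ ≤ C * (1 + ‖x‖))
    {L : NNReal} (hL : ∀ m, LipschitzWith L fun x => U x m) :
    QuadIntegrand fun x m y => inner ℝ (DmU x m y) (Dp H (Dx U y m) y) := by
  refine ⟨tendsto_of_continuous ?_, fun x m => ?_⟩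
  · have h1 : Continuous fun q : E d × PSpace d 2 × E d => Dx U q.2.2 q.2.1 :=
      hU.cont_Dx.comp (by fun_prop : Continuous fun q : E d × PSpace d 2 × E d => (q.2.2, q.2.1))
    exact hU.cont_Dm.inner ((continuous_Dp hH).comp
      (h1.prodMk (by fun_prop : Continuous fun q : E d × PSpace d 2 × E d => q.2.2)))
  · obtain ⟨C, hC0, hC⟩ := hU.exists_growth x m
    obtain ⟨C', hC'⟩ := hDpH L
    have hC'0 : 0 ≤ C' := by
      have := (norm_nonneg _).trans (hC' 0 0 (by simp))
      simpa using this
    refine ⟨2 * (C * C'), hC.mono fun q hq y => ?_⟩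
    calc |(inner ℝ (DmU q.1 q.2 y) (Dp H (Dx U y q.2) y) : ℝ)| ≤
        ‖DmU q.1 q.2 y‖ * ‖Dp H (Dx U y q.2) y‖ := abs_real_inner_le_norm _ _
      _ ≤ (C * (1 + ‖y‖)) * (C' * (1 + ‖y‖)) := by
        gcongr
        · exact (hq y 0).1
        · exact hC' _ _ (norm_Dx_le_of_lipschitz (hL _) _)
      _ = (C * C') * (1 + ‖y‖) ^ 2 := by ring
      _ ≤ (C * C') * (2 * (1 + ‖y‖ ^ 2)) := by
        gcongr
        nlinarith [sq_nonneg (‖y‖ - 1)]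
      _ = _ := by ring

/-- The left-hand side of the master equation minus `F`, with the second-order terms written as a
trace of iterated derivatives and of iterated integrals. -/
noncomputable def eqResidual (β : ℝ) (H : E d → E d → ℝ) (F : E d → PSpace d 1 → ℝ)
    (U : E d → PSpace d 2 → ℝ) (DmU : E d → PSpace d 2 → E d → E d)
    (DymU DxmU : E d → PSpace d 2 → E d → E d →L[ℝ] E d)
    (DmmU : E d → PSpace d 2 → E d → E d → E d →L[ℝ] E d) (x : E d) (m : PSpace d 2) : ℝ :=
  U x m - β * tr (fderiv ℝ (fun x' => Dx U x' m) x) + H (Dx U x m) x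
    + ∫ y, inner ℝ (DmU x m y) (Dp H (Dx U y m) y) ∂m.toMeasure
    - β * (∫ y, tr (DymU x m y) ∂m.toMeasure + 2 * ∫ y, tr (DxmU x m y) ∂m.toMeasure
      + ∫ y, ∫ y', tr (DmmU x m y y') ∂m.toMeasure ∂m.toMeasure)
    - F x m.toP1

lemma HasContDerivs.tendsto_residual (hU : HasContDerivs P U DmU DymU DxmU DmmU) (β : ℝ)
    {H : E d → E d → ℝ} (hH : ContDiff ℝ 1 fun z : E d × E d => H z.1 z.2)
    (hDpH : ∀ r : ℝ, ∃ C : ℝ, ∀ p x : E d, ‖p‖ ≤ r → ‖Dp H p x‖ ≤ C * (1 + ‖x‖))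
    {F : E d → PSpace d 1 → ℝ} (hF : Continuous fun q : E d × PSpace d 1 => F q.1 q.2)
    {L : NNReal} (hL : ∀ m, LipschitzWith L fun x => U x m) (x : E d) (m : PSpace d 2) :
    Tendsto (fun q : E d × PSpace d 2 => eqResidual β H F U DmU DymU DxmU DmmU q.1 q.2)
      (𝓝 x ×ˢ wnhds m) (𝓝 (eqResidual β H F U DmU DymU DxmU DmmU x m)) := by
  have hle := nhds_prod_wnhds_le x m
  have t1 := (hU.cont_U.tendsto (x, m)).mono_left hle
  have t2 := ((continuous_tr.comp hU.cont_Dxx).tendsto (x, m)).mono_left hle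
  have t3 := ((hH.continuous.comp (hU.cont_Dx.prodMk _root_.continuous_fst)).tendsto (x, m)).mono_left hle
  have t4 : Tendsto (fun q : E d × PSpace d 2 => F q.1 q.2.toP1) (𝓝 x ×ˢ wnhds m)
      (𝓝 (F x m.toP1)) := by
    refine (hF.tendsto (x, m.toP1)).comp (f := fun q : E d × PSpace d 2 => (q.1, q.2.toP1)) ?_
    rw [nhds_prod_eq]
    exact tendsto_fst.prodMk (((tendsto_toP1 m).mono_right (wnhds_le_nhds _)).comp tendsto_snd)
  have t5 := (hU.quadIntegrand_drift hH hDpH hL).tendsto_integral x m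
  have t6 := hU.quadIntegrand_ym.tendsto_integral x m
  have t7 := hU.quadIntegrand_xm.tendsto_integral x m
  have t8 := hU.quadIntegrand_mm.tendsto_integral x m
  exact ((((t1.sub (t2.const_mul β)).add t3).add t5).sub
    (((t6.add (t7.const_mul 2)).add t8).const_mul β)).sub t4

lemma HasContDerivs.laplacian_eq_tr (hU : HasContDerivs P U DmU DymU DxmU DmmU) (x : E d)
    (m : PSpace d 2) :
    Laplacian.laplacian (fun x' => U x' m) x = tr (fderiv ℝ (fun x' => Dx U x' m) x) := by
  rw [InnerProductSpace.laplacian_eq_iteratedFDeriv_orthonormalBasis _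
    (EuclideanSpace.basisFun (Fin d) ℝ), tr,
    LinearMap.trace_eq_sum_inner _ (EuclideanSpace.basisFun (Fin d) ℝ)]
  refine Finset.sum_congr rfl fun k _ => ?_
  set e := EuclideanSpace.basisFun (Fin d) ℝ k
  have h1 : DifferentiableAt ℝ (fderiv ℝ fun x' => U x' m) x :=
    ((hU.contDiff_x m).fderiv_right (m := 1) (by norm_num)).differentiable (by norm_num) x
  have h2 : ∀ x', (inner ℝ e (Dx U x' m) : ℝ) = fderiv ℝ (fun x' => U x' m) x' e := fun x' => by
    rw [real_inner_comm, Dx, gradient, InnerProductSpace.toDual_symm_apply]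
  have h3 := (innerSL ℝ e).hasFDerivAt.comp x (hU.hasFDerivAt_Dx x m)
  have h4 : HasFDerivAt (fun x' => fderiv ℝ (fun x' => U x' m) x' e) _ x :=
    (ContinuousLinearMap.apply ℝ ℝ e).hasFDerivAt.comp x h1.hasFDerivAt
  have h5 : (innerSL ℝ e ∘ fun x' => Dx U x' m) = fun x' => fderiv ℝ (fun x' => U x' m) x' e :=
    funext h2
  rw [h5] at h3
  rw [iteratedFDeriv_two_apply]
  exact (DFunLike.congr_fun (h4.unique h3) e)

lemma HasContDerivs.integrable_mm_prod (hU : HasContDerivs P U DmU DymU DxmU DmmU) (x : E d)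
    (m : PSpace d 2) : Integrable (fun z : E d × E d => tr (DmmU x m z.1 z.2))
    (m.toMeasure.prod m.toMeasure) := by
  have := m.isProb
  obtain ⟨C, hC0, hC⟩ := hU.exists_growth x m
  have hC' := pure_le_nhds_prod_wnhds x m hC
  have hc : Continuous fun z : E d × E d => tr (DmmU x m z.1 z.2) :=
    continuous_tr.comp (hU.cont_Dmm.comp (by fun_prop : Continuous
      fun z : E d × E d => (x, m, z.1, z.2)))
  have h1 : Integrable (fun y : E d => 1 + ‖y‖) m.toMeasure := by
    refine m.integrable_of_growth (by fun_prop) (C := 2) fun y => ?_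
    rw [abs_of_nonneg (by positivity)]
    simpa using one_add_mul_le zero_le_one ‖y‖
  refine ((h1.mul_prod h1).const_mul (‖trL d‖ * C)).mono' hc.aestronglyMeasurable
    (Eventually.of_forall fun z => (abs_tr_le _).trans ?_)
  rw [mul_assoc]
  gcongr
  rw [← mul_assoc]
  exact (hC' z.1 z.2).2.2.2

end Residual

/-! ### Independence of the residual of the space variable -/

section Conclusion

variable {Ω : Type*} [MeasurableSpace Ω] {P : Measure Ω} [IsProbabilityMeasure P] {d : ℕ}
variable {U : E d → PSpace d 2 → ℝ} {DmU : E d → PSpace d 2 → E d → E d}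
  {DymU DxmU : E d → PSpace d 2 → E d → E d →L[ℝ] E d}
  {DmmU : E d → PSpace d 2 → E d → E d → E d →L[ℝ] E d}

lemma integral_law (X : L2 P d) {G : Type*} [NormedAddCommGroup G] [NormedSpace ℝ G]
    {f : E d → G} (hf : StronglyMeasurable f) :
    ∫ y, f y ∂(law X).toMeasure = ∫ ω, f (X ω) ∂P :=
  integral_map (measurable_coe_L2 X).aemeasurable hf.aestronglyMeasurable

lemma integrable_comp_of_ae_bound {f : E d → ℝ} (hf : Continuous f) {ξ : L2 P d} {R : ℝ}
    (hξ : ∀ᵐ ω ∂P, ‖ξ ω‖ ≤ R) : Integrable (fun ω => f (ξ ω)) P := by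
  obtain ⟨K, hK⟩ := (isCompact_closedBall (0 : E d) R).exists_bound_of_continuousOn hf.continuousOn
  exact Integrable.of_bound (hf.measurable.comp (measurable_coe_L2 ξ)).aestronglyMeasurable K
    (hξ.mono fun ω hω => hK _ (by simpa using hω))

lemma tr_integral {α : Type*} [MeasurableSpace α] {μ : Measure α} {A : α → E d →L[ℝ] E d}
    (hA : Integrable A μ) : tr (∫ a, A a ∂μ) = ∫ a, tr (A a) ∂μ :=
  ((trL d).integral_comp_comm hA).symm

/-- At bounded random variables, the second-order terms of the equation are the trace of the second
derivative of `U` along joint translations of `x` and the law. -/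
lemma HasContDerivs.tr_translationHessian (hU : HasContDerivs P U DmU DymU DxmU DmmU)
    (X₀ : L2 P d) {R₀ : ℝ} (hX₀ : ∀ᵐ ω ∂P, ‖X₀ ω‖ ≤ R₀) (x : E d) :
    tr (translationHessian U DymU DxmU DmmU X₀ x) =
      tr (fderiv ℝ (fun x' => Dx U x' (law X₀)) x) +
      (∫ y, tr (DymU x (law X₀) y) ∂(law X₀).toMeasure +
        2 * ∫ y, tr (DxmU x (law X₀) y) ∂(law X₀).toMeasure +
        ∫ y, ∫ y', tr (DmmU x (law X₀) y y') ∂(law X₀).toMeasure ∂(law X₀).toMeasure) := by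
  have hX := measurable_coe_L2 X₀
  have cy : Continuous fun y => DymU x (law X₀) y :=
    hU.cont_Dym.comp (by fun_prop : Continuous fun y : E d => (x, law X₀, y))
  have cx : Continuous fun y => DxmU x (law X₀) y :=
    hU.cont_Dxm.comp (by fun_prop : Continuous fun y : E d => (x, law X₀, y))
  have cm : ∀ y, Continuous fun y' => DmmU x (law X₀) y y' := fun y =>
    hU.cont_Dmm.comp (by fun_prop : Continuous fun y' : E d => (x, law X₀, y, y'))
  obtain ⟨C, r, hB⟩ := hU.exists_growthBound X₀ ‖x‖
  have hC := hB.nonneg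
  have hr : ‖X₀ - X₀‖ ≤ r := by simpa using hB.pos.le
  have iy : Integrable (fun ω => DymU x (law X₀) (X₀ ω)) P :=
    Integrable.of_bound (cy.comp_aestronglyMeasurable hX.aestronglyMeasurable) (C * (1 + R₀ ^ 2))
      (hX₀.mono fun ω hω => (hB.dym x le_rfl X₀ hr _).trans (by gcongr))
  have ix : Integrable (fun ω => DxmU x (law X₀) (X₀ ω)) P :=
    Integrable.of_bound (cx.comp_aestronglyMeasurable hX.aestronglyMeasurable) (C * (1 + R₀))
      (hX₀.mono fun ω hω => (hB.dxm x le_rfl X₀ hr _).trans (by gcongr))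
  have im : ∀ y, Integrable (fun ω => DmmU x (law X₀) y (X₀ ω)) P := hU.integrable_DmmU x X₀
  have imm : Integrable (fun ω => ∫ ω', DmmU x (law X₀) (X₀ ω) (X₀ ω') ∂P) P := by
    refine Integrable.of_bound ((hU.stronglyMeasurable_integral_DmmU X₀).comp_measurable
      (measurable_const.prodMk hX)).aestronglyMeasurable (C * (1 + R₀) * (1 + R₀))
      (hX₀.mono fun ω hω => ?_)
    have hR₀ : 0 ≤ R₀ := (norm_nonneg _).trans hω
    refine (norm_integral_le_of_norm_le_const (C := C * (1 + R₀) * (1 + R₀)) ?_).trans_eq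
      (by simp)
    filter_upwards [hX₀] with ω' hω'
    exact (hB.dmm x le_rfl X₀ hr _ _).trans (by gcongr)
  have e4 : ∀ y, ∫ ω', tr (DmmU x (law X₀) y (X₀ ω')) ∂P =
      ∫ y', tr (DmmU x (law X₀) y y') ∂(law X₀).toMeasure := fun y =>
    (integral_law X₀ (continuous_tr.comp (cm y)).stronglyMeasurable).symm
  rw [integral_law X₀ (f := fun y => tr (DymU x (law X₀) y))
      (continuous_tr.comp cy).stronglyMeasurable,
    integral_law X₀ (f := fun y => tr (DxmU x (law X₀) y))
      (continuous_tr.comp cx).stronglyMeasurable,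
    integral_law X₀ (hU.quadIntegrand_mm.continuous x (law X₀)).stronglyMeasurable,
    translationHessian]
  have h1 : ∀ A B : E d →L[ℝ] E d, tr (A + B) = tr A + tr B := (trL d).map_add
  have h2 : ∀ (a : ℝ) (A : E d →L[ℝ] E d), tr (a • A) = a * tr A := (trL d).map_smul
  rw [h1, h1, h2, tr_integral ix, integral_add iy imm, h1, tr_integral iy, tr_integral imm]
  simp only [tr_integral (im _), e4]
  ring

/-- The weak inequality, tested with the explicit elements of the subdifferential, in the limit of
vanishing `ε`: the residual, averaged over the law of `X₀`, dominates its average over any other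
bounded random variable. -/
lemma integral_residual_le (hU : HasContDerivs P U DmU DymU DxmU DmmU) {β : ℝ}
    {H : E d → E d → ℝ} (hH : ContDiff ℝ 1 fun z : E d × E d => H z.1 z.2)
    {F : E d → PSpace d 1 → ℝ} (hF : Continuous fun q : E d × PSpace d 1 => F q.1 q.2)
    (hweak : IsWeakSolution P β H F U) {s : Finset (E d)} {w : E d → ENNReal} {r : ℝ} (hr : 0 < r)
    (hw : ∑ i ∈ s, w i = 1) {X₀ : L2 P d} (hX₀ : (law X₀).toMeasure = ballMixture s w r)
    (η : L2 P d) {R : ℝ} (hη : ∀ᵐ ω ∂P, ‖η ω‖ ≤ R) :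
    ∫ ω, eqResidual β H F U DmU DymU DxmU DmmU (η ω) (law X₀) ∂P ≤
      ∫ ω, eqResidual β H F U DmU DymU DxmU DmmU (X₀ ω) (law X₀) ∂P := by
  obtain ⟨CU, hCU⟩ := hweak.bounded
  obtain ⟨L, hL⟩ := hweak.lipschitz
  obtain ⟨C, hC, hineq⟩ := hweak.subjet_ineq
  have hXm := measurable_coe_L2 X₀
  obtain ⟨R₀, hR₀⟩ : ∃ R₀ : ℝ, ∀ᵐ ω ∂P, ‖X₀ ω‖ ≤ R₀ := by
    obtain ⟨R₀, h⟩ := ae_norm_le_ballMixture (s := s) (w := w) (r := r)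
    rw [← hX₀] at h
    exact ⟨R₀, ae_of_ae_map hXm.aemeasurable h⟩
  have cDx := hU.continuous_Dx (law X₀)
  have cH : Continuous fun x => H (Dx U x (law X₀)) x := hH.continuous.comp (cDx.prodMk continuous_id)
  have cF : Continuous fun x => F x (law X₀).toP1 := 
    hF.comp (continuous_id.prodMk continuous_const)
  have cDp : Continuous fun x => Dp H (Dx U x (law X₀)) x :=
    (continuous_Dp hH).comp (cDx.prodMk continuous_id)
  have exV : ∀ ξ : L2 P d, ∃ V : L2 P d, V =ᵐ[P] fun ω => Dx U (ξ ω) (law X₀) := fun ξ =>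
    exists_L2_of_bound (cDx.measurable.comp (measurable_coe_L2 ξ)).aestronglyMeasurable
      (Eventually.of_forall fun _ => norm_Dx_le_of_lipschitz (hL _) _)
  obtain ⟨V, hV⟩ := exV X₀
  obtain ⟨V', hV'⟩ := exV η
  obtain ⟨G, -, hG⟩ := hU.exists_inner_eq_integral_lawDeriv X₀ X₀ hR₀ hR₀
  obtain ⟨G', -, hG'⟩ := hU.exists_inner_eq_integral_lawDeriv X₀ η hR₀ hη
  obtain ⟨D, K, hK, -, hD⟩ := exists_densNorm_lower_bound (P := P) hX₀
  obtain ⟨Z, hZ⟩ : ∃ Z : L2 P d, Z =ᵐ[P] fun ω => Dp H (Dx U (X₀ ω) (law X₀)) (X₀ ω) := by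
    obtain ⟨M, hM⟩ := (isCompact_closedBall (0 : E d) R₀).exists_bound_of_continuousOn
      cDp.continuousOn
    exact exists_L2_of_bound (cDp.measurable.comp hXm).aestronglyMeasurable
      (hR₀.mono fun ω hω => hM _ (by simpa using hω))
  have hres : ∀ x, eqResidual β H F U DmU DymU DxmU DmmU x (law X₀) =
      U x (law X₀) - β * tr (translationHessian U DymU DxmU DmmU X₀ x) + H (Dx U x (law X₀)) x
        + lawDeriv DmU X₀ x Z - F x (law X₀).toP1 := by
    intro x
    have h1 : ∫ y, inner ℝ (DmU x (law X₀) y) (Dp H (Dx U y (law X₀)) y) ∂(law X₀).toMeasure =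
        lawDeriv DmU X₀ x Z := by
      rw [integral_law X₀ ((hU.continuous_DmU x (law X₀)).inner cDp).stronglyMeasurable, lawDeriv]
      refine integral_congr_ae ?_
      filter_upwards [hZ] with ω hω
      rw [hω]
    rw [eqResidual, hU.tr_translationHessian X₀ hR₀, h1]
    ring
  have hint : ∀ (ξ : L2 P d) (R' : ℝ), (∀ᵐ ω ∂P, ‖ξ ω‖ ≤ R') →
      ∫ ω, eqResidual β H F U DmU DymU DxmU DmmU (ξ ω) (law X₀) ∂P =
      ∫ ω, U (ξ ω) (law X₀) ∂P
        - β * tr (∫ ω, translationHessian U DymU DxmU DmmU X₀ (ξ ω) ∂P)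
        + ∫ ω, H (Dx U (ξ ω) (law X₀)) (ξ ω) ∂P + ∫ ω, lawDeriv DmU X₀ (ξ ω) Z ∂P
        - ∫ ω, F (ξ ω) (law X₀).toP1 ∂P := by
    intro ξ R' hξ
    have i0 := hU.integrable_translationHessian X₀ ξ hR₀ hξ
    have i1 := hU.integrable_U_comp hCU (law X₀) (measurable_coe_L2 ξ)
    have i2 : Integrable (fun ω => β * tr (translationHessian U DymU DxmU DmmU X₀ (ξ ω))) P :=
      ((trL d).integrable_comp i0).const_mul β
    have i3 := integrable_comp_of_ae_bound cH hξ
    have i4 := hU.integrable_lawDeriv X₀ ξ Z hξ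
    have i5 := integrable_comp_of_ae_bound cF hξ
    simp only [hres]
    rw [tr_integral i0, ← integral_const_mul]
    exact (integral_sub (((i1.sub i2).add i3).add i4) i5).trans (congrArg (· - _)
      ((integral_add ((i1.sub i2).add i3) i4).trans (congrArg (· + _)
        ((integral_add (i1.sub i2) i3).trans (congrArg (· + _) (integral_sub i1 i2))))))
  rw [hint X₀ R₀ hR₀, hint η R hη]
  set S := ∫ ω, translationHessian U DymU DxmU DmmU X₀ (X₀ ω) ∂P with hS
  set S' := ∫ ω, translationHessian U DymU DxmU DmmU X₀ (η ω) ∂P with hS'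
  have iF := (integrable_comp_of_ae_bound cF hR₀).sub (integrable_comp_of_ae_bound cF hη)
  have iU := hU.integrable_U_comp hCU (law X₀) hXm
  have iU' := hU.integrable_U_comp hCU (law X₀) (measurable_coe_L2 η)
  have hacX : X₀ ∈ LInftyAc P d := mem_LInftyAc_of_ballMixture hr hw hX₀
  have hV'neg : ∀ᵐ ω ∂P, H (-((-V' : L2 P d) ω)) (η ω) = H (Dx U (η ω) (law X₀)) (η ω) := by
    filter_upwards [hV', Lp.coeFn_neg V'] with ω h1 h2
    rw [h2, Pi.neg_apply, neg_neg, h1]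
  have iH : Integrable (fun ω => H (Dx U (X₀ ω) (law X₀)) (X₀ ω) - H (-((-V' : L2 P d) ω)) (η ω))
      P := by
    refine ((integrable_comp_of_ae_bound cH hR₀).sub (integrable_comp_of_ae_bound cH hη)).congr ?_
    filter_upwards [hV'neg] with ω h1
    rw [h1]; rfl
  have eH : ∫ ω, (H (Dx U (X₀ ω) (law X₀)) (X₀ ω) - H (-((-V' : L2 P d) ω)) (η ω)) ∂P =
      ∫ ω, H (Dx U (X₀ ω) (law X₀)) (X₀ ω) ∂P - ∫ ω, H (Dx U (η ω) (law X₀)) (η ω) ∂P := by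
    rw [← integral_sub (integrable_comp_of_ae_bound cH hR₀) (integrable_comp_of_ae_bound cH hη)]
    refine integral_congr_ae ?_
    filter_upwards [hV'neg] with ω h1
    rw [h1]
  have hdrift : ∀ p : L2 P d, (fun ω => (inner ℝ ((V - p : L2 P d) ω) (Z ω) : ℝ)) =ᵐ[P]
      fun ω => inner ℝ (Dx U (X₀ ω) (law X₀) - p ω) (Dp H (Dx U (X₀ ω) (law X₀)) (X₀ ω)) := by
    intro p
    filter_upwards [hV, hZ, Lp.coeFn_sub V p] with ω h1 h2 h3
    rw [h3, Pi.sub_apply, h1, h2]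
  set J := (∫ ω, U (X₀ ω) (law X₀) ∂P - β * tr S + ∫ ω, H (Dx U (X₀ ω) (law X₀)) (X₀ ω) ∂P
    + ∫ ω, lawDeriv DmU X₀ (X₀ ω) Z ∂P - ∫ ω, F (X₀ ω) (law X₀).toP1 ∂P) with hJ
  set J' := (∫ ω, U (η ω) (law X₀) ∂P - β * tr S' + ∫ ω, H (Dx U (η ω) (law X₀)) (η ω) ∂P
    + ∫ ω, lawDeriv DmU X₀ (η ω) Z ∂P - ∫ ω, F (η ω) (law X₀).toP1 ∂P) with hJ'
  have key : ∀ ε ∈ Ioo (0 : ℝ) 1, 0 ≤ J - J' +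
      ε * (β * (4 + 4 * K) * tr (ContinuousLinearMap.id ℝ (E d)) + inner ℝ D Z
        + C * (1 + densNorm X₀)) := by
    intro ε hε
    obtain ⟨b, hb⟩ := hU.exists_mem_subjet hCU hL X₀ η V G G' V' D hR₀ hη hV hV' hG hG' hD hK
      hε.1 hε.1.le
    have h := hineq X₀ hacX η ε hε _ _ _ 
      (subset_closedSubjet (x := WithLp.toLp 2 (X₀, η))
        (S := {z : L2Pair P d | z.fst ∈ LInftyAc P d}) hacX hb) iF iH
      ((L2.integrable_inner _ _).congr (hdrift _))
    have eD : ∫ ω, (inner ℝ (Dx U (X₀ ω) (law X₀) - (V + G - G' + ε • D : L2 P d) ω)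
        (Dp H (Dx U (X₀ ω) (law X₀)) (X₀ ω)) : ℝ) ∂P =
        -∫ ω, lawDeriv DmU X₀ (X₀ ω) Z ∂P + ∫ ω, lawDeriv DmU X₀ (η ω) Z ∂P
          - ε * inner ℝ D Z := by
      rw [← integral_congr_ae (hdrift _), ← L2.inner_def, ← hG, ← hG']
      have : V - (V + G - G' + ε • D) = -G + G' - ε • D := by abel
      rw [this, inner_sub_left, inner_add_left, inner_neg_left, real_inner_smul_left]
    have eF : ∫ ω, (F (X₀ ω) (law X₀).toP1 - F (η ω) (law X₀).toP1) ∂P =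
        ∫ ω, F (X₀ ω) (law X₀).toP1 ∂P - ∫ ω, F (η ω) (law X₀).toP1 ∂P :=
      integral_sub (integrable_comp_of_ae_bound cF hR₀) (integrable_comp_of_ae_bound cF hη)
    have eU : hatU U (WithLp.toLp 2 (X₀, η)) = ∫ ω, U (X₀ ω) (law X₀) ∂P -
        ∫ ω, U (η ω) (law X₀) ∂P := integral_sub iU iU'
    have eL : tr (S - S' - (4 * ε + 4 * ε * K) • ContinuousLinearMap.id ℝ (E d)) =
        tr S - tr S' - (4 * ε + 4 * ε * K) * tr (ContinuousLinearMap.id ℝ (E d)) := by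
      simp only [← trL_apply, map_sub, map_smul, smul_eq_mul]
    rw [Lam_meanForm, eD, eF, eU, eL, eH] at h
    rw [hJ, hJ']
    linarith
  have hlim : Tendsto (fun ε : ℝ => J - J' +
      ε * (β * (4 + 4 * K) * tr (ContinuousLinearMap.id ℝ (E d)) + inner ℝ D Z
        + C * (1 + densNorm X₀))) (𝓝[>] 0) (𝓝 (J - J')) := by
    have hc : Continuous fun ε : ℝ => J - J' +
      ε * (β * (4 + 4 * K) * tr (ContinuousLinearMap.id ℝ (E d)) + inner ℝ D Z
        + C * (1 + densNorm X₀)) := by fun_prop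
    simpa using (hc.tendsto 0).mono_left nhdsWithin_le_nhds
  have h0 := ge_of_tendsto hlim (b := 0) (by
    filter_upwards [Ioo_mem_nhdsGT (zero_lt_one' ℝ)] with ε hε using key ε hε)
  linarith

/-- The residual does not depend on `x`. It is maximal at almost every point of a nice law, hence at
the centres of the balls, and every law is a limit of nice laws with a ball centred at a given
point. -/
lemma residual_le (hP : Atomless P) (hU : HasContDerivs P U DmU DymU DxmU DmmU) {β : ℝ}
    {H : E d → E d → ℝ} (hH : ContDiff ℝ 1 fun z : E d × E d => H z.1 z.2)
    (hDpH : ∀ r : ℝ, ∃ C : ℝ, ∀ p x : E d, ‖p‖ ≤ r → ‖Dp H p x‖ ≤ C * (1 + ‖x‖))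
    {F : E d → PSpace d 1 → ℝ} (hF : Continuous fun q : E d × PSpace d 1 => F q.1 q.2)
    (hweak : IsWeakSolution P β H F U) (x y : E d) (m : PSpace d 2) :
    eqResidual β H F U DmU DymU DxmU DmmU y m ≤ eqResidual β H F U DmU DymU DxmU DmmU x m := by
  obtain ⟨L, hL⟩ := hweak.lipschitz
  have htend := hU.tendsto_residual β hH hDpH hF hL
  refine of_ballMixture (q := fun m => eqResidual β H F U DmU DymU DxmU DmmU y m ≤
    eqResidual β H F U DmU DymU DxmU DmmU x m) x (fun m μ hle hμ => ?_)
    (fun s w r hr hxs hwx hw m hm => ?_) m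
  · have ht : ∀ z, Tendsto (fun n => eqResidual β H F U DmU DymU DxmU DmmU z (μ n)) atTop
        (𝓝 (eqResidual β H F U DmU DymU DxmU DmmU z m)) := fun z =>
      (htend z m).comp (f := fun n => (z, μ n)) (tendsto_const_nhds.prodMk hμ)
    exact le_of_tendsto_of_tendsto' (ht y) (ht x) hle
  · obtain ⟨X₀, rfl⟩ := hP.exists_law_eq m
    have hcont : Continuous fun z => eqResidual β H F U DmU DymU DxmU DmmU z (law X₀) :=
      continuous_iff_continuousAt.2 fun z => (htend z (law X₀)).comp (f := fun z => (z, law X₀))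
        (tendsto_id.prodMk (tendsto_const_pure.mono_right (pure_le_wnhds _)))
    set ρ : E d → ℝ := fun z => eqResidual β H F U DmU DymU DxmU DmmU z (law X₀) with hρ
    have hle : ∀ z, ρ z ≤ ∫ ω, ρ (X₀ ω) ∂P := by
      intro z
      have hz : ∀ᵐ ω ∂P, (Lp.const 2 P z : L2 P d) ω = z := by
        filter_upwards [Lp.coeFn_const (p := 2) (μ := P) z] with ω e
        rw [e]; rfl
      have h := integral_residual_le hU hH hF hweak hr hw hm (Lp.const 2 P z) (R := ‖z‖)
        (hz.mono fun ω e => by rw [e])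
      refine le_trans (le_of_eq ?_) h
      rw [integral_congr_ae (g := fun _ => ρ z) (hz.mono fun ω e => by simp only [e, hρ])]
      simp
    have hint : Integrable (fun ω => ρ (X₀ ω)) P := by
      obtain ⟨R₀, h⟩ := ae_norm_le_ballMixture (s := s) (w := w) (r := r)
      rw [← hm] at h
      exact integrable_comp_of_ae_bound hcont
        (ae_of_ae_map (measurable_coe_L2 X₀).aemeasurable h)
    have hae : ∀ᵐ ω ∂P, ρ (X₀ ω) = ∫ ω, ρ (X₀ ω) ∂P := by
      have h0 : ∫ ω, (∫ ω, ρ (X₀ ω) ∂P - ρ (X₀ ω)) ∂P = 0 := by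
        rw [integral_sub (integrable_const _) hint]; simp
      rw [integral_eq_zero_iff_of_nonneg (fun ω => sub_nonneg.2 (hle _))
        ((integrable_const _).sub hint)] at h0
      filter_upwards [h0] with ω h1
      exact (sub_eq_zero.1 h1).symm
    have hae' : ∀ᵐ z ∂(ballMixture s w r), ρ z = ∫ ω, ρ (X₀ ω) ∂P := by
      rw [← hm]
      exact (ae_map_iff (measurable_coe_L2 X₀).aemeasurable
        (measurableSet_eq_fun hcont.measurable measurable_const)).2 hae
    exact (hle y).trans_eq (eq_of_ae_ballMixture hr hxs hwx hcont hae').symm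

end Conclusion

end MasterEq

open MasterEq in
theorem proposition3p2 {d : ℕ} {Ω : Type*} [MeasurableSpace Ω] (P : Measure Ω)
    [IsProbabilityMeasure P] (hP : Atomless P) (β : ℝ) (hβ : 0 ≤ β)
    (H : E d → E d → ℝ) (hH : ContDiff ℝ 1 fun z : E d × E d => H z.1 z.2)
    (hDpH : ∀ r : ℝ, ∃ C : ℝ, ∀ p x : E d, ‖p‖ ≤ r → ‖Dp H p x‖ ≤ C * (1 + ‖x‖))
    (F : E d → PSpace d 1 → ℝ) (hF : Continuous fun q : E d × PSpace d 1 => F q.1 q.2)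
    (U : E d → PSpace d 2 → ℝ)
    (DmU : E d → PSpace d 2 → E d → E d)
    (DymU DxmU : E d → PSpace d 2 → E d → E d →L[ℝ] E d)
    (DmmU : E d → PSpace d 2 → E d → E d → E d →L[ℝ] E d)
    (hU : HasContDerivs P U DmU DymU DxmU DmmU)
    (hweak : IsWeakSolution P β H F U) :
    ∃ g : PSpace d 2 → ℝ, Continuous g ∧
      IsClassicalSolution P β H (fun x m => F x m.toP1 + g m) U DmU DymU DxmU DmmU := by
  obtain ⟨L, hL⟩ := hweak.lipschitz
  refine ⟨eqResidual β H F U DmU DymU DxmU DmmU 0, continuous_of_tendsto_wnhds fun m =>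
    (hU.tendsto_residual β hH hDpH hF hL 0 m).comp (f := fun m' => ((0 : E d), m'))
      (tendsto_const_nhds.prodMk tendsto_id), hU,
    (hU.quadIntegrand_drift hH hDpH hL).integrable, hU.quadIntegrand_ym.integrable,
    hU.quadIntegrand_xm.integrable, hU.integrable_mm_prod, fun x m => ?_⟩
  have := m.isProb
  have h := le_antisymm (residual_le hP hU hH hDpH hF hweak 0 x m)
    (residual_le hP hU hH hDpH hF hweak x 0 m)
  rw [← h, eqResidual, hU.laplacian_eq_tr, integral_prod _ (hU.integrable_mm_prod x m)]
  ring
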